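/- **Setting.** Let $f(x)=\frac1N\sum_{i=1}^N f_i(x)$ on $\mathbb{R}^d$, where $f_i(x)=\mathbb{E}_{\xi\sim\mathcal D_i}[F(x;\xi)]$, and suppose $f$ is bounded from below; put $\Delta=f(x^0)-\inf f$. Assume * (sample-wise smoothness) $\|\nabla F(x;\xi)-\nabla F(y;\xi)\|\le L\|x-y\|$ for all $x,y,\xi$, with $L>0$; * (stochastic gradients) $\mathbb{E}_{\xi\sim\mathcal D_i}[\nabla F(x;\xi)]=\nabla f_i(x)$ and $\mathbb{E}_{\xi\sim\mathcal D_i}\|\nabla F(x;\xi)-\nabla f_i(x)\|^2\le\sigma^2$ for all $x,i$, with $\sigma\ge0$. No bound on the heterogeneity of the clients is assumed. **Algorithm (SCAFFOLD-M-VR)** with parameters $\eta>0,\gamma,\beta$, $1\le S\le N$, $K\ge1$, $B\ge1$. Initialize $x^{-1}=x^0$, $c_i^0=\frac1B\sum_{b=1}^B\nabla F(x^0;\xi_i^b)$ with $\xi_i^b\sim\mathcal D_i$, $g^0=c^0=\frac1N\sum_i c_i^0$. In round $r=0,1,\dots$ draw a uniformly random set $\mathcal S_r$ of $S$ clients. Each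 $i\in\mathcal S_r$ starts from $x_i^{r,0}=x^r$ and does, for $k=0,\dots,K-1$ with $\xi_i^{r,k}\sim\mathcal D_i$, $$x_i^{r,k+1}=x_i^{r,k}-\eta\big(\nabla F(x_i^{r,k};\xi_i^{r,k})-\beta(c_i^r-c^r)+(1-\beta)(g^r-\nabla F(x^{r-1};\xi_i^{r,k}))\big),$$ and sets $c_i^{r+1}=\frac1K\sum_k\nabla F(x_i^{r,k};\xi_i^{r,k})$; for $i\notin\mathcal S_r$, $c_i^{r+1}=c_i^r$. Then $g^{r+1}=\frac1{\eta SK}\sum_{i\in\mathcal S_r}(x^r-x_i^{r,K})$, $x^{r+1}=x^r-\gamma g^{r+1}$, $c^{r+1}=c^r+\frac1N\sum_{i\in\mathcal S_r}(c_i^{r+1}-c_i^r)$. All draws are independent. **Notation.** Let $R\ge1$ and $X=\left(\frac{KL\Delta}{\sigma^2R}\right)^{2/3}S^{1/3}$ ($X=+\infty$ if $\sigma=0$). In each part, $a,b$ are constants and $$\gamma=a\min\Big\{\frac1L,\frac{\sqrt{\beta S}}L\Big\},\qquad 0<\eta,\quad \eta KL\le b\,\min\Big\{\beta,\Big(\frac\beta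 S\Big)^{1/2},\Big(\frac\beta{SK}\Big)^{1/4}\Big\}.$$ **Theorem 4.** 1. There is a numerical constant $a_0>0$ such that for every $a\in(0,a_0]$ there are $b,C>0$ depending only on $a$ with the following property. If $\beta=\min\{\frac SN,X\}$ and $B=\left\lceil\max\left\{\frac{SK}{NR\beta^2},\frac{NK}{SR}\right\}\right\rceil$, then $$\frac1R\sum_{r=0}^{R-1}\mathbb{E}\|\nabla f(x^r)\|^2\le C\left[\left(\frac{L\Delta\sigma}{S\sqrt KR}\right)^{2/3}+\frac{L\Delta}R\Big(1+\frac{N^{1/2}}S\Big)\right].$$ 2. For all $c,b_1,b_2>0$ there is $a_0>0$ such that for every $a\in(0,a_0]$ there are $b,C>0$, depending only on $c,b_1,b_2,a$, with the following property. Suppose $R\ge cN/S$ and $b_1\frac{SKR}N\le B\le b_2\frac{SKR}N$. (i) If $\beta=\min\{\frac SN,X\}$, then $$\frac1R\sum_{r=0}^{R-1}\mathbb{E}\|\nabla f(x^r)\|^2\le C\left[\left(\frac{L\Delta\sigma}{S\sqrt KR}\right)^{2/3}+\frac{L\Delta}R\Big(1+\frac{N^{1/2}}S\Big)+\frac{\sigma^2}{SKR}\right].$$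 (ii) If $\beta=\min\{\frac1R,X\}$, then the same bound holds with $\frac{L\Delta}{\sqrt{SR}}$ added inside the brackets. -/

import Mathlib

open MeasureTheory

noncomputable section

namespace FedLearn

/-- The parameter space `ℝ^d` with its Euclidean norm. -/
abbrev Vec (d : ℕ) : Type := EuclideanSpace ℝ (Fin d)

/-- The stochastic gradient `∇F(x; ξ)`, the gradient being taken in `x`. -/
def sampleGrad {d : ℕ} {Ξ : Type*} (F : Vec d → Ξ → ℝ) (x : Vec d) (ξ : Ξ) : Vec d :=
  gradient (fun y => F y ξ) x

/-- The loss of client `i`: `f_i(x) = 𝔼_{ξ ∼ D_i} F(x; ξ)`. -/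
def localLoss {d N : ℕ} {Ξ : Type*} [MeasurableSpace Ξ] (F : Vec d → Ξ → ℝ)
    (D : Fin N → Measure Ξ) (i : Fin N) (x : Vec d) : ℝ :=
  ∫ ξ, F x ξ ∂(D i)

/-- The objective `f(x) = (1/N) ∑_i f_i(x)`. -/
def globalLoss {d N : ℕ} {Ξ : Type*} [MeasurableSpace Ξ] (F : Vec d → Ξ → ℝ)
    (D : Fin N → Measure Ξ) (x : Vec d) : ℝ :=
  (1 / (N : ℝ)) * ∑ i, localLoss F D i x

/-- The initial gap `Δ = f(x⁰) - inf f`. -/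
def initialGap {d N : ℕ} {Ξ : Type*} [MeasurableSpace Ξ] (F : Vec d → Ξ → ℝ)
    (D : Fin N → Measure Ξ) (x₀ : Vec d) : ℝ :=
  globalLoss F D x₀ - ⨅ x, globalLoss F D x

/-- The problem is well posed: the losses `f_i` are defined and `f` is bounded from below. -/
structure WellPosed {d N : ℕ} {Ξ : Type*} [MeasurableSpace Ξ] (F : Vec d → Ξ → ℝ)
    (D : Fin N → Measure Ξ) : Prop where
  measurable : ∀ x, Measurable (F x)
  integrable : ∀ i x, Integrable (F x) (D i)
  bddBelow : BddBelow (Set.range (globalLoss F D))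

/-- Sample-wise smoothness: every `F(·; ξ)` is differentiable with `L`-Lipschitz gradient. -/
structure SampleSmooth {d : ℕ} {Ξ : Type*} (F : Vec d → Ξ → ℝ) (L : ℝ) : Prop where
  differentiable : ∀ ξ, Differentiable ℝ (fun x => F x ξ)
  lipschitz : ∀ ξ x y, ‖sampleGrad F x ξ - sampleGrad F y ξ‖ ≤ L * ‖x - y‖

/-- The stochastic gradients are unbiased and have variance at most `σ²` at every point. -/
structure StochasticGradient {d N : ℕ} {Ξ : Type*} [MeasurableSpace Ξ] (F : Vec d → Ξ → ℝ)
    (D : Fin N → Measure Ξ) (σ : ℝ) : Prop where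
  integrable : ∀ i x, Integrable (sampleGrad F x) (D i)
  unbiased : ∀ i x, ∫ ξ, sampleGrad F x ξ ∂(D i) = gradient (localLoss F D i) x
  integrable_sq : ∀ i x,
    Integrable (fun ξ => ‖sampleGrad F x ξ - gradient (localLoss F D i) x‖ ^ 2) (D i)
  variance_le : ∀ i x,
    ∫ ξ, ‖sampleGrad F x ξ - gradient (localLoss F D i) x‖ ^ 2 ∂(D i) ≤ σ ^ 2

/-! ### The algorithm -/

/-- The variables at the start of round `r`: `x^r`, `x^{r-1}`, `g^r`, `(c_i^r)_i` and `c^r`. -/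
structure State (d N : ℕ) where
  x : Vec d
  xPrev : Vec d
  g : Vec d
  ci : Fin N → Vec d
  c : Vec d

/-- The initialization from `B` samples per client, where `ξ (i, b)` is `ξ_i^b`:
`x^{-1} = x^0`, `c_i^0 = (1/B) ∑_b ∇F(x^0; ξ_i^b)`, `g^0 = c^0 = (1/N) ∑_i c_i^0`. -/
def initState {d N : ℕ} {Ξ : Type*} (F : Vec d → Ξ → ℝ) (B : ℕ) (x₀ : Vec d)
    (ξ : Fin N × ℕ → Ξ) : State d N :=
  let ci : Fin N → Vec d := fun i =>
    (1 / (B : ℝ)) • ∑ b ∈ Finset.range B, sampleGrad F x₀ (ξ (i, b))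
  let c : Vec d := (1 / (N : ℝ)) • ∑ i, ci i
  { x := x₀, xPrev := x₀, g := c, ci := ci, c := c }

/-- The local models `x_i^{r,k}` of client `i`, where `ξ k` is `ξ_i^{r,k}`. -/
def localModel {d N : ℕ} {Ξ : Type*} (F : Vec d → Ξ → ℝ) (η β : ℝ) (s : State d N)
    (i : Fin N) (ξ : ℕ → Ξ) : ℕ → Vec d
  | 0 => s.x
  | k + 1 =>
    let y := localModel F η β s i ξ k
    y - η • (sampleGrad F y (ξ k) - β • (s.ci i - s.c)
      + (1 - β) • (s.g - sampleGrad F s.xPrev (ξ k)))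

/-- One communication round, with participating clients `P` and local samples
`ξ (i, k) = ξ_i^{r,k}`. -/
def round {d N : ℕ} {Ξ : Type*} (F : Vec d → Ξ → ℝ) (η γ β : ℝ) (S K : ℕ) (s : State d N)
    (P : Finset (Fin N)) (ξ : Fin N × ℕ → Ξ) : State d N :=
  let y : Fin N → ℕ → Vec d := fun i => localModel F η β s i (fun k => ξ (i, k))
  let g' : Vec d := (1 / (η * S * K)) • ∑ i ∈ P, (s.x - y i K)
  let ci' : Fin N → Vec d := fun i =>
    if i ∈ P then (1 / (K : ℝ)) • ∑ k ∈ Finset.range K, sampleGrad F (y i k) (ξ (i, k))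
    else s.ci i
  { x := s.x - γ • g'
    xPrev := s.x
    g := g'
    ci := ci'
    c := s.c + (1 / (N : ℝ)) • ∑ i ∈ P, (ci' i - s.ci i) }

/-- All random draws: the initial samples `ξ_i^b`, the local samples `ξ_i^{r,k}` and the sets of
participating clients. -/
abbrev Draws (N : ℕ) (Ξ : Type*) : Type _ :=
  (Fin N × ℕ → Ξ) × (ℕ × Fin N × ℕ → Ξ) × (ℕ → Finset (Fin N))

/-- The state at the start of round `r`. -/
def state {d N : ℕ} {Ξ : Type*} (F : Vec d → Ξ → ℝ) (η γ β : ℝ) (S K B : ℕ) (x₀ : Vec d)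
    (ω : Draws N Ξ) : ℕ → State d N
  | 0 => initState F B x₀ ω.1
  | r + 1 => round F η γ β S K (state F η γ β S K B x₀ ω r) (ω.2.2 r)
      (fun j => ω.2.1 (r, j.1, j.2))

/-- The uniform distribution on the sets of exactly `S` among `N` clients. -/
def uniformClients (N S : ℕ) (hS : S ≤ N) : Measure (Finset (Fin N)) :=
  (PMF.uniformOfFinset (Finset.powersetCard S Finset.univ)
    (Finset.powersetCard_nonempty.2 (by simpa using hS))).toMeasure

instance (N S : ℕ) (hS : S ≤ N) : IsProbabilityMeasure (uniformClients N S hS) := by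
  unfold uniformClients; infer_instance

/-- The law of the draws: all of them are independent, the samples of client `i` have law `D i`,
and the sets of participating clients are uniform among those of size `S`. -/
def drawsLaw {N : ℕ} {Ξ : Type*} [MeasurableSpace Ξ] (D : Fin N → Measure Ξ)
    [∀ i, IsProbabilityMeasure (D i)] (S : ℕ) (hS : S ≤ N) : Measure (Draws N Ξ) :=
  (Measure.infinitePi (fun j : Fin N × ℕ => D j.1)).prod
    ((Measure.infinitePi (fun j : ℕ × Fin N × ℕ => D j.2.1)).prod
      (Measure.infinitePi (fun _ : ℕ => uniformClients N S hS)))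

/-- `(1/R) ∑_{r<R} 𝔼 ‖∇f(x^r)‖² ≤ bound`, all these expectations being finite. -/
def AvgGradSqLE {d N : ℕ} {Ξ : Type*} [MeasurableSpace Ξ] (F : Vec d → Ξ → ℝ)
    (D : Fin N → Measure Ξ) [∀ i, IsProbabilityMeasure (D i)] (η γ β : ℝ) (S : ℕ) (hS : S ≤ N)
    (K B R : ℕ) (x₀ : Vec d) (bound : ℝ) : Prop :=
  (∀ r < R, Integrable
    (fun ω => ‖gradient (globalLoss F D) (state F η γ β S K B x₀ ω r).x‖ ^ 2)
    (drawsLaw D S hS)) ∧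
  (1 / (R : ℝ)) * ∑ r ∈ Finset.range R,
    ∫ ω, ‖gradient (globalLoss F D) (state F η γ β S K B x₀ ω r).x‖ ^ 2 ∂(drawsLaw D S hS)
      ≤ bound

/-! ### Parameters and rate -/

/-- `min {θ, (K L Δ / (σ² R))^{2/3} S^{1/3}}`; for `σ = 0` the second entry is `+∞`. -/
def momentum (θ L Δ σ : ℝ) (S K R : ℕ) : ℝ :=
  if σ = 0 then θ
  else min θ ((K * L * Δ / (σ ^ 2 * R)) ^ (2 / 3 : ℝ) * (S : ℝ) ^ (1 / 3 : ℝ))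

/-- The global learning rate `γ = a min {1/L, √(β S)/L}`. -/
def globalRate (a L β : ℝ) (S : ℕ) : ℝ :=
  a * min (1 / L) (√(β * S) / L)

/-- The local learning rate is small:
`0 < η` and `η K L ≤ b min {β, (β/S)^{1/2}, (β/(S K))^{1/4}}`. -/
def SmallLocalRate (b L β η : ℝ) (S K : ℕ) : Prop :=
  0 < η ∧ η * K * L ≤ b * min β (min ((β / S) ^ (1 / 2 : ℝ)) ((β / (S * K)) ^ (1 / 4 : ℝ)))

/-- `(L Δ σ / (S √K R))^{2/3} + (L Δ / R) (1 + N^{1/2} / S)`. -/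
def mainRate (L Δ σ : ℝ) (N S K R : ℕ) : ℝ :=
  (L * Δ * σ / (S * √K * R)) ^ (2 / 3 : ℝ) + L * Δ / R * (1 + √N / S)

end FedLearn

end

/-!
The proof follows the Lyapunov function
`Φ_n = (f(x^r) - inf f) + A_n ‖g^r - ∇f(x^{r-1})‖² + V · (1/N) ∑_i ‖c_i^r - ∇f_i(x^{r-1})‖²
  + ‖x^r - x^{r-1}‖² / (4γ)` through the rounds, where `n` is the number of rounds that remain.

* *Descent.* An inexact gradient step decreases `f` by a multiple of `γ (‖∇f‖² + ‖g^{r+1}‖²)`, up to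
  `γ / 2` times the momentum error (`globalLoss_step_le`). The term in `‖g^{r+1}‖²` pays for the new
  last term of `Φ`.
* *Momentum.* The new momentum error is the old one times `1 - β`, plus a centred term coming from
  the sampled clients and their samples, plus the effect of the local drift (`dirErr_round_eq`). Since
  the gradients at `x^r` and `x^{r-1}` are taken at the same samples, samplewise smoothness bounds
  the centred term by `L²‖x^r - x^{r-1}‖² / S` and `β²σ² / (SK)`; since the control variates are
  subtracted, the spread of the `∇f_i` over the clients enters only through `β²` times the error of
  the control variates, and no bound on the heterogeneity is needed (`avg_norm_dirDev_sq_le`).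
* *Control variates.* Each is refreshed with probability `S / N`, so their error contracts at this
  rate (`roundLE_ctrlErr`).
* *Local drift.* For small `ηKL` the drift is absorbed into itself; the noise enters it only at the
  point `x^{r-1}`, which is independent of the samples of the round (`drift_le`).

The expectation over one round is taken for a fixed past. This is justified by replacing the draws of
that round by an independent copy (`lintegral_drawsLaw_eq`). Within the round, independence
gives the variance of the sum over the samples (`integral_norm_add_sum_sq`), and sampling the clients
without replacement has at most the variance of sampling with replacement
(`clientAvg_norm_sum_mem_sq_le`).

With `A_{n+1} = (1 - β) A_n + γ`, `A_0 = 0` and a suitable `V`, one round gives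
`𝔼 Φ_n + (γ / 4) 𝔼‖∇f(x^r)‖² ≤ 𝔼 Φ_{n+1} + 73 γβσ² / (SK)` (`roundLE_lyapunov`), and telescoping
bounds the average of `‖∇f‖²` by multiples of `Δ / (γR)`, `βσ² / (SK)` and the errors of the initialization
(`avgGradSqLE_of_smallRates`). As `A_n ≤ γ min {n, 1 / β}`, the initial momentum error costs at most a
multiple of `min {1, 1 / (βR)} σ² / (NB)`. The cap `X` on `β` is the value at which `βσ² / (SK)` and
`LΔ / (R √(βS))` are both equal to the first term of the rate (`momentum_mul_noise_le`,
`gap_div_sqrt_momentum_le`), and the choices of the batch `B` keep the cost of the initialization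
within the stated bounds.
-/

namespace FedLearn

open scoped RealInnerProductSpace

/-! ### Smoothness of the losses -/

section Smooth

variable {E : Type*} [NormedAddCommGroup E] [InnerProductSpace ℝ E] [CompleteSpace E]

/-- First-order Taylor bound for a function with `L`-Lipschitz gradient. The mean value inequality
gives the constant `L`, which is enough here, instead of the optimal `L / 2`. -/
lemma abs_sub_sub_inner_gradient_le {φ : E → ℝ} {L : ℝ} (hφ : Differentiable ℝ φ)
    (hL : ∀ x y, ‖gradient φ x - gradient φ y‖ ≤ L * ‖x - y‖) (hL0 : 0 ≤ L) (x y : E) :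
    |φ y - φ x - ⟪gradient φ x, y - x⟫| ≤ L * ‖y - x‖ ^ 2 := by
  have key := (convex_closedBall x ‖y - x‖).norm_image_sub_le_of_norm_fderiv_le' (𝕜 := ℝ)
    (f := φ) (φ := fderiv ℝ φ x) (C := L * ‖y - x‖) (x := x) (y := y)
    (fun z _ => hφ z) ?_ (by simp) (by simp [dist_eq_norm])
  · rw [← inner_gradient_left, Real.norm_eq_abs] at key
    calc _ ≤ _ := key
      _ = _ := by ring
  · intro z hz
    rw [← toDual_gradient, ← toDual_gradient, ← map_sub, LinearIsometryEquiv.norm_map]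
    refine (hL z x).trans ?_
    gcongr
    simpa [dist_eq_norm] using hz

/-- A quadratic first-order expansion identifies the gradient. -/
lemma hasGradientAt_of_abs_le {φ : E → ℝ} {C : ℝ} {x v : E}
    (h : ∀ y, |φ y - φ x - ⟪v, y - x⟫| ≤ C * ‖y - x‖ ^ 2) : HasGradientAt φ v x := by
  rw [hasGradientAt_iff_isLittleO]
  have h1 : (fun y => φ y - φ x - ⟪v, y - x⟫) =O[nhds x] fun y => ‖y - x‖ ^ 2 :=
    Asymptotics.IsBigO.of_bound C (Filter.Eventually.of_forall fun y => by
      simpa [Real.norm_eq_abs] using h y)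
  refine h1.trans_isLittleO ?_
  have h2 : (fun y : E => ‖y - x‖ ^ 2) =o[nhds x] fun y => ‖y - x‖ := by
    have := (Asymptotics.isLittleO_pow_id (𝕜 := ℝ) (one_lt_two)).comp_tendsto
      (tendsto_norm_sub_self x)
    simpa [Function.comp_def] using this
  exact h2.of_norm_right

end Smooth

section Problem

variable {d N : ℕ} {Ξ : Type*} {F : Vec d → Ξ → ℝ} {L σ : ℝ}

lemma continuous_sampleGrad (hs : SampleSmooth F L) (hL : 0 ≤ L) (ξ : Ξ) :
    Continuous fun x => sampleGrad F x ξ := by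
  refine (LipschitzWith.of_dist_le_mul (K := L.toNNReal) fun x y => ?_).continuous
  simpa [dist_eq_norm, hL] using hs.lipschitz ξ x y

lemma norm_sampleGrad_sub_sq_le (hs : SampleSmooth F L) (x y : Vec d)
    (ξ : Ξ) : ‖sampleGrad F x ξ - sampleGrad F y ξ‖ ^ 2 ≤ L ^ 2 * ‖x - y‖ ^ 2 := by
  rw [← mul_pow]
  exact pow_le_pow_left₀ (norm_nonneg _) (hs.lipschitz ξ x y) 2

variable [MeasurableSpace Ξ] {D : Fin N → Measure Ξ}

lemma measurable_sampleGrad (hw : WellPosed F D) (hs : SampleSmooth F L) (x : Vec d) :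
    Measurable (sampleGrad F x) := by
  have hcoord : ∀ l : Fin d, Measurable fun ξ => (sampleGrad F x ξ) l := by
    intro l
    set e : Vec d := EuclideanSpace.single l 1 with he
    refine measurable_of_tendsto_metrizable
      (f := fun (n : ℕ) ξ => (n : ℝ) * (F (x + (n : ℝ)⁻¹ • e) ξ - F x ξ)) ?_ ?_
    · intro n
      exact ((hw.measurable _).sub (hw.measurable _)).const_mul _
    · rw [tendsto_pi_nhds]
      intro ξ
      have h1 := ((hs.differentiable ξ) x).hasFDerivAt.lim (v := e)
        (c := fun n : ℕ => (n : ℝ)) (l := Filter.atTop) ?_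
      · have h2 : (sampleGrad F x ξ) l = fderiv ℝ (fun x => F x ξ) x e := by
          rw [← inner_gradient_left, he, EuclideanSpace.inner_single_right]
          simp [sampleGrad]
        rw [h2]
        simpa [smul_eq_mul] using h1
      · simpa using tendsto_natCast_atTop_atTop (R := ℝ)
  have h := (PiLp.continuous_toLp 2 (fun _ : Fin d => ℝ)).measurable.comp (measurable_pi_iff.2 hcoord)
  exact h

/-- Stochastic gradients are jointly measurable in the point and the sample. -/
lemma measurable_uncurry_sampleGrad (hw : WellPosed F D) (hs : SampleSmooth F L) (hL : 0 ≤ L) :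
    Measurable (Function.uncurry (sampleGrad F)) :=
  measurable_uncurry_of_continuous_of_measurable (continuous_sampleGrad hs hL)
    (measurable_sampleGrad hw hs)

/-- Each client loss inherits the quadratic Taylor bound by integrating the samplewise one. -/
lemma abs_localLoss_sub_le [∀ i, IsProbabilityMeasure (D i)] (hL : 0 < L) (hw : WellPosed F D)
    (hs : SampleSmooth F L) (hg : StochasticGradient F D σ) (i : Fin N) (x y : Vec d) :
    |localLoss F D i y - localLoss F D i x - ⟪gradient (localLoss F D i) x, y - x⟫|
      ≤ L * ‖y - x‖ ^ 2 := by
  have h1 : localLoss F D i y - localLoss F D i x - ⟪gradient (localLoss F D i) x, y - x⟫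
      = ∫ ξ, (F y ξ - F x ξ - ⟪sampleGrad F x ξ, y - x⟫) ∂(D i) := by
    have e1 : ∫ ξ, (F y ξ - F x ξ) ∂(D i) = localLoss F D i y - localLoss F D i x :=
      integral_sub (hw.integrable i y) (hw.integrable i x)
    have e2 : ∫ ξ, ⟪sampleGrad F x ξ, y - x⟫ ∂(D i) = ⟪gradient (localLoss F D i) x, y - x⟫ := by
      rw [← hg.unbiased i x, real_inner_comm, ← integral_inner (hg.integrable i x)]
      simp_rw [real_inner_comm]
    have e3 : Integrable (fun ξ => F y ξ - F x ξ) (D i) :=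
      (hw.integrable i y).sub (hw.integrable i x)
    rw [integral_sub e3 ((hg.integrable i x).inner_const _), e1, e2]
  rw [h1]
  have h2 := norm_integral_le_of_norm_le_const (μ := D i) (C := L * ‖y - x‖ ^ 2)
    (f := fun ξ => F y ξ - F x ξ - ⟪sampleGrad F x ξ, y - x⟫)
    (Filter.Eventually.of_forall fun ξ => by
      rw [Real.norm_eq_abs]
      exact abs_sub_sub_inner_gradient_le (hs.differentiable ξ) (hs.lipschitz ξ) hL.le x y)
  simpa using h2

lemma hasGradientAt_localLoss [∀ i, IsProbabilityMeasure (D i)] (hL : 0 < L) (hw : WellPosed F D)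
    (hs : SampleSmooth F L) (hg : StochasticGradient F D σ) (i : Fin N) (x : Vec d) :
    HasGradientAt (localLoss F D i) (gradient (localLoss F D i) x) x :=
  hasGradientAt_of_abs_le (abs_localLoss_sub_le hL hw hs hg i x)

lemma gradient_globalLoss [∀ i, IsProbabilityMeasure (D i)] (hL : 0 < L) (hw : WellPosed F D)
    (hs : SampleSmooth F L) (hg : StochasticGradient F D σ) (x : Vec d) :
    gradient (globalLoss F D) x = (1 / (N : ℝ)) • ∑ i, gradient (localLoss F D i) x := by
  refine HasGradientAt.gradient ?_
  rw [hasGradientAt_iff_hasFDerivAt, map_smul, map_sum]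
  exact (HasFDerivAt.fun_sum fun i _ =>
    (hasGradientAt_iff_hasFDerivAt.1 (hasGradientAt_localLoss hL hw hs hg i x))).const_mul _

lemma abs_globalLoss_sub_le [∀ i, IsProbabilityMeasure (D i)] (hL : 0 < L) (hw : WellPosed F D)
    (hs : SampleSmooth F L) (hg : StochasticGradient F D σ) (hN : 0 < N) (x y : Vec d) :
    |globalLoss F D y - globalLoss F D x - ⟪gradient (globalLoss F D) x, y - x⟫|
      ≤ L * ‖y - x‖ ^ 2 := by
  have hN' : (0 : ℝ) < N := by exact_mod_cast hN
  have h1 : globalLoss F D y - globalLoss F D x - ⟪gradient (globalLoss F D) x, y - x⟫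
      = (1 / (N : ℝ)) * ∑ i, (localLoss F D i y - localLoss F D i x
          - ⟪gradient (localLoss F D i) x, y - x⟫) := by
    rw [gradient_globalLoss hL hw hs hg, real_inner_smul_left, sum_inner, globalLoss, globalLoss,
      Finset.sum_sub_distrib, Finset.sum_sub_distrib]
    ring
  rw [h1, abs_mul, abs_of_pos (by positivity)]
  calc (1 / (N : ℝ)) * |∑ i, (localLoss F D i y - localLoss F D i x
          - ⟪gradient (localLoss F D i) x, y - x⟫)|
      ≤ (1 / (N : ℝ)) * ∑ _i : Fin N, L * ‖y - x‖ ^ 2 := by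
        gcongr
        exact (Finset.abs_sum_le_sum_abs _ _).trans
          (Finset.sum_le_sum fun i _ => abs_localLoss_sub_le hL hw hs hg i x y)
    _ = L * ‖y - x‖ ^ 2 := by
        rw [Finset.sum_const, Finset.card_univ, Fintype.card_fin, nsmul_eq_mul]
        field_simp

lemma norm_gradient_localLoss_sub_le [∀ i, IsProbabilityMeasure (D i)]
    (hs : SampleSmooth F L) (hg : StochasticGradient F D σ) (i : Fin N) (x y : Vec d) :
    ‖gradient (localLoss F D i) x - gradient (localLoss F D i) y‖ ≤ L * ‖x - y‖ := by
  rw [← hg.unbiased i x, ← hg.unbiased i y, ← integral_sub (hg.integrable i x) (hg.integrable i y)]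
  have h2 := norm_integral_le_of_norm_le_const (μ := D i) (C := L * ‖x - y‖)
    (f := fun ξ => sampleGrad F x ξ - sampleGrad F y ξ)
    (Filter.Eventually.of_forall fun ξ => hs.lipschitz ξ x y)
  simpa using h2

lemma norm_gradient_localLoss_sub_sq_le [∀ i, IsProbabilityMeasure (D i)]
    (hs : SampleSmooth F L) (hg : StochasticGradient F D σ) (i : Fin N) (x y : Vec d) :
    ‖gradient (localLoss F D i) x - gradient (localLoss F D i) y‖ ^ 2 ≤ L ^ 2 * ‖x - y‖ ^ 2 := by
  rw [← mul_pow]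
  exact pow_le_pow_left₀ (norm_nonneg _) (norm_gradient_localLoss_sub_le hs hg i x y) 2

/-- Jensen's inequality for the uniform average over the clients. -/
lemma norm_avg_sq_le {N : ℕ} (hN : 0 < N) (v : Fin N → Vec d) :
    ‖(1 / (N : ℝ)) • ∑ i, v i‖ ^ 2 ≤ (1 / (N : ℝ)) * ∑ i, ‖v i‖ ^ 2 := by
  have hN' : (0 : ℝ) < N := by exact_mod_cast hN
  have h1 : ‖∑ i, v i‖ ^ 2 ≤ N * ∑ i, ‖v i‖ ^ 2 := by
    refine (pow_le_pow_left₀ (norm_nonneg _) (norm_sum_le _ _) 2).trans ?_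
    simpa using sq_sum_le_card_mul_sum_sq (s := Finset.univ) (f := fun i => ‖v i‖)
  rw [norm_smul, mul_pow, Real.norm_of_nonneg (by positivity)]
  calc (1 / (N : ℝ)) ^ 2 * ‖∑ i, v i‖ ^ 2 ≤ (1 / (N : ℝ)) ^ 2 * (N * ∑ i, ‖v i‖ ^ 2) := by gcongr
    _ = _ := by field_simp

lemma norm_gradient_globalLoss_sub_sq_le [∀ i, IsProbabilityMeasure (D i)] (hL : 0 < L)
    (hw : WellPosed F D) (hs : SampleSmooth F L) (hg : StochasticGradient F D σ) (hN : 0 < N)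
    (x y : Vec d) :
    ‖gradient (globalLoss F D) x - gradient (globalLoss F D) y‖ ^ 2 ≤ L ^ 2 * ‖x - y‖ ^ 2 := by
  have hN' : (0 : ℝ) < N := by exact_mod_cast hN
  rw [gradient_globalLoss hL hw hs hg, gradient_globalLoss hL hw hs hg, ← smul_sub,
    ← Finset.sum_sub_distrib]
  refine (norm_avg_sq_le hN _).trans ?_
  calc _ ≤ (1 / (N : ℝ)) * ∑ _i : Fin N, L ^ 2 * ‖x - y‖ ^ 2 := by
        gcongr with i
        exact norm_gradient_localLoss_sub_sq_le hs hg i x y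
    _ = _ := by
        rw [Finset.sum_const, Finset.card_univ, Fintype.card_fin, nsmul_eq_mul]
        field_simp

lemma continuous_gradient_localLoss [∀ i, IsProbabilityMeasure (D i)] (hL : 0 < L)
    (hs : SampleSmooth F L) (hg : StochasticGradient F D σ) (i : Fin N) :
    Continuous (gradient (localLoss F D i)) := by
  refine (LipschitzWith.of_dist_le_mul (K := L.toNNReal) fun x y => ?_).continuous
  simpa [dist_eq_norm, hL.le] using norm_gradient_localLoss_sub_le hs hg i x y

lemma continuous_gradient_globalLoss [∀ i, IsProbabilityMeasure (D i)] (hL : 0 < L)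
    (hw : WellPosed F D) (hs : SampleSmooth F L) (hg : StochasticGradient F D σ) :
    Continuous (gradient (globalLoss F D)) := by
  rw [funext (gradient_globalLoss hL hw hs hg)]
  exact (continuous_finsetSum _ fun i _ =>
    continuous_gradient_localLoss hL hs hg i).const_smul (1 / (N : ℝ))

lemma continuous_globalLoss [∀ i, IsProbabilityMeasure (D i)] (hL : 0 < L)
    (hw : WellPosed F D) (hs : SampleSmooth F L) (hg : StochasticGradient F D σ) :
    Continuous (globalLoss F D) := by
  have h : ∀ i, Continuous (localLoss F D i) := fun i => continuous_iff_continuousAt.2 fun x =>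
    (hasGradientAt_localLoss hL hw hs hg i x).differentiableAt.continuousAt
  exact (continuous_finsetSum _ fun i _ => h i).const_mul _

/-- Descent along an inexact gradient step: the decrease of `f` dominates `‖∇f‖²` and `‖g‖²`, up to
the squared error of the direction `g`. -/
lemma globalLoss_step_le [∀ i, IsProbabilityMeasure (D i)] (hL : 0 < L)
    (hw : WellPosed F D) (hs : SampleSmooth F L) (hg : StochasticGradient F D σ) (hN : 0 < N)
    {γ : ℝ} (hγ : 0 < γ) (hγL : γ * L ≤ 1 / 4) (x g : Vec d) :
    globalLoss F D (x - γ • g) ≤ globalLoss F D x - γ / 2 * ‖gradient (globalLoss F D) x‖ ^ 2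
      - γ / 4 * ‖g‖ ^ 2 + γ / 2 * ‖g - gradient (globalLoss F D) x‖ ^ 2 := by
  have h := (abs_le.1 (abs_globalLoss_sub_le hL hw hs hg hN x (x - γ • g))).2
  set u := gradient (globalLoss F D) x
  have e1 : x - γ • g - x = -(γ • g) := by abel
  rw [e1, inner_neg_right, real_inner_smul_right, norm_neg, norm_smul, mul_pow,
    Real.norm_of_nonneg hγ.le] at h
  have e2 : ‖g - u‖ ^ 2 = ‖g‖ ^ 2 - 2 * ⟪u, g⟫ + ‖u‖ ^ 2 := by
    rw [norm_sub_sq_real, real_inner_comm]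
  rw [e2]
  have e3 : L * (γ ^ 2 * ‖g‖ ^ 2) ≤ γ / 4 * ‖g‖ ^ 2 := by
    have : γ * L * (γ * ‖g‖ ^ 2) ≤ 1 / 4 * (γ * ‖g‖ ^ 2) := by gcongr
    linarith
  nlinarith

end Problem

/-! ### Sums of independent centred vectors -/

section Independent

open ProbabilityTheory

variable {ι Ξ : Type*} [MeasurableSpace Ξ] {d : ℕ} {μ : ι → Measure Ξ}
  [∀ j, IsProbabilityMeasure (μ j)] {Z : ι → Ξ → Vec d}

/-- Under a product measure, a sum of centred functions of distinct coordinates has the sum of the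
variances as its second moment. -/
lemma integral_norm_add_sum_sq (hZ : ∀ j, Measurable (Z j))
    (hZ2 : ∀ j, Integrable (fun ξ => ‖Z j ξ‖ ^ 2) (μ j)) (hZ0 : ∀ j, ∫ ξ, Z j ξ ∂(μ j) = 0)
    (v : Vec d) (T : Finset ι) :
    Integrable (fun ω => ‖v + ∑ j ∈ T, Z j (ω j)‖ ^ 2) (Measure.infinitePi μ) ∧
      ∫ ω, ‖v + ∑ j ∈ T, Z j (ω j)‖ ^ 2 ∂(Measure.infinitePi μ)
        = ‖v‖ ^ 2 + ∑ j ∈ T, ∫ ξ, ‖Z j ξ‖ ^ 2 ∂(μ j) := by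
  classical
  have hmp := fun j => measurePreserving_eval_infinitePi μ j
  have hmeas : ∀ j, Measurable fun ω : ι → Ξ => Z j (ω j) := fun j =>
    (hZ j).comp (measurable_pi_apply j)
  have hL2 : ∀ j, MemLp (fun ω : ι → Ξ => Z j (ω j)) 2 (Measure.infinitePi μ) := fun j =>
    ((memLp_two_iff_integrable_sq_norm (hZ j).aestronglyMeasurable).2
      (hZ2 j)).comp_measurePreserving (hmp j)
  have hsumL2 : ∀ T : Finset ι, MemLp (fun ω : ι → Ξ => v + ∑ j ∈ T, Z j (ω j)) 2
      (Measure.infinitePi μ) := fun T =>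
    (memLp_const v).add (memLp_finsetSum T fun j _ => hL2 j)
  have hind : iIndepFun (fun j (ω : ι → Ξ) => Z j (ω j)) (Measure.infinitePi μ) :=
    iIndepFun_infinitePi hZ
  have hint : ∀ T : Finset ι, Integrable (fun ω : ι → Ξ => ‖v + ∑ j ∈ T, Z j (ω j)‖ ^ 2)
      (Measure.infinitePi μ) := fun T =>
    (memLp_two_iff_integrable_sq_norm (hsumL2 T).1).1 (hsumL2 T)
  refine ⟨hint T, ?_⟩
  induction T using Finset.induction_on with
  | empty => simp
  | insert a T ha ih =>
    have hi : IndepFun (fun ω : ι → Ξ => v + ∑ j ∈ T, Z j (ω j)) (fun ω => Z a (ω a))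
        (Measure.infinitePi μ) := by
      have h := (hind.indepFun_finsetSum_of_notMem hmeas ha).comp
        (φ := fun w : Vec d => v + w) (ψ := id) (by fun_prop) measurable_id
      simpa [Function.comp_def] using h
    have hcross : ∫ ω, ⟪v + ∑ j ∈ T, Z j (ω j), Z a (ω a)⟫ ∂(Measure.infinitePi μ) = 0 := by
      have h0 : ∫ ω, Z a (ω a) ∂(Measure.infinitePi μ) = 0 := by
        have h := integral_map (μ := Measure.infinitePi μ) (φ := Function.eval a) (f := Z a)
          (measurable_pi_apply a).aemeasurable (hZ a).aestronglyMeasurable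
        rw [(hmp a).map_eq, hZ0 a] at h
        exact h.symm
      refine (hi.integral_bilin ((hsumL2 T).integrable one_le_two)
        ((hL2 a).integrable one_le_two) (innerSL ℝ)).trans ?_
      rw [h0, map_zero]
    have hcrossint : Integrable (fun ω => ⟪v + ∑ j ∈ T, Z j (ω j), Z a (ω a)⟫)
        (Measure.infinitePi μ) := by
      exact hi.integrable_bilin ((hsumL2 T).integrable one_le_two)
        ((hL2 a).integrable one_le_two) (innerSL ℝ)
    have hsq : ∫ ω, ‖Z a (ω a)‖ ^ 2 ∂(Measure.infinitePi μ) = ∫ ξ, ‖Z a ξ‖ ^ 2 ∂(μ a) := by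
      have h := integral_map (μ := Measure.infinitePi μ) (φ := Function.eval a)
        (f := fun ξ => ‖Z a ξ‖ ^ 2) (measurable_pi_apply a).aemeasurable
        ((hZ a).norm.pow_const 2).aestronglyMeasurable
      rw [(hmp a).map_eq] at h
      exact h.symm
    have hexp : ∀ ω : ι → Ξ, ‖v + ∑ j ∈ insert a T, Z j (ω j)‖ ^ 2
        = ‖v + ∑ j ∈ T, Z j (ω j)‖ ^ 2 + 2 * ⟪v + ∑ j ∈ T, Z j (ω j), Z a (ω a)⟫
          + ‖Z a (ω a)‖ ^ 2 := by
      intro ω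
      rw [Finset.sum_insert ha, ← norm_add_sq_real]
      congr 2
      abel
    simp_rw [hexp]
    have hadd : Integrable (fun ω : ι → Ξ => ‖v + ∑ j ∈ T, Z j (ω j)‖ ^ 2
        + 2 * ⟪v + ∑ j ∈ T, Z j (ω j), Z a (ω a)⟫) (Measure.infinitePi μ) :=
      (hint T).add (hcrossint.const_mul 2)
    rw [integral_add hadd ((memLp_two_iff_integrable_sq_norm (hL2 a).1).1 (hL2 a)),
      integral_add (hint T) (hcrossint.const_mul 2), integral_const_mul, hcross, hsq, ih,
      Finset.sum_insert ha]
    ring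

end Independent

/-! ### Averages over the sets of participating clients -/

section Sampling

variable {N S : ℕ}

/-- The average of `Θ` over the sets of exactly `S` among `N` clients. -/
noncomputable def clientAvg (N S : ℕ) (Θ : Finset (Fin N) → ℝ) : ℝ :=
  (1 / (N.choose S : ℝ)) * ∑ P ∈ Finset.powersetCard S Finset.univ, Θ P

lemma clientAvg_add (Θ₁ Θ₂ : Finset (Fin N) → ℝ) :
    clientAvg N S (fun P => Θ₁ P + Θ₂ P) = clientAvg N S Θ₁ + clientAvg N S Θ₂ := by
  simp only [clientAvg, Finset.sum_add_distrib, mul_add]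

lemma clientAvg_mul (a : ℝ) (Θ : Finset (Fin N) → ℝ) :
    clientAvg N S (fun P => a * Θ P) = a * clientAvg N S Θ := by
  simp only [clientAvg, ← Finset.mul_sum]
  ring

lemma clientAvg_const (hS : S ≤ N) (a : ℝ) : clientAvg N S (fun _ => a) = a := by
  have h : (N.choose S : ℝ) ≠ 0 := by exact_mod_cast (Nat.choose_pos hS).ne'
  simp only [clientAvg, Finset.sum_const, Finset.card_powersetCard, Finset.card_univ,
    Fintype.card_fin, nsmul_eq_mul]
  field_simp

lemma lintegral_uniformClients_le (hS : S ≤ N) {h : Finset (Fin N) → ENNReal}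
    {Θ : Finset (Fin N) → ℝ} (hΘ : ∀ P, P.card = S → h P ≤ ENNReal.ofReal (Θ P))
    (h0 : ∀ P, P.card = S → 0 ≤ Θ P) :
    ∫⁻ P, h P ∂(uniformClients N S hS) ≤ ENNReal.ofReal (clientAvg N S Θ) := by
  have hc : (0 : ℝ) < N.choose S := by exact_mod_cast Nat.choose_pos hS
  have hm : ∀ P : Finset (Fin N), (uniformClients N S hS) {P}
      = if P ∈ Finset.powersetCard S Finset.univ then ENNReal.ofReal (1 / (N.choose S : ℝ))
        else 0 := by
    intro P
    rw [uniformClients, PMF.toMeasure_apply_singleton _ _ (measurableSet_singleton P),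
      PMF.uniformOfFinset_apply, Finset.card_powersetCard, Finset.card_univ, Fintype.card_fin,
      one_div, ENNReal.ofReal_inv_of_pos hc, ENNReal.ofReal_natCast]
    split_ifs <;> rfl
  rw [lintegral_fintype]
  simp_rw [hm, mul_ite, mul_zero]
  rw [Finset.sum_ite_mem, Finset.univ_inter, clientAvg, Finset.mul_sum,
    ENNReal.ofReal_sum_of_nonneg]
  · refine Finset.sum_le_sum fun P hP => ?_
    rw [mul_comm, ENNReal.ofReal_mul (by positivity)]
    gcongr
    exact hΘ P (Finset.mem_powersetCard.1 hP).2
  · intro P hP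
    have := h0 P (Finset.mem_powersetCard.1 hP).2
    positivity

lemma card_clients_mem (hS : S ≤ N) (hS1 : 1 ≤ S) (i : Fin N) :
    ((((Finset.powersetCard S Finset.univ).filter (i ∈ ·)).card : ℕ) : ℝ)
      = S / N * N.choose S := by
  have h := Finset.card_filter_powersetCard_subset {i} (Finset.univ : Finset (Fin N)) S
    (Finset.subset_univ _) (by simpa using hS1)
  simp only [Finset.singleton_subset_iff, Finset.card_univ, Fintype.card_fin,
    Finset.card_singleton] at h
  rw [h]
  obtain ⟨s, rfl⟩ : ∃ s, S = s + 1 := ⟨S - 1, by omega⟩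
  obtain ⟨n, rfl⟩ : ∃ n, N = n + 1 := ⟨N - 1, by omega⟩
  have h2 : (((n + 1) * n.choose s : ℕ) : ℝ) = (((n + 1).choose (s + 1) * (s + 1) : ℕ) : ℝ) := by
    exact_mod_cast Nat.add_one_mul_choose_eq n s
  push_cast at h2 ⊢
  have h3 : (n : ℝ) + 1 ≠ 0 := by positivity
  field_simp
  linarith

lemma sum_mem_eq_sum_indicator {M : Type*} [AddCommMonoid M] (P : Finset (Fin N)) (u : Fin N → M) :
    ∑ i ∈ P, u i = ∑ i, if i ∈ P then u i else 0 := by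
  rw [Finset.sum_ite_mem, Finset.univ_inter]

/-- Every client participates with probability `S / N`. -/
lemma clientAvg_sum_mem (hS : S ≤ N) (hS1 : 1 ≤ S) (u : Fin N → ℝ) :
    clientAvg N S (fun P => ∑ i ∈ P, u i) = S / N * ∑ i, u i := by
  have hc : (N.choose S : ℝ) ≠ 0 := by exact_mod_cast (Nat.choose_pos hS).ne'
  have h1 : ∑ P ∈ Finset.powersetCard S (Finset.univ : Finset (Fin N)), ∑ i ∈ P, u i
      = ∑ i, (S / N * N.choose S) * u i := by
    rw [Finset.sum_congr rfl fun P _ => sum_mem_eq_sum_indicator P u, Finset.sum_comm]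
    refine Finset.sum_congr rfl fun i _ => ?_
    rw [← Finset.sum_filter, Finset.sum_const, nsmul_eq_mul, card_clients_mem hS hS1]
  rw [clientAvg, h1, ← Finset.mul_sum]
  field_simp

variable {d : ℕ}

lemma clientAvg_inner_sum_mem (hS : S ≤ N) (hS1 : 1 ≤ S) {z : Fin N → Vec d} (hz : ∑ i, z i = 0)
    (w : Vec d) : clientAvg N S (fun P => ⟪w, ∑ i ∈ P, z i⟫) = 0 := by
  simp_rw [inner_sum]
  rw [clientAvg_sum_mem hS hS1, ← inner_sum, hz, inner_zero_right, mul_zero]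

lemma exists_card_clients_mem_mem (N S : ℕ) :
    ∃ p : ℝ, 0 ≤ p ∧ ∀ i j : Fin N, i ≠ j →
      ((((Finset.powersetCard S Finset.univ).filter (fun P => i ∈ P ∧ j ∈ P)).card : ℕ) : ℝ)
        = p := by
  by_cases h2 : 2 ≤ S
  · refine ⟨((N - 2).choose (S - 2) : ℕ), by positivity, fun i j hij => ?_⟩
    have h := Finset.card_filter_powersetCard_subset {i, j} (Finset.univ : Finset (Fin N)) S
      (Finset.subset_univ _) (by rw [Finset.card_pair hij]; exact h2)
    rw [Finset.card_pair hij, Finset.card_univ, Fintype.card_fin] at h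
    rw [← h]
    simp only [Finset.insert_subset_iff, Finset.singleton_subset_iff]
  · refine ⟨0, le_rfl, fun i j hij => ?_⟩
    rw [Nat.cast_eq_zero, Finset.card_eq_zero, Finset.filter_eq_empty_iff]
    rintro P hP ⟨hi, hj⟩
    have h3 : ({i, j} : Finset (Fin N)).card ≤ P.card :=
      Finset.card_le_card (by simp [Finset.insert_subset_iff, hi, hj])
    rw [Finset.card_pair hij, (Finset.mem_powersetCard.1 hP).2] at h3
    exact h2 h3

/-- Sampling without replacement has at most the variance of sampling with replacement. -/
lemma clientAvg_norm_sum_mem_sq_le (hS : S ≤ N) (hS1 : 1 ≤ S) {z : Fin N → Vec d}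
    (hz : ∑ i, z i = 0) :
    clientAvg N S (fun P => ‖∑ i ∈ P, z i‖ ^ 2) ≤ S / N * ∑ i, ‖z i‖ ^ 2 := by
  have hc : (0 : ℝ) < N.choose S := by exact_mod_cast Nat.choose_pos hS
  obtain ⟨p, hp0, hp⟩ := exists_card_clients_mem_mem N S
  set p₁ : ℝ := S / N * N.choose S with hp₁
  have h1 : ∑ P ∈ Finset.powersetCard S (Finset.univ : Finset (Fin N)), ‖∑ i ∈ P, z i‖ ^ 2
      = ∑ i, ∑ j, (p + if i = j then p₁ - p else 0) * ⟪z i, z j⟫ := by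
    have e : ∀ P : Finset (Fin N), ‖∑ i ∈ P, z i‖ ^ 2
        = ∑ i, ∑ j, if i ∈ P ∧ j ∈ P then ⟪z i, z j⟫ else 0 := by
      intro P
      rw [← real_inner_self_eq_norm_sq, sum_inner, sum_mem_eq_sum_indicator P]
      refine Finset.sum_congr rfl fun i _ => ?_
      by_cases hi : i ∈ P
      · simp only [hi, if_true, true_and]
        rw [inner_sum, sum_mem_eq_sum_indicator P]
      · simp [hi]
    simp_rw [e]
    rw [Finset.sum_comm]
    refine Finset.sum_congr rfl fun i _ => ?_
    rw [Finset.sum_comm]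
    refine Finset.sum_congr rfl fun j _ => ?_
    rw [← Finset.sum_filter, Finset.sum_const, nsmul_eq_mul]
    congr 1
    by_cases hij : i = j
    · subst hij
      simp only [and_self, if_true]
      rw [card_clients_mem hS hS1]
      ring
    · rw [hp i j hij]
      simp [hij]
  have h2 : ∑ i, ∑ j, (p + if i = j then p₁ - p else 0) * ⟪z i, z j⟫
      = (p₁ - p) * ∑ i, ‖z i‖ ^ 2 := by
    have e : ∀ i j, (p + if i = j then p₁ - p else 0) * ⟪z i, z j⟫
        = p * ⟪z i, z j⟫ + if i = j then (p₁ - p) * ⟪z i, z j⟫ else 0 := by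
      intro i j
      split_ifs <;> ring
    simp_rw [e, Finset.sum_add_distrib, ← Finset.mul_sum, ← inner_sum, hz]
    simp [Finset.mul_sum]
  rw [clientAvg, h1, h2]
  have h3 : (p₁ - p) * ∑ i, ‖z i‖ ^ 2 ≤ p₁ * ∑ i, ‖z i‖ ^ 2 := by
    gcongr
    linarith
  calc (1 / (N.choose S : ℝ)) * ((p₁ - p) * ∑ i, ‖z i‖ ^ 2)
      ≤ (1 / (N.choose S : ℝ)) * (p₁ * ∑ i, ‖z i‖ ^ 2) := by gcongr
    _ = _ := by rw [hp₁]; field_simp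

end Sampling

/-! ### Resampling the draws of one round -/

section Resample

open scoped ENNReal

variable {Ω : Type*} [MeasurableSpace Ω]

/-- Replacing the block of coordinates with first index `r` by an independent copy preserves a
product measure. -/
lemma measurePreserving_replace_block {κ : Type*} {μ : κ → Measure Ω}
    [∀ k, IsProbabilityMeasure (μ k)] (r : ℕ) :
    MeasurePreserving (fun p : (ℕ × κ → Ω) × (κ → Ω) => fun j : ℕ × κ =>
        if j.1 = r then p.2 j.2 else p.1 j)
      ((Measure.infinitePi fun j : ℕ × κ => μ j.2).prod (Measure.infinitePi μ))
      (Measure.infinitePi fun j : ℕ × κ => μ j.2) := by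
  classical
  have hm : Measurable (fun p : (ℕ × κ → Ω) × (κ → Ω) => fun j : ℕ × κ =>
      if j.1 = r then p.2 j.2 else p.1 j) := by
    refine measurable_pi_lambda _ fun j => ?_
    by_cases h : j.1 = r
    · simp only [h, if_true]; fun_prop
    · simp only [h, if_false]; fun_prop
  refine ⟨hm, Measure.eq_infinitePi _ fun s t ht => ?_⟩
  have hbox : MeasurableSet (Set.pi (s : Set (ℕ × κ)) t) :=
    MeasurableSet.pi s.countable_toSet fun j _ => ht j
  rw [Measure.map_apply hm hbox]
  set s₁ : Finset (ℕ × κ) := s.filter fun j => ¬ j.1 = r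
  set s₂ : Finset κ := (s.filter fun j => j.1 = r).image Prod.snd
  have hpre : (fun p : (ℕ × κ → Ω) × (κ → Ω) => fun j : ℕ × κ =>
      if j.1 = r then p.2 j.2 else p.1 j) ⁻¹' (Set.pi (s : Set (ℕ × κ)) t)
      = (Set.pi (s₁ : Set (ℕ × κ)) t) ×ˢ (Set.pi (s₂ : Set κ) fun k => t (r, k)) := by
    ext p
    simp only [Set.mem_preimage, Set.mem_pi, Finset.mem_coe, Set.mem_prod, s₁, s₂,
      Finset.mem_filter, Finset.mem_image]
    constructor
    · intro h
      refine ⟨fun j hj => by simpa [hj.2] using h j hj.1, ?_⟩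
      rintro k ⟨⟨r', k'⟩, ⟨hj, hr⟩, rfl⟩
      obtain rfl : r' = r := hr
      simpa using h _ hj
    · rintro ⟨h1, h2⟩ ⟨r', k⟩ hj
      by_cases hr : r' = r
      · subst hr
        simpa using h2 k ⟨(r', k), ⟨hj, rfl⟩, rfl⟩
      · simpa [hr] using h1 (r', k) ⟨hj, hr⟩
  rw [hpre, Measure.prod_prod, Measure.infinitePi_pi _ fun j _ => ht j,
    Measure.infinitePi_pi _ fun k _ => ht (r, k), ← Finset.prod_filter_mul_prod_filter_not s
      (fun j => j.1 = r), mul_comm]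
  congr 1
  rw [Finset.prod_image]
  · refine Finset.prod_congr rfl fun j hj => ?_
    rw [← (Finset.mem_filter.1 hj).2]
  · intro j hj j' hj' h
    exact Prod.ext (((Finset.mem_filter.1 hj).2).trans ((Finset.mem_filter.1 hj').2).symm) h

/-- Replacing one coordinate by an independent copy preserves the law of an i.i.d. sequence. -/
lemma measurePreserving_update {μ : Measure Ω} [IsProbabilityMeasure μ] (r : ℕ) :
    MeasurePreserving (fun p : (ℕ → Ω) × Ω => Function.update p.1 r p.2)
      ((Measure.infinitePi fun _ : ℕ => μ).prod μ) (Measure.infinitePi fun _ : ℕ => μ) := by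
  classical
  have hm : Measurable (fun p : (ℕ → Ω) × Ω => Function.update p.1 r p.2) := by
    refine measurable_pi_lambda _ fun j => ?_
    by_cases h : j = r
    · subst h; simp only [Function.update_self]; fun_prop
    · simp only [Function.update_of_ne h]; fun_prop
  refine ⟨hm, Measure.eq_infinitePi _ fun s t ht => ?_⟩
  have hbox : MeasurableSet (Set.pi (s : Set ℕ) t) :=
    MeasurableSet.pi s.countable_toSet fun j _ => ht j
  rw [Measure.map_apply hm hbox]
  have hpre : (fun p : (ℕ → Ω) × Ω => Function.update p.1 r p.2) ⁻¹' (Set.pi (s : Set ℕ) t)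
      = (Set.pi ((s.erase r : Finset ℕ) : Set ℕ) t) ×ˢ (if r ∈ s then t r else Set.univ) := by
    ext p
    simp only [Set.mem_preimage, Set.mem_pi, Finset.mem_coe, Set.mem_prod, Finset.mem_erase]
    constructor
    · intro h
      refine ⟨fun j hj => by simpa [hj.1] using h j hj.2, ?_⟩
      split_ifs with hr
      · simpa using h r hr
      · trivial
    · rintro ⟨h1, h2⟩ j hj
      by_cases hjr : j = r
      · subst hjr
        simpa [hj] using h2
      · simpa [hjr] using h1 j ⟨hjr, hj⟩
  rw [hpre, Measure.prod_prod, Measure.infinitePi_pi _ fun j _ => ht j]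
  split_ifs with hr
  · rw [Finset.prod_erase_mul _ _ hr]
  · rw [measure_univ, mul_one, Finset.erase_eq_of_notMem hr]

variable {N : ℕ}

/-- The draws `ω` with those of round `r` replaced by the clients `P` and the samples `ξ`. -/
def replaceRound (r : ℕ) (ω : Draws N Ω) (P : Finset (Fin N)) (ξ : Fin N × ℕ → Ω) : Draws N Ω :=
  (ω.1, fun j => if j.1 = r then ξ j.2 else ω.2.1 j, Function.update ω.2.2 r P)

lemma measurable_replaceRound (r : ℕ) :
    Measurable fun p : Draws N Ω × Finset (Fin N) × (Fin N × ℕ → Ω) =>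
      replaceRound r p.1 p.2.1 p.2.2 := by
  unfold replaceRound
  refine Measurable.prodMk (by fun_prop) (Measurable.prodMk ?_ ?_)
  · refine measurable_pi_lambda _ fun j => ?_
    by_cases h : j.1 = r
    · simp only [h, if_true]; fun_prop
    · simp only [h, if_false]; fun_prop
  · refine measurable_pi_lambda _ fun j => ?_
    by_cases h : j = r
    · subst h; simp only [Function.update_self]; fun_prop
    · simp only [Function.update_of_ne h]; fun_prop

/-- Expectations are unchanged when the draws of round `r` are replaced by an independent copy. This
is how independence of the rounds enters the analysis. -/
lemma lintegral_drawsLaw_eq (D : Fin N → Measure Ω) [∀ i, IsProbabilityMeasure (D i)] {S : ℕ}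
    (hS : S ≤ N) (r : ℕ) {h : Draws N Ω → ℝ≥0∞} (hh : Measurable h) :
    ∫⁻ ω, h ω ∂(drawsLaw D S hS) = ∫⁻ ω, ∫⁻ P, ∫⁻ ξ, h (replaceRound r ω P ξ)
      ∂(Measure.infinitePi fun j : Fin N × ℕ => D j.1) ∂(uniformClients N S hS)
      ∂(drawsLaw D S hS) := by
  have hjoint : Measurable fun p : Draws N Ω × Finset (Fin N) × (Fin N × ℕ → Ω) =>
      h (replaceRound r p.1 p.2.1 p.2.2) := hh.comp (measurable_replaceRound r)
  have hm2 : Measurable fun ω : Draws N Ω => ∫⁻ P, ∫⁻ ξ, h (replaceRound r ω P ξ)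
      ∂(Measure.infinitePi fun j : Fin N × ℕ => D j.1) ∂(uniformClients N S hS) :=
    (Measurable.lintegral_prod_right' (f := fun q : (Draws N Ω × Finset (Fin N)) ×
      (Fin N × ℕ → Ω) => h (replaceRound r q.1.1 q.1.2 q.2)) (hjoint.comp (by fun_prop : Measurable
        fun q : (Draws N Ω × Finset (Fin N)) × (Fin N × ℕ → Ω) =>
          (q.1.1, q.1.2, q.2)))).lintegral_prod_right'
  rw [drawsLaw, lintegral_prod _ hh.aemeasurable, lintegral_prod _ hm2.aemeasurable]
  refine lintegral_congr fun ω₁ => ?_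
  set Q := Measure.infinitePi fun j : Fin N × ℕ => D j.1
  set U := uniformClients N S hS
  have hh₁ : Measurable fun y => h (ω₁, y) := hh.comp measurable_prodMk_left
  have hm₁ : Measurable fun y => ∫⁻ P, ∫⁻ ξ, h (replaceRound r (ω₁, y) P ξ) ∂Q ∂U :=
    hm2.comp measurable_prodMk_left
  rw [lintegral_prod _ hh₁.aemeasurable, lintegral_prod _ hm₁.aemeasurable]
  have hcomp : ∀ {α : Type _} [MeasurableSpace α] {u : α → Draws N Ω} {v : α → Finset (Fin N)}
      {w : α → Fin N × ℕ → Ω}, Measurable u → Measurable v → Measurable w →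
      Measurable fun a => h (replaceRound r (u a) (v a) (w a)) := fun hu hv hw =>
    hjoint.comp (hu.prodMk (hv.prodMk hw))
  -- resample the clients of round `r`, then its samples
  have hclients : ∀ ω₂ : ℕ × Fin N × ℕ → Ω,
      ∫⁻ ω₃, h (ω₁, ω₂, ω₃) ∂(Measure.infinitePi fun _ : ℕ => U)
        = ∫⁻ ω₃, ∫⁻ P, h (ω₁, ω₂, Function.update ω₃ r P) ∂U
          ∂(Measure.infinitePi fun _ : ℕ => U) := by
    intro ω₂
    have hm : Measurable fun ω₃ : ℕ → Finset (Fin N) => h (ω₁, ω₂, ω₃) := hh.comp (by fun_prop)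
    have hmp := measurePreserving_update (μ := U) r
    rw [← hmp.lintegral_comp hm]
    exact lintegral_prod _ (hm.comp hmp.measurable).aemeasurable
  simp_rw [hclients]
  set k : (ℕ × Fin N × ℕ → Ω) → ℝ≥0∞ := fun ω₂ =>
    ∫⁻ ω₃, ∫⁻ P, h (ω₁, ω₂, Function.update ω₃ r P) ∂U ∂(Measure.infinitePi fun _ : ℕ => U) with hk
  have hkm : Measurable k := by
    have e : k = fun ω₂ => ∫⁻ ω₃, h (ω₁, ω₂, ω₃) ∂(Measure.infinitePi fun _ : ℕ => U) :=
      funext fun ω₂ => (hclients ω₂).symm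
    rw [e]
    exact hh₁.lintegral_prod_right'
  have hmp := measurePreserving_replace_block (μ := fun j : Fin N × ℕ => D j.1) r
  rw [← hmp.lintegral_comp hkm]
  refine (lintegral_prod _ (hkm.comp hmp.measurable).aemeasurable).trans ?_
  refine lintegral_congr fun ω₂ => ?_
  have hswap : ∀ ω₃ : ℕ → Finset (Fin N),
      ∫⁻ P, ∫⁻ ξ, h (replaceRound r (ω₁, ω₂, ω₃) P ξ) ∂Q ∂U
        = ∫⁻ ξ, ∫⁻ P, h (replaceRound r (ω₁, ω₂, ω₃) P ξ) ∂U ∂Q := fun ω₃ =>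
    lintegral_lintegral_swap (hcomp (by fun_prop) (by fun_prop) (by fun_prop)).aemeasurable
  simp_rw [hswap]
  rw [lintegral_lintegral_swap]
  · rfl
  · exact (Measurable.lintegral_prod_right' (f := fun q : ((ℕ → Finset (Fin N)) ×
      (Fin N × ℕ → Ω)) × Finset (Fin N) => h (replaceRound r (ω₁, ω₂, q.1.1) q.2 q.1.2))
      (hcomp (by fun_prop) (by fun_prop) (by fun_prop))).aemeasurable

end Resample

/-! ### The state as a function of the draws -/

section States

variable {d N : ℕ} {Ξ : Type*} {F : Vec d → Ξ → ℝ} {η γ β : ℝ} {S K B : ℕ} {x₀ : Vec d}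

lemma state_replaceRound_of_le {r r' : ℕ} (h : r' ≤ r) (ω : Draws N Ξ) (P : Finset (Fin N))
    (ξ : Fin N × ℕ → Ξ) :
    state F η γ β S K B x₀ (replaceRound r ω P ξ) r' = state F η γ β S K B x₀ ω r' := by
  induction r' with
  | zero => rfl
  | succ k ih =>
    have hk : k ≠ r := by omega
    simp only [state, ih (by omega)]
    simp [replaceRound, hk]

lemma state_replaceRound_succ (r : ℕ) (ω : Draws N Ξ) (P : Finset (Fin N))
    (ξ : Fin N × ℕ → Ξ) :
    state F η γ β S K B x₀ (replaceRound r ω P ξ) (r + 1)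
      = round F η γ β S K (state F η γ β S K B x₀ ω r) P ξ := by
  simp only [state, state_replaceRound_of_le le_rfl]
  simp [replaceRound]

/-- The server's control variate is the average of the control variates of the clients. -/
lemma state_c_eq (ω : Draws N Ξ) (r : ℕ) :
    (state F η γ β S K B x₀ ω r).c
      = (1 / (N : ℝ)) • ∑ i, (state F η γ β S K B x₀ ω r).ci i := by
  induction r with
  | zero => rfl
  | succ k ih =>
    simp only [state, round]
    rw [ih, ← smul_add, sum_mem_eq_sum_indicator (ω.2.2 k), ← Finset.sum_add_distrib]
    congr 1
    refine Finset.sum_congr rfl fun i _ => ?_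
    split_ifs <;> simp

/-- Measurability of all the components of a random state. -/
structure MeasurableState {α : Type*} [MeasurableSpace α] (s : α → State d N) : Prop where
  x : Measurable fun a => (s a).x
  xPrev : Measurable fun a => (s a).xPrev
  g : Measurable fun a => (s a).g
  ci : ∀ i, Measurable fun a => (s a).ci i
  c : Measurable fun a => (s a).c

variable [MeasurableSpace Ξ] {α : Type*} [MeasurableSpace α]

lemma measurable_localModel (hF : Measurable (Function.uncurry (sampleGrad F)))
    {s : α → State d N} (hs : MeasurableState s) (i : Fin N) {ξ : α → ℕ → Ξ} (hξ : Measurable ξ)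
    (k : ℕ) : Measurable fun a => localModel F η β (s a) i (ξ a) k := by
  have hF' : ∀ {u : α → Vec d} {v : α → Ξ}, Measurable u → Measurable v →
      Measurable fun a => sampleGrad F (u a) (v a) := fun hu hv => hF.comp (hu.prodMk hv)
  induction k with
  | zero => exact hs.x
  | succ k ih =>
    have hk : Measurable fun a => ξ a k := (measurable_pi_apply k).comp hξ
    simp only [localModel]
    exact ih.sub ((((hF' ih hk).sub (((hs.ci i).sub hs.c).const_smul β)).add
      ((hs.g.sub (hF' hs.xPrev hk)).const_smul (1 - β))).const_smul η)

lemma measurableState_round (hF : Measurable (Function.uncurry (sampleGrad F)))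
    {s : α → State d N} (hs : MeasurableState s) {P : α → Finset (Fin N)} (hP : Measurable P)
    {ξ : α → Fin N × ℕ → Ξ} (hξ : Measurable ξ) :
    MeasurableState fun a => round F η γ β S K (s a) (P a) (ξ a) := by
  have hy : ∀ i k, Measurable fun a => localModel F η β (s a) i (fun k => ξ a (i, k)) k :=
    fun i k => measurable_localModel hF hs i
      (measurable_pi_lambda _ fun k => (measurable_pi_apply (i, k)).comp hξ) k
  have hmem : ∀ i, MeasurableSet {a | i ∈ P a} := fun i => hP (measurableSet_mem_finset i)
  have hsum : ∀ {u : Fin N → α → Vec d}, (∀ i, Measurable (u i)) →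
      Measurable fun a => ∑ i ∈ P a, u i a := by
    intro u hu
    have e : (fun a => ∑ i ∈ P a, u i a) = fun a => ∑ i, if i ∈ P a then u i a else 0 :=
      funext fun a => sum_mem_eq_sum_indicator (P a) fun i => u i a
    rw [e]
    exact Finset.measurable_fun_sum _ fun i _ => Measurable.ite (hmem i) (hu i) measurable_const
  have hg : Measurable fun a => (round F η γ β S K (s a) (P a) (ξ a)).g :=
    (hsum fun i => hs.x.sub (hy i K)).const_smul (1 / (η * S * K))
  have hci : ∀ i, Measurable fun a => (round F η γ β S K (s a) (P a) (ξ a)).ci i := fun i =>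
    Measurable.ite (hmem i) ((Finset.measurable_fun_sum _ fun k _ =>
      hF.comp ((hy i k).prodMk ((measurable_pi_apply (i, k)).comp hξ))).const_smul (1 / (K : ℝ)))
      (hs.ci i)
  exact ⟨hs.x.sub (hg.const_smul γ), hs.x, hg, hci,
    hs.c.add ((hsum fun i => (hci i).sub (hs.ci i)).const_smul (1 / (N : ℝ)))⟩

lemma measurableState_state (hF : Measurable (Function.uncurry (sampleGrad F))) (r : ℕ) :
    MeasurableState fun ω : Draws N Ξ => state F η γ β S K B x₀ ω r := by
  induction r with
  | zero =>
    have hci : ∀ i, Measurable fun ω : Draws N Ξ => (1 / (B : ℝ)) •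
        ∑ b ∈ Finset.range B, sampleGrad F x₀ (ω.1 (i, b)) := fun i =>
      (Finset.measurable_fun_sum _ fun b _ => hF.comp (measurable_const.prodMk
        ((measurable_pi_apply (i, b)).comp measurable_fst))).const_smul (1 / (B : ℝ))
    have hc : Measurable fun ω : Draws N Ξ => (1 / (N : ℝ)) • ∑ i : Fin N, (1 / (B : ℝ)) •
        ∑ b ∈ Finset.range B, sampleGrad F x₀ (ω.1 (i, b)) :=
      (Finset.measurable_fun_sum _ fun i _ => hci i).const_smul (1 / (N : ℝ))
    exact ⟨measurable_const, measurable_const, hc, hci, hc⟩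
  | succ k ih => exact measurableState_round hF ih (by fun_prop) (by fun_prop)

end States

/-! ### Expectations over one round -/

section RoundLE

variable {N S : ℕ} {Ξ : Type*} [MeasurableSpace Ξ] {D : Fin N → Measure Ξ}
  [∀ i, IsProbabilityMeasure (D i)]

/-- The expectation of `φ` over the clients `P` and the samples `ξ` of one round is at most `t`.
It is expressed by an integrable upper bound `Ψ` of `φ`, so that `φ` itself, which involves the
local models, need not be shown integrable; `Θ P` bounds the expectation for given clients `P`. -/
def RoundLE (D : Fin N → Measure Ξ) [∀ i, IsProbabilityMeasure (D i)] (S : ℕ)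
    (φ : Finset (Fin N) → (Fin N × ℕ → Ξ) → ℝ) (t : ℝ) : Prop :=
  ∃ (Ψ : Finset (Fin N) → (Fin N × ℕ → Ξ) → ℝ) (Θ : Finset (Fin N) → ℝ),
    (∀ P, P.card = S → (∀ ξ, φ P ξ ≤ Ψ P ξ) ∧
      Integrable (Ψ P) (Measure.infinitePi fun j : Fin N × ℕ => D j.1) ∧
      ∫ ξ, Ψ P ξ ∂(Measure.infinitePi fun j : Fin N × ℕ => D j.1) ≤ Θ P) ∧
    clientAvg N S Θ ≤ t

namespace RoundLE

variable {φ φ' : Finset (Fin N) → (Fin N × ℕ → Ξ) → ℝ} {t t' : ℝ}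

lemma mono (h : RoundLE D S φ t) (hφ : ∀ P, P.card = S → ∀ ξ, φ' P ξ ≤ φ P ξ) (ht : t ≤ t') :
    RoundLE D S φ' t' := by
  obtain ⟨Ψ, Θ, h1, h2⟩ := h
  exact ⟨Ψ, Θ, fun P hP => ⟨fun ξ => (hφ P hP ξ).trans ((h1 P hP).1 ξ), (h1 P hP).2⟩, h2.trans ht⟩

lemma add (h : RoundLE D S φ t) (h' : RoundLE D S φ' t') :
    RoundLE D S (fun P ξ => φ P ξ + φ' P ξ) (t + t') := by
  obtain ⟨Ψ, Θ, h1, h2⟩ := h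
  obtain ⟨Ψ', Θ', h1', h2'⟩ := h'
  refine ⟨fun P ξ => Ψ P ξ + Ψ' P ξ, fun P => Θ P + Θ' P, fun P hP => ⟨fun ξ =>
    add_le_add ((h1 P hP).1 ξ) ((h1' P hP).1 ξ), (h1 P hP).2.1.add (h1' P hP).2.1, ?_⟩, ?_⟩
  · rw [integral_add (h1 P hP).2.1 (h1' P hP).2.1]
    exact add_le_add (h1 P hP).2.2 (h1' P hP).2.2
  · rw [clientAvg_add]
    exact add_le_add h2 h2'

lemma const_mul (h : RoundLE D S φ t) {a : ℝ} (ha : 0 ≤ a) :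
    RoundLE D S (fun P ξ => a * φ P ξ) (a * t) := by
  obtain ⟨Ψ, Θ, h1, h2⟩ := h
  refine ⟨fun P ξ => a * Ψ P ξ, fun P => a * Θ P, fun P hP => ⟨fun ξ =>
    mul_le_mul_of_nonneg_left ((h1 P hP).1 ξ) ha, (h1 P hP).2.1.const_mul a, ?_⟩, ?_⟩
  · rw [integral_const_mul]
    exact mul_le_mul_of_nonneg_left (h1 P hP).2.2 ha
  · rw [clientAvg_mul]
    exact mul_le_mul_of_nonneg_left h2 ha

lemma const (hS : S ≤ N) (a : ℝ) : RoundLE D S (fun _ _ => a) a :=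
  ⟨fun _ _ => a, fun _ => a, fun _ _ => ⟨fun _ => le_rfl, integrable_const a, by simp⟩,
    (clientAvg_const hS a).le⟩

lemma sum_mem (hS : S ≤ N) (hS1 : 1 ≤ S) {Φ : Fin N → (Fin N × ℕ → Ξ) → ℝ} {τ : Fin N → ℝ}
    (hΦ : ∀ i, Integrable (Φ i) (Measure.infinitePi fun j : Fin N × ℕ => D j.1))
    (hτ : ∀ i, ∫ ξ, Φ i ξ ∂(Measure.infinitePi fun j : Fin N × ℕ => D j.1) ≤ τ i) :
    RoundLE D S (fun P ξ => ∑ i ∈ P, Φ i ξ) (S / N * ∑ i, τ i) := by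
  refine ⟨fun P ξ => ∑ i ∈ P, Φ i ξ, fun P => ∑ i ∈ P, τ i, fun P _ => ⟨fun _ => le_rfl,
    integrable_finsetSum _ fun i _ => hΦ i, ?_⟩, (clientAvg_sum_mem hS hS1 τ).le⟩
  rw [integral_finsetSum _ fun i _ => hΦ i]
  exact Finset.sum_le_sum fun i _ => hτ i

lemma lintegral_le (h : RoundLE D S φ t) (hS : S ≤ N) (h0 : ∀ P, P.card = S → ∀ ξ, 0 ≤ φ P ξ) :
    ∫⁻ P, ∫⁻ ξ, ENNReal.ofReal (φ P ξ) ∂(Measure.infinitePi fun j : Fin N × ℕ => D j.1)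
      ∂(uniformClients N S hS) ≤ ENNReal.ofReal t := by
  obtain ⟨Ψ, Θ, h1, h2⟩ := h
  have hΨ0 : ∀ P, P.card = S → ∀ ξ, 0 ≤ Ψ P ξ := fun P hP ξ => (h0 P hP ξ).trans ((h1 P hP).1 ξ)
  refine (lintegral_uniformClients_le hS (Θ := Θ) (fun P hP => ?_) fun P hP => ?_).trans
    (ENNReal.ofReal_le_ofReal h2)
  · calc _ ≤ ∫⁻ ξ, ENNReal.ofReal (Ψ P ξ) ∂(Measure.infinitePi fun j : Fin N × ℕ => D j.1) :=
        lintegral_mono fun ξ => ENNReal.ofReal_le_ofReal ((h1 P hP).1 ξ)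
      _ = ENNReal.ofReal (∫ ξ, Ψ P ξ ∂(Measure.infinitePi fun j : Fin N × ℕ => D j.1)) :=
        (ofReal_integral_eq_lintegral_ofReal (h1 P hP).2.1
          (Filter.Eventually.of_forall (hΨ0 P hP))).symm
      _ ≤ _ := ENNReal.ofReal_le_ofReal (h1 P hP).2.2
  · exact (integral_nonneg (hΨ0 P hP)).trans (h1 P hP).2.2

end RoundLE

/-- The second moment of the error made by averaging over sampled clients and over their samples:
the deterministic part `z` varies with the client, the noise `Z` with the sample. -/
lemma roundLE_norm_sq {d : ℕ} (hS : S ≤ N) (hS1 : 1 ≤ S) (K : ℕ) {Z : Fin N → Ξ → Vec d}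
    (hZ : ∀ i, Measurable (Z i)) (hZ2 : ∀ i, Integrable (fun ξ => ‖Z i ξ‖ ^ 2) (D i))
    (hZ0 : ∀ i, ∫ ξ, Z i ξ ∂(D i) = 0) {τ : ℝ} (hτ : ∀ i, ∫ ξ, ‖Z i ξ‖ ^ 2 ∂(D i) ≤ τ)
    (v : Vec d) {z : Fin N → Vec d} (hz : ∑ i, z i = 0) :
    RoundLE D S (fun P ξ => ‖v + (1 / (S : ℝ)) • ∑ i ∈ P, z i
        + ∑ j ∈ P ×ˢ Finset.range K, (1 / ((S : ℝ) * K)) • Z j.1 (ξ j)‖ ^ 2)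
      (‖v‖ ^ 2 + 1 / S * (1 / N * ∑ i, ‖z i‖ ^ 2) + τ / (S * K)) := by
  have hS' : (0 : ℝ) < S := by exact_mod_cast hS1
  have hN' : (0 : ℝ) < N := by exact_mod_cast hS1.trans hS
  refine ⟨_, fun P => ‖v + (1 / (S : ℝ)) • ∑ i ∈ P, z i‖ ^ 2 + τ / (S * K), fun P hP =>
    ⟨fun _ => le_rfl, ?_⟩, ?_⟩
  · have hA := integral_norm_add_sum_sq (μ := fun j : Fin N × ℕ => D j.1)
      (Z := fun j ξ => (1 / ((S : ℝ) * K)) • Z j.1 ξ)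
      (fun j => (hZ j.1).const_smul (1 / ((S : ℝ) * K)))
      (fun j => by simpa only [norm_smul, mul_pow] using (hZ2 j.1).const_mul _)
      (fun j => by rw [integral_smul, hZ0, smul_zero])
      (v + (1 / (S : ℝ)) • ∑ i ∈ P, z i) (P ×ˢ Finset.range K)
    refine ⟨hA.1, hA.2.trans_le (add_le_add le_rfl ?_)⟩
    simp only [norm_smul, mul_pow, integral_const_mul]
    calc ∑ j ∈ P ×ˢ Finset.range K, ‖1 / ((S : ℝ) * K)‖ ^ 2 * ∫ ξ, ‖Z j.1 ξ‖ ^ 2 ∂(D j.1)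
        ≤ ∑ _j ∈ P ×ˢ Finset.range K, ‖1 / ((S : ℝ) * K)‖ ^ 2 * τ := by
          gcongr with j
          exact hτ j.1
      _ = τ / (S * K) := by
          rw [Finset.sum_const, Finset.card_product, hP, Finset.card_range, nsmul_eq_mul,
            Real.norm_of_nonneg (by positivity)]
          rcases Nat.eq_zero_or_pos K with rfl | hK
          · simp
          · push_cast
            field_simp
  · have e : ∀ P : Finset (Fin N), ‖v + (1 / (S : ℝ)) • ∑ i ∈ P, z i‖ ^ 2 + τ / (S * K)
        = (‖v‖ ^ 2 + τ / (S * K)) + (2 * (1 / S) * inner ℝ v (∑ i ∈ P, z i)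
          + (1 / S) ^ 2 * ‖∑ i ∈ P, z i‖ ^ 2) := by
      intro P
      rw [norm_add_sq_real, real_inner_smul_right, norm_smul, mul_pow,
        Real.norm_of_nonneg (by positivity)]
      ring
    simp_rw [e]
    rw [clientAvg_add (fun _ => ‖v‖ ^ 2 + τ / (S * K)), clientAvg_const hS,
      clientAvg_add (fun P => 2 * (1 / (S : ℝ)) * inner ℝ v (∑ i ∈ P, z i)), clientAvg_mul,
      clientAvg_mul, clientAvg_inner_sum_mem hS hS1 hz]
    have h := mul_le_mul_of_nonneg_left (clientAvg_norm_sum_mem_sq_le hS hS1 hz)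
      (by positivity : (0 : ℝ) ≤ (1 / S) ^ 2)
    have e2 : (1 / (S : ℝ)) ^ 2 * (S / N * ∑ i, ‖z i‖ ^ 2)
        = 1 / S * (1 / N * ∑ i, ‖z i‖ ^ 2) := by field_simp
    linarith

end RoundLE

/-! ### Local drift -/

section Norms

variable {E : Type*} [NormedAddCommGroup E]

/-- Young's inequality for the square of a sum. -/
lemma norm_add_sq_le_young {t : ℝ} (ht : 0 < t) (a b : E) :
    ‖a + b‖ ^ 2 ≤ (1 + t) * ‖a‖ ^ 2 + (1 + 1 / t) * ‖b‖ ^ 2 := by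
  have h1 : ‖a + b‖ ^ 2 ≤ (‖a‖ + ‖b‖) ^ 2 := pow_le_pow_left₀ (norm_nonneg _) (norm_add_le a b) 2
  have h2 : 2 * (‖a‖ * ‖b‖) ≤ t * ‖a‖ ^ 2 + 1 / t * ‖b‖ ^ 2 := by
    have h3 : 0 ≤ 1 / t * (t * ‖a‖ - ‖b‖) ^ 2 := by positivity
    have h4 : 1 / t * (t * ‖a‖ - ‖b‖) ^ 2
        = t * ‖a‖ ^ 2 + 1 / t * ‖b‖ ^ 2 - 2 * (‖a‖ * ‖b‖) := by
      field_simp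
      ring
    linarith
  nlinarith

lemma norm_sum_sq_le {ι : Type*} (T : Finset ι) (a : ι → E) :
    ‖∑ j ∈ T, a j‖ ^ 2 ≤ T.card * ∑ j ∈ T, ‖a j‖ ^ 2 :=
  (pow_le_pow_left₀ (norm_nonneg _) (norm_sum_le _ _) 2).trans sq_sum_le_card_mul_sum_sq

variable [InnerProductSpace ℝ E]

lemma norm_add_sq_le_two_mul (a b : E) : ‖a + b‖ ^ 2 ≤ 2 * (‖a‖ ^ 2 + ‖b‖ ^ 2) := by
  have h := parallelogram_law_with_norm ℝ a b
  nlinarith [sq_nonneg ‖a - b‖]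

lemma norm_add_add_add_sq_le (a b c e : E) :
    ‖a + b + c + e‖ ^ 2 ≤ 4 * (‖a‖ ^ 2 + ‖b‖ ^ 2 + ‖c‖ ^ 2 + ‖e‖ ^ 2) := by
  have h := norm_add_sq_le_two_mul (a + b) (c + e)
  rw [← add_assoc] at h
  linarith [norm_add_sq_le_two_mul a b, norm_add_sq_le_two_mul c e]

end Norms

section Round

variable {d N : ℕ} {Ξ : Type*} {F : Vec d → Ξ → ℝ} {η γ β L σ : ℝ} {S K : ℕ}

lemma localModel_sub_eq (s : State d N) (i : Fin N) (ξ : ℕ → Ξ) (k : ℕ) :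
    localModel F η β s i ξ k - s.x = -(η • ∑ j ∈ Finset.range k,
      (sampleGrad F (localModel F η β s i ξ j) (ξ j) - β • (s.ci i - s.c)
        + (1 - β) • (s.g - sampleGrad F s.xPrev (ξ j)))) := by
  induction k with
  | zero => simp [localModel]
  | succ k ih =>
    rw [Finset.sum_range_succ, smul_add, neg_add, ← ih]
    simp only [localModel]
    abel

section Pathwise

variable [MeasurableSpace Ξ] {D : Fin N → Measure Ξ}

/-- The error `∇F(x; ξ) - ∇f_i(x)` of a stochastic gradient. -/
noncomputable def gradNoise (F : Vec d → Ξ → ℝ) (D : Fin N → Measure Ξ) (x : Vec d) (i : Fin N)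
    (ξ : Ξ) : Vec d :=
  sampleGrad F x ξ - gradient (localLoss F D i) x

/-- The error of the momentum `g^r` as an estimate of `∇f(x^{r-1})`. -/
noncomputable def dirErr (F : Vec d → Ξ → ℝ) (D : Fin N → Measure Ξ) (s : State d N) : Vec d :=
  s.g - gradient (globalLoss F D) s.xPrev

/-- The mean squared error of the control variates `c_i^r` as estimates of `∇f_i(x^{r-1})`. -/
noncomputable def ctrlErr (F : Vec d → Ξ → ℝ) (D : Fin N → Measure Ξ) (s : State d N) : ℝ :=
  (1 / (N : ℝ)) * ∑ i, ‖s.ci i - gradient (localLoss F D i) s.xPrev‖ ^ 2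

/-- The part of the local update direction of client `i` that is the same at all local steps. -/
noncomputable def meanDir (F : Vec d → Ξ → ℝ) (D : Fin N → Measure Ξ) (β : ℝ) (s : State d N)
    (i : Fin N) : Vec d :=
  β • (gradient (localLoss F D i) s.xPrev - s.ci i) + β • s.c + (1 - β) • s.g

/-- The drift `(L² / K) ∑_k ‖x_i^{r,k} - x^r‖²` of client `i` in one round. -/
noncomputable def drift (F : Vec d → Ξ → ℝ) (η β L : ℝ) (K : ℕ) (s : State d N) (i : Fin N)
    (ξ : Fin N × ℕ → Ξ) : ℝ :=
  L ^ 2 * ((1 / (K : ℝ)) *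
    ∑ k ∈ Finset.range K, ‖localModel F η β s i (fun k => ξ (i, k)) k - s.x‖ ^ 2)

/-- The local direction at step `j` is split as the change of the stochastic gradient from `x^r` to
the local model, its change from `x^{r-1}` to `x^r`, the constant part `meanDir`, and `β` times the
noise at `x^{r-1}`. The first two need no independence by samplewise smoothness; the last is taken at
a point that does not depend on the samples of the round. -/
lemma norm_localModel_sub_sq_le (hL : 0 < L) (hs : SampleSmooth F L) (s : State d N) (i : Fin N)
    (ξ : ℕ → Ξ) {k : ℕ} (hk : k ≤ K) :
    ‖localModel F η β s i ξ k - s.x‖ ^ 2 ≤ 4 * η ^ 2 *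
      (K * (L ^ 2 * ∑ j ∈ Finset.range K, ‖localModel F η β s i ξ j - s.x‖ ^ 2)
        + K ^ 2 * (L ^ 2 * ‖s.x - s.xPrev‖ ^ 2) + K ^ 2 * ‖meanDir F D β s i‖ ^ 2
        + β ^ 2 * ‖∑ j ∈ Finset.range k, gradNoise F D s.xPrev i (ξ j)‖ ^ 2) := by
  have hkK : (k : ℝ) ≤ K := by exact_mod_cast hk
  set y := localModel F η β s i ξ with hy
  have e : ∑ j ∈ Finset.range k, (sampleGrad F (y j) (ξ j) - β • (s.ci i - s.c)
        + (1 - β) • (s.g - sampleGrad F s.xPrev (ξ j)))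
      = ∑ j ∈ Finset.range k, (sampleGrad F (y j) (ξ j) - sampleGrad F s.x (ξ j))
        + ∑ j ∈ Finset.range k, (sampleGrad F s.x (ξ j) - sampleGrad F s.xPrev (ξ j))
        + (k : ℝ) • meanDir F D β s i
        + β • ∑ j ∈ Finset.range k, gradNoise F D s.xPrev i (ξ j) := by
    have e1 : (k : ℝ) • meanDir F D β s i = ∑ _j ∈ Finset.range k, meanDir F D β s i := by
      rw [Finset.sum_const, Finset.card_range, Nat.cast_smul_eq_nsmul]
    rw [e1, Finset.smul_sum, ← Finset.sum_add_distrib, ← Finset.sum_add_distrib,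
      ← Finset.sum_add_distrib]
    refine Finset.sum_congr rfl fun j _ => ?_
    simp only [meanDir, gradNoise]
    module
  rw [localModel_sub_eq, norm_neg, norm_smul, mul_pow, Real.norm_eq_abs, sq_abs, ← hy, e,
    mul_comm 4, mul_assoc]
  refine mul_le_mul_of_nonneg_left ((norm_add_add_add_sq_le _ _ _ _).trans ?_) (sq_nonneg η)
  have b1 : ‖∑ j ∈ Finset.range k, (sampleGrad F (y j) (ξ j) - sampleGrad F s.x (ξ j))‖ ^ 2
      ≤ K * (L ^ 2 * ∑ j ∈ Finset.range K, ‖y j - s.x‖ ^ 2) := by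
    refine (norm_sum_sq_le _ _).trans ?_
    rw [Finset.card_range, Finset.mul_sum (Finset.range K)]
    gcongr
    · exact (Finset.sum_le_sum fun j _ => norm_sampleGrad_sub_sq_le hs _ _ _).trans
        (Finset.sum_le_sum_of_subset_of_nonneg (Finset.range_mono hk) fun _ _ _ => by positivity)
  have b2 : ‖∑ j ∈ Finset.range k, (sampleGrad F s.x (ξ j) - sampleGrad F s.xPrev (ξ j))‖ ^ 2
      ≤ K ^ 2 * (L ^ 2 * ‖s.x - s.xPrev‖ ^ 2) := by
    refine (norm_sum_sq_le _ _).trans ?_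
    rw [Finset.card_range]
    calc (k : ℝ) * ∑ j ∈ Finset.range k, ‖sampleGrad F s.x (ξ j) - sampleGrad F s.xPrev (ξ j)‖ ^ 2
        ≤ k * ∑ _j ∈ Finset.range k, L ^ 2 * ‖s.x - s.xPrev‖ ^ 2 := by
          gcongr with j
          exact norm_sampleGrad_sub_sq_le hs _ _ _
      _ = k ^ 2 * (L ^ 2 * ‖s.x - s.xPrev‖ ^ 2) := by
          rw [Finset.sum_const, Finset.card_range, nsmul_eq_mul]
          ring
      _ ≤ _ := by gcongr
  have b3 : ‖(k : ℝ) • meanDir F D β s i‖ ^ 2 ≤ K ^ 2 * ‖meanDir F D β s i‖ ^ 2 := by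
    rw [norm_smul, mul_pow, Real.norm_of_nonneg (by positivity)]
    gcongr
  have b4 : ‖β • ∑ j ∈ Finset.range k, gradNoise F D s.xPrev i (ξ j)‖ ^ 2
      = β ^ 2 * ‖∑ j ∈ Finset.range k, gradNoise F D s.xPrev i (ξ j)‖ ^ 2 := by
    rw [norm_smul, mul_pow, Real.norm_eq_abs, sq_abs]
  rw [b4]
  linarith

/-- The drift is bounded by itself times a small factor, which is absorbed into the left side. The
sampling noise enters only through sums of independent centred vectors. -/
lemma drift_le (hL : 0 < L) (hs : SampleSmooth F L) (hK : 1 ≤ K)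
    (hη : (η * K * L) ^ 2 ≤ 1 / 8) (s : State d N) (i : Fin N) (ξ : Fin N × ℕ → Ξ) :
    drift F η β L K s i ξ ≤ 8 * (η * K * L) ^ 2 *
      (L ^ 2 * ‖s.x - s.xPrev‖ ^ 2 + ‖meanDir F D β s i‖ ^ 2
        + β ^ 2 / K ^ 3 * ∑ k ∈ Finset.range K,
          ‖∑ j ∈ Finset.range k, gradNoise F D s.xPrev i (ξ (i, j))‖ ^ 2) := by
  have hK' : (0 : ℝ) < K := by exact_mod_cast hK
  unfold drift
  set y := localModel F η β s i (fun k => ξ (i, k)) with hy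
  set T := ∑ k ∈ Finset.range K, ‖y k - s.x‖ ^ 2
  set X := L ^ 2 * ‖s.x - s.xPrev‖ ^ 2
  set A := ‖meanDir F D β s i‖ ^ 2
  set n := ∑ k ∈ Finset.range K, ‖∑ j ∈ Finset.range k, gradNoise F D s.xPrev i (ξ (i, j))‖ ^ 2
  have h1 : T ≤ 4 * η ^ 2 * (K * (K * (L ^ 2 * T) + K ^ 2 * X + K ^ 2 * A) + β ^ 2 * n) := by
    calc T ≤ ∑ k ∈ Finset.range K, 4 * η ^ 2 * (K * (L ^ 2 * T) + K ^ 2 * X + K ^ 2 * A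
            + β ^ 2 * ‖∑ j ∈ Finset.range k, gradNoise F D s.xPrev i (ξ (i, j))‖ ^ 2) :=
          Finset.sum_le_sum fun k hk => norm_localModel_sub_sq_le hL hs s i _
            (Finset.mem_range.1 hk).le
      _ = _ := by
          rw [← Finset.mul_sum, Finset.sum_add_distrib, ← Finset.mul_sum, Finset.sum_const,
            Finset.card_range, nsmul_eq_mul]
  have hT0 : 0 ≤ T := Finset.sum_nonneg fun _ _ => by positivity
  have h2 : 4 * η ^ 2 * (K * (K * (L ^ 2 * T))) ≤ 1 / 2 * T := by
    have : 4 * (η * K * L) ^ 2 * T ≤ 4 * (1 / 8) * T := by gcongr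
    nlinarith
  have h3 : T ≤ 8 * η ^ 2 * (K ^ 3 * (X + A) + β ^ 2 * n) := by nlinarith
  calc L ^ 2 * (1 / K * T) ≤ L ^ 2 * (1 / K * (8 * η ^ 2 * (K ^ 3 * (X + A) + β ^ 2 * n))) := by
        gcongr
    _ = _ := by
        field_simp

lemma measurable_gradNoise (hw : WellPosed F D) (hs : SampleSmooth F L) (x : Vec d) (i : Fin N) :
    Measurable (gradNoise F D x i) :=
  (measurable_sampleGrad hw hs x).sub_const _

end Pathwise

section Expectation

variable [MeasurableSpace Ξ] {D : Fin N → Measure Ξ} [∀ i, IsProbabilityMeasure (D i)]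

lemma integral_gradNoise (hg : StochasticGradient F D σ) (x : Vec d) (i : Fin N) :
    ∫ ξ, gradNoise F D x i ξ ∂(D i) = 0 := by
  simp only [gradNoise]
  rw [integral_sub (hg.integrable i x) (integrable_const _), hg.unbiased]
  simp

/-- The second moment of the sum of `m` noise vectors of one client at a fixed point. -/
lemma integral_norm_sum_gradNoise_le (hw : WellPosed F D) (hs : SampleSmooth F L)
    (hg : StochasticGradient F D σ) (x : Vec d) (i : Fin N) (m : ℕ) :
    Integrable (fun ξ : Fin N × ℕ → Ξ => ‖∑ j ∈ Finset.range m, gradNoise F D x i (ξ (i, j))‖ ^ 2)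
        (Measure.infinitePi fun j : Fin N × ℕ => D j.1) ∧
      ∫ ξ, ‖∑ j ∈ Finset.range m, gradNoise F D x i (ξ (i, j))‖ ^ 2
        ∂(Measure.infinitePi fun j : Fin N × ℕ => D j.1) ≤ m * σ ^ 2 := by
  have h := integral_norm_add_sum_sq (μ := fun j : Fin N × ℕ => D j.1)
    (Z := fun j => gradNoise F D x j.1) (fun j => measurable_gradNoise hw hs x j.1)
    (fun j => hg.integrable_sq j.1 x) (fun j => integral_gradNoise hg x j.1) 0
    ({i} ×ˢ Finset.range m)
  simp only [Finset.sum_product, Finset.sum_singleton, zero_add, norm_zero] at h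
  refine ⟨h.1, h.2.trans_le ?_⟩
  rw [Finset.sum_const, Finset.card_range, nsmul_eq_mul]
  rw [zero_pow two_ne_zero, zero_add]
  exact mul_le_mul_of_nonneg_left (hg.variance_le i x) (Nat.cast_nonneg m)

lemma norm_c_sub_sq_le (hL : 0 < L) (hw : WellPosed F D)
    (hs : SampleSmooth F L) (hg : StochasticGradient F D σ) (hN : 0 < N) {s : State d N}
    (hc : s.c = (1 / (N : ℝ)) • ∑ i, s.ci i) :
    ‖s.c - gradient (globalLoss F D) s.xPrev‖ ^ 2 ≤ ctrlErr F D s := by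
  rw [hc, gradient_globalLoss hL hw hs hg, ← smul_sub, ← Finset.sum_sub_distrib]
  exact norm_avg_sq_le hN _

lemma avg_norm_meanDir_sq_le (hL : 0 < L) (hw : WellPosed F D)
    (hs : SampleSmooth F L) (hg : StochasticGradient F D σ) (hN : 0 < N) (hβ0 : 0 ≤ β)
    (hβ1 : β ≤ 1) {s : State d N} (hc : s.c = (1 / (N : ℝ)) • ∑ i, s.ci i) :
    1 / (N : ℝ) * ∑ i, ‖meanDir F D β s i‖ ^ 2 ≤ 8 * (β ^ 2 * ctrlErr F D s)
      + 4 * ‖dirErr F D s‖ ^ 2 + 8 * ‖gradient (globalLoss F D) s.x‖ ^ 2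
      + 8 * (L ^ 2 * ‖s.x - s.xPrev‖ ^ 2) := by
  have hN' : (0 : ℝ) < N := by exact_mod_cast hN
  set u := gradient (globalLoss F D) s.xPrev with hu
  have hV := norm_c_sub_sq_le hL hw hs hg hN hc
  have hG : ‖u‖ ^ 2 ≤ 2 * (‖gradient (globalLoss F D) s.x‖ ^ 2
      + L ^ 2 * ‖s.x - s.xPrev‖ ^ 2) := by
    have h := norm_add_sq_le_two_mul (gradient (globalLoss F D) s.x)
      (u - gradient (globalLoss F D) s.x)
    rw [add_sub_cancel] at h
    have h2 := norm_gradient_globalLoss_sub_sq_le hL hw hs hg hN s.xPrev s.x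
    rw [norm_sub_rev s.xPrev] at h2
    linarith
  have hA : ∀ i, ‖meanDir F D β s i‖ ^ 2
      ≤ 4 * β ^ 2 * ‖s.ci i - gradient (localLoss F D i) s.xPrev‖ ^ 2
        + 4 * (β ^ 2 * ctrlErr F D s + ‖dirErr F D s‖ ^ 2 + ‖u‖ ^ 2) := by
    intro i
    have e : meanDir F D β s i = β • (gradient (localLoss F D i) s.xPrev - s.ci i)
        + β • (s.c - u) + (1 - β) • dirErr F D s + u := by
      simp only [meanDir, dirErr, ← hu]
      module
    rw [e]
    refine (norm_add_add_add_sq_le _ _ _ _).trans ?_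
    rw [norm_smul, norm_smul, norm_smul, mul_pow, mul_pow, mul_pow, Real.norm_of_nonneg hβ0,
      Real.norm_of_nonneg (sub_nonneg.2 hβ1), norm_sub_rev (gradient _ _)]
    have h1 : (1 - β) ^ 2 * ‖dirErr F D s‖ ^ 2 ≤ 1 * ‖dirErr F D s‖ ^ 2 := by
      gcongr
      nlinarith
    have h2 : β ^ 2 * ‖s.c - u‖ ^ 2 ≤ β ^ 2 * ctrlErr F D s := by gcongr
    linarith
  calc 1 / (N : ℝ) * ∑ i, ‖meanDir F D β s i‖ ^ 2
      ≤ 1 / (N : ℝ) * ∑ i, (4 * β ^ 2 * ‖s.ci i - gradient (localLoss F D i) s.xPrev‖ ^ 2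
        + 4 * (β ^ 2 * ctrlErr F D s + ‖dirErr F D s‖ ^ 2 + ‖u‖ ^ 2)) := by
        gcongr with i
        exact hA i
    _ = 4 * β ^ 2 * ctrlErr F D s
        + 4 * (β ^ 2 * ctrlErr F D s + ‖dirErr F D s‖ ^ 2 + ‖u‖ ^ 2) := by
        rw [Finset.sum_add_distrib, ← Finset.mul_sum, Finset.sum_const, Finset.card_univ,
          Fintype.card_fin, nsmul_eq_mul]
        simp only [ctrlErr]
        field_simp
    _ ≤ _ := by linarith

/-- The bound on the expected drift, averaged over the clients. -/
noncomputable def driftBound (F : Vec d → Ξ → ℝ) (D : Fin N → Measure Ξ) (η β L σ : ℝ) (K : ℕ)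
    (s : State d N) : ℝ :=
  8 * (η * K * L) ^ 2 * (9 * (L ^ 2 * ‖s.x - s.xPrev‖ ^ 2) + 8 * (β ^ 2 * ctrlErr F D s)
    + 4 * ‖dirErr F D s‖ ^ 2 + 8 * ‖gradient (globalLoss F D) s.x‖ ^ 2 + β ^ 2 * σ ^ 2 / K)

lemma roundLE_drift (hL : 0 < L) (hw : WellPosed F D)
    (hs : SampleSmooth F L) (hg : StochasticGradient F D σ) (hS : S ≤ N) (hS1 : 1 ≤ S)
    (hK : 1 ≤ K) (hβ0 : 0 ≤ β) (hβ1 : β ≤ 1) (hη : (η * K * L) ^ 2 ≤ 1 / 8) {s : State d N}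
    (hc : s.c = (1 / (N : ℝ)) • ∑ i, s.ci i) :
    RoundLE D S (fun P ξ => ∑ i ∈ P, drift F η β L K s i ξ)
      (S * driftBound F D η β L σ K s) := by
  have hK' : (0 : ℝ) < K := by exact_mod_cast hK
  have hN : 0 < N := hS1.trans hS
  have hN' : (0 : ℝ) < N := by exact_mod_cast hN
  set X := L ^ 2 * ‖s.x - s.xPrev‖ ^ 2 with hX
  have hn := fun i k => integral_norm_sum_gradNoise_le hw hs hg s.xPrev i k
  have hnint : ∀ i, Integrable (fun ξ : Fin N × ℕ → Ξ => ∑ k ∈ Finset.range K,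
      ‖∑ j ∈ Finset.range k, gradNoise F D s.xPrev i (ξ (i, j))‖ ^ 2)
      (Measure.infinitePi fun j : Fin N × ℕ => D j.1) := fun i =>
    integrable_finsetSum _ fun k _ => (hn i k).1
  have hnle : ∀ i, ∫ ξ, ∑ k ∈ Finset.range K,
      ‖∑ j ∈ Finset.range k, gradNoise F D s.xPrev i (ξ (i, j))‖ ^ 2
      ∂(Measure.infinitePi fun j : Fin N × ℕ => D j.1) ≤ K ^ 2 * σ ^ 2 := by
    intro i
    rw [integral_finsetSum _ fun k _ => (hn i k).1]
    calc _ ≤ ∑ _k ∈ Finset.range K, (K : ℝ) * σ ^ 2 := by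
          refine Finset.sum_le_sum fun k hk => (hn i k).2.trans ?_
          have : (k : ℝ) ≤ K := by exact_mod_cast (Finset.mem_range.1 hk).le
          gcongr
      _ = _ := by
          rw [Finset.sum_const, Finset.card_range, nsmul_eq_mul]
          ring
  have h := RoundLE.sum_mem (D := D) hS hS1 (Φ := fun i ξ => 8 * (η * K * L) ^ 2 *
      (X + ‖meanDir F D β s i‖ ^ 2 + β ^ 2 / K ^ 3 * ∑ k ∈ Finset.range K,
        ‖∑ j ∈ Finset.range k, gradNoise F D s.xPrev i (ξ (i, j))‖ ^ 2))
    (τ := fun i => 8 * (η * K * L) ^ 2 *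
      (X + ‖meanDir F D β s i‖ ^ 2 + β ^ 2 * σ ^ 2 / K)) ?_ ?_
  · refine h.mono (fun P _ ξ => Finset.sum_le_sum fun i _ => drift_le hL hs hK hη s i ξ) ?_
    have hA := avg_norm_meanDir_sq_le hL hw hs hg hN hβ0 hβ1 hc
    rw [← Finset.mul_sum, Finset.sum_add_distrib, Finset.sum_add_distrib, Finset.sum_const,
      Finset.sum_const, Finset.card_univ, Fintype.card_fin, nsmul_eq_mul, nsmul_eq_mul, driftBound,
      ← hX]
    calc (S : ℝ) / N * (8 * (η * K * L) ^ 2 * (N * X + ∑ i, ‖meanDir F D β s i‖ ^ 2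
          + N * (β ^ 2 * σ ^ 2 / K)))
        = S * (8 * (η * K * L) ^ 2 * (X + 1 / N * ∑ i, ‖meanDir F D β s i‖ ^ 2
          + β ^ 2 * σ ^ 2 / K)) := by field_simp
      _ ≤ _ := by
          refine mul_le_mul_of_nonneg_left (mul_le_mul_of_nonneg_left ?_ (by positivity))
            (by positivity)
          linarith
  · exact fun i => (((integrable_const _).add ((hnint i).const_mul _)).const_mul _)
  · intro i
    rw [integral_const_mul, integral_add (integrable_const _) ((hnint i).const_mul _),
      integral_const_mul]
    simp only [integral_const, probReal_univ, one_smul]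
    refine mul_le_mul_of_nonneg_left (add_le_add le_rfl ?_) (by positivity)
    calc β ^ 2 / (K : ℝ) ^ 3 * _ ≤ β ^ 2 / (K : ℝ) ^ 3 * (K ^ 2 * σ ^ 2) := by
          gcongr
          exact hnle i
      _ = _ := by field_simp

end Expectation

end Round

/-! ### Errors of the momentum and of the control variates after one round -/

section OneRound

/-- Young's inequality with weight `β / 2` separates the damped error, with its centred perturbation,
from the drift `u`; one factor `1 - β` of the damping `(1 - β)²` survives. -/
lemma damped_error_arith {S K β E X V m u σ : ℝ} (hS : 0 < S) (hK : 1 ≤ K) (hβ0 : 0 < β)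
    (hβ1 : β ≤ 1) (hE : 0 ≤ E) (hX : 0 ≤ X) (hm0 : 0 ≤ m) (hu : 0 ≤ u)
    (hm : m ≤ 2 * X + 2 * (β ^ 2 * V)) :
    (1 + β / 2) * ((1 - β) ^ 2 * E + 1 / S * m + (8 * X + 2 * β ^ 2 * σ ^ 2) / (S * K))
      + (1 + 1 / (β / 2)) * (1 / S * (S * u))
    ≤ (1 - β) * E + 20 / S * X + 4 * β ^ 2 / S * V + 4 * β ^ 2 * σ ^ 2 / (S * K) + 3 / β * u := by
  have hK0 : 0 < K := by linarith
  have h2 : (1 + β / 2) * ((1 - β) ^ 2 * E) ≤ (1 - β) * E := by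
    have : (1 + β / 2) * (1 - β) ^ 2 ≤ 1 - β := by nlinarith [sq_nonneg β]
    calc _ = (1 + β / 2) * (1 - β) ^ 2 * E := by ring
      _ ≤ _ := by gcongr
  have h3 : 1 / S * m + (8 * X + 2 * β ^ 2 * σ ^ 2) / (S * K)
      ≤ 10 / S * X + 2 * β ^ 2 / S * V + 2 * β ^ 2 * σ ^ 2 / (S * K) := by
    have h4 : 8 * X / (S * K) ≤ 8 * X / S := by
      gcongr
      nlinarith
    have h5 : 1 / S * m ≤ 1 / S * (2 * X + 2 * (β ^ 2 * V)) := by gcongr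
    rw [add_div]
    calc _ ≤ 1 / S * (2 * X + 2 * (β ^ 2 * V)) + (8 * X / S
          + 2 * β ^ 2 * σ ^ 2 / (S * K)) := by linarith
      _ = _ := by ring
  have h6 : (1 + β / 2) * (1 / S * m + (8 * X + 2 * β ^ 2 * σ ^ 2) / (S * K))
      ≤ 2 * (10 / S * X + 2 * β ^ 2 / S * V + 2 * β ^ 2 * σ ^ 2 / (S * K)) :=
    mul_le_mul (by linarith) h3 (by positivity) (by norm_num)
  have h7 : (1 + 1 / (β / 2)) * (1 / S * (S * u)) ≤ 3 / β * u := by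
    have e1 : 1 / S * (S * u) = u := by field_simp
    rw [e1]
    gcongr
    rw [le_div_iff₀ hβ0]
    field_simp
    linarith
  calc _ = (1 + β / 2) * ((1 - β) ^ 2 * E) + (1 + β / 2) * (1 / S * m
        + (8 * X + 2 * β ^ 2 * σ ^ 2) / (S * K)) + (1 + 1 / (β / 2)) * (1 / S * (S * u)) := by
        ring
    _ ≤ _ := add_le_add (add_le_add h2 h6) h7
    _ = _ := by ring

variable {d N : ℕ} {Ξ : Type*} {F : Vec d → Ξ → ℝ} {η γ β L σ : ℝ} {S K : ℕ}

lemma norm_drift_term_sq_le (hs : SampleSmooth F L) (hK : 1 ≤ K) (hS1 : 1 ≤ S) (s : State d N)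
    {P : Finset (Fin N)} (hP : P.card = S) (ξ : Fin N × ℕ → Ξ) :
    ‖(1 / ((S : ℝ) * K)) • ∑ j ∈ P ×ˢ Finset.range K,
        (sampleGrad F (localModel F η β s j.1 (fun k => ξ (j.1, k)) j.2) (ξ j)
          - sampleGrad F s.x (ξ j))‖ ^ 2
      ≤ 1 / S * ∑ i ∈ P, drift F η β L K s i ξ := by
  have hK' : (0 : ℝ) < K := by exact_mod_cast hK
  have hS' : (0 : ℝ) < S := by exact_mod_cast hS1
  rw [norm_smul, mul_pow, Real.norm_of_nonneg (by positivity)]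
  calc _ ≤ (1 / ((S : ℝ) * K)) ^ 2 * ((P ×ˢ Finset.range K).card * ∑ j ∈ P ×ˢ Finset.range K,
        L ^ 2 * ‖localModel F η β s j.1 (fun k => ξ (j.1, k)) j.2 - s.x‖ ^ 2) := by
        refine mul_le_mul_of_nonneg_left ((norm_sum_sq_le _ _).trans ?_) (by positivity)
        exact mul_le_mul_of_nonneg_left
          (Finset.sum_le_sum fun j _ => norm_sampleGrad_sub_sq_le hs _ _ _) (by positivity)
    _ = _ := by
        rw [Finset.card_product, hP, Finset.card_range, Finset.sum_product]
        simp only [drift, ← Finset.mul_sum]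
        push_cast
        field_simp

variable [MeasurableSpace Ξ] {D : Fin N → Measure Ξ}

/-- The centred noise of one local direction, before the drift of the local model. -/
noncomputable def dirNoise (F : Vec d → Ξ → ℝ) (D : Fin N → Measure Ξ) (β : ℝ) (s : State d N)
    (i : Fin N) (ξ : Ξ) : Vec d :=
  gradNoise F D s.x i ξ - (1 - β) • gradNoise F D s.xPrev i ξ

/-- The deviation of the mean direction of client `i` from the average over all clients. -/
noncomputable def dirDev (F : Vec d → Ξ → ℝ) (D : Fin N → Measure Ξ) (β : ℝ) (s : State d N)
    (i : Fin N) : Vec d :=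
  (gradient (localLoss F D i) s.x - (1 - β) • gradient (localLoss F D i) s.xPrev
      - β • (s.ci i - s.c))
    - (gradient (globalLoss F D) s.x - (1 - β) • gradient (globalLoss F D) s.xPrev)

/-- After one round, the error of the momentum is the old one damped by `1 - β`, plus a centred
term from the sampling of clients and gradients, plus the effect of the local drift. -/
lemma dirErr_round_eq (hη : 0 < η) (hK : 1 ≤ K) (hS1 : 1 ≤ S) (s : State d N)
    {P : Finset (Fin N)} (hP : P.card = S) (ξ : Fin N × ℕ → Ξ) :
    dirErr F D (round F η γ β S K s P ξ)
      = ((1 - β) • dirErr F D s + (1 / (S : ℝ)) • ∑ i ∈ P, dirDev F D β s i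
          + ∑ j ∈ P ×ˢ Finset.range K, (1 / ((S : ℝ) * K)) • dirNoise F D β s j.1 (ξ j))
        + (1 / ((S : ℝ) * K)) • ∑ j ∈ P ×ˢ Finset.range K,
          (sampleGrad F (localModel F η β s j.1 (fun k => ξ (j.1, k)) j.2) (ξ j)
            - sampleGrad F s.x (ξ j)) := by
  have hK' : (K : ℝ) ≠ 0 := by positivity
  have hS' : (S : ℝ) ≠ 0 := by positivity
  have h1 : ∀ v : Vec d, v = (1 / ((S : ℝ) * K)) • ∑ _j ∈ P ×ˢ Finset.range K, v := by
    intro v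
    rw [Finset.sum_const, Finset.card_product, hP, Finset.card_range, ← Nat.cast_smul_eq_nsmul ℝ,
      smul_smul, Nat.cast_mul, one_div_mul_cancel (by positivity), one_smul]
  have h2 : (1 / (S : ℝ)) • ∑ i ∈ P, dirDev F D β s i
      = (1 / ((S : ℝ) * K)) • ∑ j ∈ P ×ˢ Finset.range K, dirDev F D β s j.1 := by
    rw [Finset.sum_product]
    simp only [Finset.sum_const, Finset.card_range, ← Nat.cast_smul_eq_nsmul ℝ]
    rw [← Finset.smul_sum, smul_smul]
    congr 1
    field_simp
  have h3 : (round F η γ β S K s P ξ).g = (1 / ((S : ℝ) * K)) • ∑ j ∈ P ×ˢ Finset.range K,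
      (sampleGrad F (localModel F η β s j.1 (fun k => ξ (j.1, k)) j.2) (ξ j)
        - β • (s.ci j.1 - s.c) + (1 - β) • (s.g - sampleGrad F s.xPrev (ξ j))) := by
    have e : ∀ i, s.x - localModel F η β s i (fun k => ξ (i, k)) K = η • ∑ k ∈ Finset.range K,
        (sampleGrad F (localModel F η β s i (fun k => ξ (i, k)) k) (ξ (i, k))
          - β • (s.ci i - s.c) + (1 - β) • (s.g - sampleGrad F s.xPrev (ξ (i, k)))) := by
      intro i
      rw [← neg_sub, localModel_sub_eq, neg_neg]
    simp only [round]
    simp_rw [e]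
    rw [← Finset.smul_sum, smul_smul, Finset.sum_product]
    congr 1
    field_simp
  have h4 : dirErr F D (round F η γ β S K s P ξ)
      = (round F η γ β S K s P ξ).g - gradient (globalLoss F D) s.x := rfl
  have h5 : ∑ j ∈ P ×ˢ Finset.range K, (1 / ((S : ℝ) * K)) • dirNoise F D β s j.1 (ξ j)
      = (1 / ((S : ℝ) * K)) • ∑ j ∈ P ×ˢ Finset.range K, dirNoise F D β s j.1 (ξ j) :=
    Finset.smul_sum.symm
  rw [h4, h3, h1 ((1 - β) • dirErr F D s), h1 (gradient (globalLoss F D) s.x), h2,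
    h5, ← smul_sub, ← smul_add, ← smul_add, ← smul_add, ← Finset.sum_sub_distrib,
    ← Finset.sum_add_distrib, ← Finset.sum_add_distrib, ← Finset.sum_add_distrib]
  congr 1
  refine Finset.sum_congr rfl fun j _ => ?_
  simp only [dirErr, dirDev, dirNoise, gradNoise]
  module

lemma sum_dirDev [∀ i, IsProbabilityMeasure (D i)] (hL : 0 < L) (hw : WellPosed F D)
    (hs : SampleSmooth F L) (hg : StochasticGradient F D σ) (hN : 0 < N) {s : State d N}
    (hc : s.c = (1 / (N : ℝ)) • ∑ i, s.ci i) : ∑ i, dirDev F D β s i = 0 := by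
  have hN' : (N : ℝ) ≠ 0 := by positivity
  have h1 : ∀ v : Fin N → Vec d, ∑ i, v i = (N : ℝ) • ((1 / (N : ℝ)) • ∑ i, v i) := by
    intro v
    rw [smul_smul, mul_one_div_cancel hN', one_smul]
  have h2 : ∀ v : Vec d, ∑ _i : Fin N, v = (N : ℝ) • v := by
    intro v
    rw [Finset.sum_const, Finset.card_univ, Fintype.card_fin, ← Nat.cast_smul_eq_nsmul ℝ]
  simp only [dirDev, Finset.sum_sub_distrib, ← Finset.smul_sum]
  rw [h1 s.ci, ← hc, h1 fun i => gradient (localLoss F D i) s.x,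
    h1 fun i => gradient (localLoss F D i) s.xPrev, ← gradient_globalLoss hL hw hs hg,
    ← gradient_globalLoss hL hw hs hg]
  simp only [h2]
  module

lemma sum_norm_sub_avg_sq_le {N : ℕ} (hN : 0 < N) (p : Fin N → Vec d) :
    ∑ i, ‖p i - (1 / (N : ℝ)) • ∑ j, p j‖ ^ 2 ≤ ∑ i, ‖p i‖ ^ 2 := by
  have hN' : (0 : ℝ) < N := by exact_mod_cast hN
  simp_rw [norm_sub_sq_real]
  rw [Finset.sum_add_distrib, Finset.sum_sub_distrib, ← Finset.mul_sum, ← sum_inner,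
    real_inner_smul_right, real_inner_self_eq_norm_sq, Finset.sum_const, Finset.card_univ,
    Fintype.card_fin, nsmul_eq_mul, norm_smul, mul_pow, Real.norm_of_nonneg (by positivity)]
  have e : (N : ℝ) * ((1 / N) ^ 2 * ‖∑ i, p i‖ ^ 2) = 1 / N * ‖∑ i, p i‖ ^ 2 := by field_simp
  have h : 0 ≤ 1 / (N : ℝ) * ‖∑ i, p i‖ ^ 2 := by positivity
  linarith

/-- The control variates make the spread of the directions over the clients small, however
heterogeneous the clients are. -/
lemma avg_norm_dirDev_sq_le [∀ i, IsProbabilityMeasure (D i)] (hL : 0 < L) (hw : WellPosed F D)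
    (hs : SampleSmooth F L) (hg : StochasticGradient F D σ) (hN : 0 < N) {s : State d N}
    (hc : s.c = (1 / (N : ℝ)) • ∑ i, s.ci i) :
    1 / (N : ℝ) * ∑ i, ‖dirDev F D β s i‖ ^ 2
      ≤ 2 * (L ^ 2 * ‖s.x - s.xPrev‖ ^ 2) + 2 * (β ^ 2 * ctrlErr F D s) := by
  have hN' : (0 : ℝ) < N := by exact_mod_cast hN
  set p : Fin N → Vec d := fun i =>
    (gradient (localLoss F D i) s.x - gradient (localLoss F D i) s.xPrev)
      + β • (gradient (localLoss F D i) s.xPrev - s.ci i) with hp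
  have hdev : ∀ i, dirDev F D β s i = p i - (1 / (N : ℝ)) • ∑ j, p j := by
    intro i
    have e : (1 / (N : ℝ)) • ∑ j, p j = (gradient (globalLoss F D) s.x
        - gradient (globalLoss F D) s.xPrev) + β • (gradient (globalLoss F D) s.xPrev - s.c) := by
      simp only [hp, Finset.sum_add_distrib, Finset.sum_sub_distrib, ← Finset.smul_sum]
      rw [gradient_globalLoss hL hw hs hg, gradient_globalLoss hL hw hs hg, hc]
      module
    rw [e, hp, dirDev]
    module
  simp_rw [hdev]
  calc 1 / (N : ℝ) * ∑ i, ‖p i - (1 / (N : ℝ)) • ∑ j, p j‖ ^ 2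
      ≤ 1 / (N : ℝ) * ∑ i, ‖p i‖ ^ 2 := by
        exact mul_le_mul_of_nonneg_left (sum_norm_sub_avg_sq_le hN p) (by positivity)
    _ ≤ 1 / (N : ℝ) * ∑ i, (2 * (L ^ 2 * ‖s.x - s.xPrev‖ ^ 2)
        + 2 * β ^ 2 * ‖s.ci i - gradient (localLoss F D i) s.xPrev‖ ^ 2) := by
        gcongr with i
        have h1 := norm_add_sq_le_two_mul
          (gradient (localLoss F D i) s.x - gradient (localLoss F D i) s.xPrev)
          (β • (gradient (localLoss F D i) s.xPrev - s.ci i))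
        rw [norm_smul, mul_pow, Real.norm_eq_abs, sq_abs, norm_sub_rev _ (s.ci i)] at h1
        have h2 := norm_gradient_localLoss_sub_sq_le hs hg i s.x s.xPrev
        simp only [hp]
        linarith
    _ = _ := by
        rw [Finset.sum_add_distrib, Finset.sum_const, Finset.card_univ,
          Fintype.card_fin, nsmul_eq_mul, ← Finset.mul_sum]
        simp only [ctrlErr]
        field_simp

lemma norm_dirNoise_sq_le [∀ i, IsProbabilityMeasure (D i)]
    (hs : SampleSmooth F L) (hg : StochasticGradient F D σ) (s : State d N) (i : Fin N) (ξ : Ξ) :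
    ‖dirNoise F D β s i ξ‖ ^ 2 ≤ 8 * (L ^ 2 * ‖s.x - s.xPrev‖ ^ 2)
      + 2 * β ^ 2 * ‖gradNoise F D s.xPrev i ξ‖ ^ 2 := by
  have e : dirNoise F D β s i ξ = ((sampleGrad F s.x ξ - sampleGrad F s.xPrev ξ)
      + -(gradient (localLoss F D i) s.x - gradient (localLoss F D i) s.xPrev))
      + β • gradNoise F D s.xPrev i ξ := by
    simp only [dirNoise, gradNoise]
    module
  have h1 := norm_add_sq_le_two_mul ((sampleGrad F s.x ξ - sampleGrad F s.xPrev ξ)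
      + -(gradient (localLoss F D i) s.x - gradient (localLoss F D i) s.xPrev))
      (β • gradNoise F D s.xPrev i ξ)
  have h2 := norm_add_sq_le_two_mul (sampleGrad F s.x ξ - sampleGrad F s.xPrev ξ)
      (-(gradient (localLoss F D i) s.x - gradient (localLoss F D i) s.xPrev))
  rw [norm_neg] at h2
  rw [← e, norm_smul, mul_pow, Real.norm_eq_abs, sq_abs] at h1
  have h3 := norm_gradient_localLoss_sub_sq_le hs hg i s.x s.xPrev
  have h4 := norm_sampleGrad_sub_sq_le hs s.x s.xPrev ξ
  linarith

variable [∀ i, IsProbabilityMeasure (D i)]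

/-- The recursion for the momentum error. The noise enters with the factor `β²`, since the stochastic
gradients at `x^r` and `x^{r-1}` share their samples. -/
lemma roundLE_dirErr (hL : 0 < L) (hw : WellPosed F D)
    (hs : SampleSmooth F L) (hg : StochasticGradient F D σ) (hS : S ≤ N) (hS1 : 1 ≤ S)
    (hK : 1 ≤ K) (hβ0 : 0 < β) (hβ1 : β ≤ 1) (hη0 : 0 < η) (hη : (η * K * L) ^ 2 ≤ 1 / 8)
    {s : State d N} (hc : s.c = (1 / (N : ℝ)) • ∑ i, s.ci i) :
    RoundLE D S (fun P ξ => ‖dirErr F D (round F η γ β S K s P ξ)‖ ^ 2)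
      ((1 - β) * ‖dirErr F D s‖ ^ 2 + 20 / S * (L ^ 2 * ‖s.x - s.xPrev‖ ^ 2)
        + 4 * β ^ 2 / S * ctrlErr F D s + 4 * β ^ 2 * σ ^ 2 / (S * K)
        + 3 / β * driftBound F D η β L σ K s) := by
  have hK1 : (1 : ℝ) ≤ K := by exact_mod_cast hK
  have hK' : (0 : ℝ) < K := by linarith
  have hS' : (0 : ℝ) < S := by exact_mod_cast hS1
  have hN : 0 < N := hS1.trans hS
  have hN' : (0 : ℝ) < N := by exact_mod_cast hN
  set X := L ^ 2 * ‖s.x - s.xPrev‖ ^ 2 with hX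
  have hX0 : 0 ≤ X := by positivity
  have hsq : ∀ i, Integrable (fun ξ => ‖gradNoise F D s.xPrev i ξ‖ ^ 2) (D i) := fun i =>
    hg.integrable_sq i s.xPrev
  have hbint : ∀ i, Integrable (fun ξ => 8 * X + 2 * β ^ 2 * ‖gradNoise F D s.xPrev i ξ‖ ^ 2)
      (D i) := fun i => (integrable_const _).add ((hsq i).const_mul _)
  have hmeas : ∀ i, Measurable (dirNoise F D β s i) := fun i =>
    (measurable_gradNoise hw hs s.x i).sub
      ((measurable_gradNoise hw hs s.xPrev i).const_smul (1 - β))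
  have hint : ∀ i, Integrable (fun ξ => ‖dirNoise F D β s i ξ‖ ^ 2) (D i) := fun i =>
    (hbint i).mono' ((hmeas i).norm.pow_const 2).aestronglyMeasurable
      (Filter.Eventually.of_forall fun ξ => by
        rw [Real.norm_of_nonneg (by positivity)]
        exact norm_dirNoise_sq_le hs hg s i ξ)
  have hnoiseint : ∀ x i, Integrable (gradNoise F D x i) (D i) := fun x i =>
    (hg.integrable i x).sub (integrable_const _)
  have hM := roundLE_norm_sq (D := D) hS hS1 K (Z := dirNoise F D β s) hmeas hint
    (fun i => by
      simp only [dirNoise]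
      have h : Integrable (fun ξ => (1 - β) • gradNoise F D s.xPrev i ξ) (D i) :=
        (hnoiseint s.xPrev i).smul (1 - β)
      rw [integral_sub (hnoiseint s.x i) h, integral_smul,
        integral_gradNoise hg, integral_gradNoise hg, smul_zero, sub_zero])
    (τ := 8 * X + 2 * β ^ 2 * σ ^ 2)
    (fun i => by
      refine (integral_mono (hint i) (hbint i) fun ξ => norm_dirNoise_sq_le hs hg s i ξ).trans ?_
      rw [integral_add (integrable_const _) ((hsq i).const_mul _), integral_const, probReal_univ,
        one_smul, integral_const_mul]
      have h1 : ∫ ξ, ‖gradNoise F D s.xPrev i ξ‖ ^ 2 ∂(D i) ≤ σ ^ 2 := hg.variance_le i s.xPrev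
      have h2 := mul_le_mul_of_nonneg_left h1 (by positivity : 0 ≤ 2 * β ^ 2)
      linarith)
    ((1 - β) • dirErr F D s) (sum_dirDev (β := β) hL hw hs hg hN hc)
  have hD := roundLE_drift hL hw hs hg hS hS1 hK hβ0.le hβ1 hη hc
  have ht : (0 : ℝ) < β / 2 := by positivity
  refine ((hM.const_mul (by positivity : 0 ≤ 1 + β / 2)).add
    ((hD.const_mul (by positivity : (0 : ℝ) ≤ 1 / S)).const_mul
      (by positivity : 0 ≤ 1 + 1 / (β / 2)))).mono (fun P hP ξ => ?_) ?_
  · rw [dirErr_round_eq hη0 hK hS1 s hP ξ]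
    refine (norm_add_sq_le_young ht _ _).trans ?_
    gcongr
    exact norm_drift_term_sq_le hs hK hS1 s hP ξ
  · have h1 := avg_norm_dirDev_sq_le (β := β) hL hw hs hg hN hc
    rw [← hX] at h1
    have hV0 : 0 ≤ ctrlErr F D s :=
      mul_nonneg (by positivity) (Finset.sum_nonneg fun _ _ => by positivity)
    have hu0 : 0 ≤ driftBound F D η β L σ K s := by
      rw [driftBound]
      positivity
    have hE : ‖(1 - β) • dirErr F D s‖ ^ 2 = (1 - β) ^ 2 * ‖dirErr F D s‖ ^ 2 := by
      rw [norm_smul, mul_pow, Real.norm_eq_abs, sq_abs]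
    rw [hE]
    exact damped_error_arith hS' hK1 hβ0 hβ1 (sq_nonneg _) hX0
      (mul_nonneg (by positivity) (Finset.sum_nonneg fun _ _ => by positivity)) hu0 h1

lemma ctrlErr_round_le (hs : SampleSmooth F L) (hg : StochasticGradient F D σ)
    (hK : 1 ≤ K) {q : ℝ} (hq : 0 < q) (s : State d N) (P : Finset (Fin N))
    (ξ : Fin N × ℕ → Ξ) :
    ctrlErr F D (round F η γ β S K s P ξ)
      ≤ (1 + q / 2) * ctrlErr F D s + (1 + 2 / q) * (L ^ 2 * ‖s.x - s.xPrev‖ ^ 2)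
        + 1 / N * ∑ i ∈ P, (2 / K ^ 2 * ‖∑ k ∈ Finset.range K, gradNoise F D s.x i (ξ (i, k))‖ ^ 2
          - ((1 + q / 2) * ‖s.ci i - gradient (localLoss F D i) s.xPrev‖ ^ 2
            + (1 + 2 / q) * (L ^ 2 * ‖s.x - s.xPrev‖ ^ 2)))
        + 2 / N * ∑ i ∈ P, drift F η β L K s i ξ := by
  have hK' : (0 : ℝ) < K := by exact_mod_cast hK
  rcases Nat.eq_zero_or_pos N with rfl | hN
  · simp only [ctrlErr, CharP.cast_eq_zero, div_zero, zero_mul, add_zero, mul_zero, zero_add]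
    positivity
  have hN' : (0 : ℝ) < N := by exact_mod_cast hN
  set X := L ^ 2 * ‖s.x - s.xPrev‖ ^ 2 with hX
  set w : Fin N → ℝ := fun i => (1 + q / 2) * ‖s.ci i - gradient (localLoss F D i) s.xPrev‖ ^ 2
    + (1 + 2 / q) * X with hw
  set n : Fin N → ℝ := fun i =>
    2 / K ^ 2 * ‖∑ k ∈ Finset.range K, gradNoise F D s.x i (ξ (i, k))‖ ^ 2 with hn
  have hW : (1 + q / 2) * ctrlErr F D s + (1 + 2 / q) * X = 1 / N * ∑ i, w i := by
    simp only [hw, ctrlErr, Finset.sum_add_distrib, ← Finset.mul_sum, Finset.sum_const,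
      Finset.card_univ, Fintype.card_fin, nsmul_eq_mul]
    field_simp
  have hin : ∀ i, ‖(1 / (K : ℝ)) • ∑ k ∈ Finset.range K,
      sampleGrad F (localModel F η β s i (fun k => ξ (i, k)) k) (ξ (i, k))
        - gradient (localLoss F D i) s.x‖ ^ 2 ≤ n i + 2 * drift F η β L K s i ξ := by
    intro i
    have e : (1 / (K : ℝ)) • ∑ k ∈ Finset.range K,
        sampleGrad F (localModel F η β s i (fun k => ξ (i, k)) k) (ξ (i, k))
          - gradient (localLoss F D i) s.x
        = (1 / (K : ℝ)) • ∑ k ∈ Finset.range K, gradNoise F D s.x i (ξ (i, k))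
          + (1 / (K : ℝ)) • ∑ k ∈ Finset.range K,
            (sampleGrad F (localModel F η β s i (fun k => ξ (i, k)) k) (ξ (i, k))
              - sampleGrad F s.x (ξ (i, k))) := by
      have e1 : gradient (localLoss F D i) s.x
          = (1 / (K : ℝ)) • ∑ _k ∈ Finset.range K, gradient (localLoss F D i) s.x := by
        rw [Finset.sum_const, Finset.card_range, ← Nat.cast_smul_eq_nsmul ℝ, smul_smul,
          one_div_mul_cancel hK'.ne', one_smul]
      conv_lhs => rw [e1]
      rw [← smul_sub, ← smul_add, ← Finset.sum_sub_distrib, ← Finset.sum_add_distrib]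
      congr 1
      refine Finset.sum_congr rfl fun k _ => ?_
      simp only [gradNoise]
      abel
    rw [e]
    refine (norm_add_sq_le_two_mul _ _).trans ?_
    rw [norm_smul, norm_smul, mul_pow, mul_pow, Real.norm_of_nonneg (by positivity), mul_add]
    refine add_le_add (le_of_eq (by simp only [hn]; ring)) ?_
    refine mul_le_mul_of_nonneg_left ?_ (by norm_num)
    calc _ ≤ (1 / (K : ℝ)) ^ 2 * ((Finset.range K).card * ∑ k ∈ Finset.range K,
          L ^ 2 * ‖localModel F η β s i (fun k => ξ (i, k)) k - s.x‖ ^ 2) := by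
          refine mul_le_mul_of_nonneg_left ((norm_sum_sq_le _ _).trans ?_) (by positivity)
          exact mul_le_mul_of_nonneg_left
            (Finset.sum_le_sum fun k _ => norm_sampleGrad_sub_sq_le hs _ _ _) (by positivity)
      _ = _ := by
          rw [Finset.card_range, ← Finset.mul_sum, drift]
          field_simp
  have hout : ∀ i, ‖s.ci i - gradient (localLoss F D i) s.x‖ ^ 2 ≤ w i := by
    intro i
    have h := norm_add_sq_le_young (by positivity : 0 < q / 2)
      (s.ci i - gradient (localLoss F D i) s.xPrev)
      (gradient (localLoss F D i) s.xPrev - gradient (localLoss F D i) s.x)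
    rw [sub_add_sub_cancel, one_div_div] at h
    refine h.trans (add_le_add le_rfl ?_)
    have h2 := norm_gradient_localLoss_sub_sq_le hs hg i s.xPrev s.x
    rw [norm_sub_rev s.xPrev] at h2
    gcongr
  have hterm : ∀ i, ‖(round F η γ β S K s P ξ).ci i - gradient (localLoss F D i) s.x‖ ^ 2
      ≤ w i + ((if i ∈ P then n i - w i else 0)
        + 2 * if i ∈ P then drift F η β L K s i ξ else 0) := by
    intro i
    by_cases hi : i ∈ P
    · simp only [round, hi, if_true]
      linarith [hin i]
    · simp only [round, hi, if_false]
      linarith [hout i]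
  rw [hW]
  change _ ≤ 1 / N * ∑ i, w i + 1 / N * ∑ i ∈ P, (n i - w i)
    + 2 / N * ∑ i ∈ P, drift F η β L K s i ξ
  clear_value w n
  calc ctrlErr F D (round F η γ β S K s P ξ)
      ≤ 1 / N * ∑ i, (w i + ((if i ∈ P then n i - w i else 0)
        + 2 * if i ∈ P then drift F η β L K s i ξ else 0)) := by
        refine mul_le_mul_of_nonneg_left ?_ (by positivity)
        exact Finset.sum_le_sum fun i _ => hterm i
    _ = _ := by
        rw [Finset.sum_add_distrib, Finset.sum_add_distrib, ← Finset.mul_sum,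
          ← sum_mem_eq_sum_indicator P, ← sum_mem_eq_sum_indicator P]
        ring

/-- The recursion for the control variates: a client is refreshed with probability `S / N`, which
contracts their mean squared error, and otherwise only the target `∇f_i` moves. -/
lemma roundLE_ctrlErr (hL : 0 < L) (hw : WellPosed F D)
    (hs : SampleSmooth F L) (hg : StochasticGradient F D σ) (hS : S ≤ N) (hS1 : 1 ≤ S)
    (hK : 1 ≤ K) (hβ0 : 0 ≤ β) (hβ1 : β ≤ 1) (hη : (η * K * L) ^ 2 ≤ 1 / 8)
    {s : State d N} (hc : s.c = (1 / (N : ℝ)) • ∑ i, s.ci i) :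
    RoundLE D S (fun P ξ => ctrlErr F D (round F η γ β S K s P ξ))
      ((1 - (S : ℝ) / N / 2) * ctrlErr F D s + 3 / ((S : ℝ) / N) * (L ^ 2 * ‖s.x - s.xPrev‖ ^ 2)
        + 2 * ((S : ℝ) / N) * (σ ^ 2 / K + driftBound F D η β L σ K s)) := by
  have hK' : (0 : ℝ) < K := by exact_mod_cast hK
  have hS' : (0 : ℝ) < S := by exact_mod_cast hS1
  have hN' : (0 : ℝ) < N := by exact_mod_cast hS1.trans hS
  have hq : (0 : ℝ) < (S : ℝ) / N := by positivity
  have hq1 : (S : ℝ) / N ≤ 1 := by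
    rw [div_le_one hN']
    exact_mod_cast hS
  have hn := fun i => integral_norm_sum_gradNoise_le hw hs hg s.x i K
  set X := L ^ 2 * ‖s.x - s.xPrev‖ ^ 2 with hX
  have hX0 : 0 ≤ X := by positivity
  have hV0 : 0 ≤ ctrlErr F D s :=
    mul_nonneg (by positivity) (Finset.sum_nonneg fun _ _ => by positivity)
  set q := (S : ℝ) / N with hqdef
  have h1 := RoundLE.sum_mem (D := D) hS hS1
    (Φ := fun i ξ => 2 / (K : ℝ) ^ 2 * ‖∑ k ∈ Finset.range K, gradNoise F D s.x i (ξ (i, k))‖ ^ 2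
      - ((1 + q / 2) * ‖s.ci i - gradient (localLoss F D i) s.xPrev‖ ^ 2 + (1 + 2 / q) * X))
    (τ := fun i => 2 * σ ^ 2 / K
      - ((1 + q / 2) * ‖s.ci i - gradient (localLoss F D i) s.xPrev‖ ^ 2 + (1 + 2 / q) * X))
    (fun i => ((hn i).1.const_mul _).sub (integrable_const _))
    (fun i => by
      rw [integral_sub ((hn i).1.const_mul _) (integrable_const _), integral_const_mul]
      simp only [integral_const, probReal_univ, one_smul]
      refine sub_le_sub_right ?_ _
      calc _ ≤ 2 / (K : ℝ) ^ 2 * (K * σ ^ 2) :=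
            mul_le_mul_of_nonneg_left (hn i).2 (by positivity)
        _ = _ := by field_simp)
  have hD := roundLE_drift hL hw hs hg hS hS1 hK hβ0 hβ1 hη hc
  refine (((RoundLE.const hS ((1 + q / 2) * ctrlErr F D s + (1 + 2 / q) * X)).add
    (h1.const_mul (by positivity : (0 : ℝ) ≤ 1 / N))).add
      (hD.const_mul (by positivity : (0 : ℝ) ≤ 2 / N))).mono
      (fun P _ ξ => ctrlErr_round_le hs hg hK hq s P ξ) ?_
  have e1 : 1 / (N : ℝ) * (q * ∑ i, (2 * σ ^ 2 / K
      - ((1 + q / 2) * ‖s.ci i - gradient (localLoss F D i) s.xPrev‖ ^ 2 + (1 + 2 / q) * X)))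
      = q * (2 * σ ^ 2 / K - ((1 + q / 2) * ctrlErr F D s + (1 + 2 / q) * X)) := by
    rw [Finset.sum_sub_distrib, Finset.sum_add_distrib, ← Finset.mul_sum, Finset.sum_const,
      Finset.sum_const, Finset.card_univ, Fintype.card_fin, nsmul_eq_mul, nsmul_eq_mul, ctrlErr]
    field_simp
  have e2 : 2 / (N : ℝ) * (S * driftBound F D η β L σ K s)
      = 2 * q * driftBound F D η β L σ K s := by
    rw [hqdef]
    ring
  rw [e1, e2]
  have h3 : (1 - q) * ((1 + q / 2) * ctrlErr F D s) ≤ (1 - q / 2) * ctrlErr F D s := by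
    rw [← mul_assoc]
    gcongr
    nlinarith
  have h4 : (1 - q) * ((1 + 2 / q) * X) ≤ 3 / q * X := by
    rw [← mul_assoc]
    gcongr
    rw [le_div_iff₀ hq]
    have : (1 - q) * (1 + 2 / q) * q = (1 - q) * (q + 2) := by field_simp
    rw [this]
    nlinarith
  have e3 : 2 * q * (σ ^ 2 / K + driftBound F D η β L σ K s)
      = q * (2 * σ ^ 2 / K) + 2 * q * driftBound F D η β L σ K s := by ring
  rw [e3]
  linarith

end OneRound

/-! ### The Lyapunov function -/

section Lyapunov

variable {d N : ℕ} {Ξ : Type*} [MeasurableSpace Ξ] {F : Vec d → Ξ → ℝ} {D : Fin N → Measure Ξ}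
  {η γ β L σ : ℝ} {S K : ℕ}

/-- The Lyapunov function: the gap to `inf f`, plus weighted squared errors of the momentum and of
the control variates, plus the squared length of the last step. -/
noncomputable def lyapunov (F : Vec d → Ξ → ℝ) (D : Fin N → Measure Ξ) (γ A B : ℝ)
    (s : State d N) : ℝ :=
  (globalLoss F D s.x - ⨅ x, globalLoss F D x) + A * ‖dirErr F D s‖ ^ 2 + B * ctrlErr F D s
    + 1 / (4 * γ) * ‖s.x - s.xPrev‖ ^ 2

lemma ctrlErr_nonneg (s : State d N) : 0 ≤ ctrlErr F D s :=
  mul_nonneg (by positivity) (Finset.sum_nonneg fun _ _ => by positivity)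

lemma lyapunov_nonneg (hw : WellPosed F D) (hγ : 0 < γ) {A B : ℝ} (hA : 0 ≤ A) (hB : 0 ≤ B)
    (s : State d N) : 0 ≤ lyapunov F D γ A B s := by
  have h1 : 0 ≤ globalLoss F D s.x - ⨅ x, globalLoss F D x :=
    sub_nonneg.2 (ciInf_le hw.bddBelow s.x)
  have h2 := mul_nonneg hB (ctrlErr_nonneg (F := F) (D := D) s)
  unfold lyapunov
  positivity

lemma lyapunov_round_le [∀ i, IsProbabilityMeasure (D i)] (hL : 0 < L)
    (hw : WellPosed F D) (hs : SampleSmooth F L) (hg : StochasticGradient F D σ) (hN : 0 < N)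
    (hγ : 0 < γ) (hγL : γ * L ≤ 1 / 4) (A B : ℝ) (s : State d N) (P : Finset (Fin N))
    (ξ : Fin N × ℕ → Ξ) :
    lyapunov F D γ A B (round F η γ β S K s P ξ)
      ≤ (globalLoss F D s.x - (⨅ x, globalLoss F D x)
          - γ / 2 * ‖gradient (globalLoss F D) s.x‖ ^ 2)
        + (A + γ / 2) * ‖dirErr F D (round F η γ β S K s P ξ)‖ ^ 2
        + B * ctrlErr F D (round F η γ β S K s P ξ) := by
  set s' := round F η γ β S K s P ξ with hs'
  have h1 : s'.x = s.x - γ • s'.g := rfl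
  have h2 : s'.xPrev = s.x := rfl
  have h3 := globalLoss_step_le hL hw hs hg hN hγ hγL s.x s'.g
  have h4 : s'.x - s'.xPrev = -(γ • s'.g) := by rw [h1, h2]; abel
  have h5 : 1 / (4 * γ) * ‖s'.x - s'.xPrev‖ ^ 2 = γ / 4 * ‖s'.g‖ ^ 2 := by
    rw [h4, norm_neg, norm_smul, mul_pow, Real.norm_of_nonneg hγ.le]
    field_simp
  have h6 : dirErr F D s' = s'.g - gradient (globalLoss F D) s.x := rfl
  rw [lyapunov, h5, h1, h6]
  linarith

/-- The weights of the Lyapunov function absorb all the error terms of one round; `u` is the bound on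
the local drift and `h = (ηKL)²`. -/
lemma lyapunov_arith {E V X Y G A A' γ β S K q σ h : ℝ} (hγ : 0 < γ) (hβ0 : 0 < β) (hβ1 : β ≤ 1)
    (hS : 1 ≤ S) (hK : 0 < K) (hq : 0 < q) (hA' : 0 ≤ A') (hβA : β * A' ≤ γ)
    (hA : A = (1 - β) * A' + γ) (hh0 : 0 ≤ h) (hh1 : h ≤ β ^ 2 / 20000)
    (hh2 : h ≤ β / S / 20000) (hE : 0 ≤ E) (hV : 0 ≤ V) (hX : 0 ≤ X) (hG : 0 ≤ G)
    (hXY : (40 * γ / (β * S) + 96 * γ * β / (S * q ^ 2) + γ) * X ≤ 1 / (4 * γ) * Y) :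
    (A' + γ / 2) * ((1 - β) * E + 20 / S * X + 4 * β ^ 2 / S * V + 4 * β ^ 2 * σ ^ 2 / (S * K)
        + 3 / β * (8 * h * (9 * X + 8 * (β ^ 2 * V) + 4 * E + 8 * G + β ^ 2 * σ ^ 2 / K)))
      + 32 * γ * β / (S * q) * ((1 - q / 2) * V + 3 / q * X + 2 * q * (σ ^ 2 / K
        + 8 * h * (9 * X + 8 * (β ^ 2 * V) + 4 * E + 8 * G + β ^ 2 * σ ^ 2 / K)))
      ≤ A * E + 32 * γ * β / (S * q) * V + 1 / (4 * γ) * Y + γ / 4 * G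
        + 73 * (γ * β * σ ^ 2 / (S * K)) := by
  have hS0 : 0 < S := by linarith
  set A₁ := A' + γ / 2 with hA₁
  have hA₁0 : 0 ≤ A₁ := by positivity
  have hβA₁ : β * A₁ ≤ 2 * γ := by
    have : β * (γ / 2) ≤ 1 * (γ / 2) := by gcongr
    rw [hA₁, mul_add]
    linarith
  set w := 3 * A₁ / β + 64 * γ * β / S with hw
  have hβS : β / S ≤ 1 := (div_le_one hS0).2 (by linarith)
  have c1 : w * (8 * h) ≤ γ / 32 := by
    have e1 : 3 * A₁ / β * (8 * h) ≤ 48 * γ / 20000 := by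
      calc 3 * A₁ / β * (8 * h) ≤ 3 * A₁ / β * (8 * (β ^ 2 / 20000)) := by gcongr
        _ = 24 * (β * A₁) / 20000 := by field_simp; ring
        _ ≤ 24 * (2 * γ) / 20000 := by gcongr
        _ = _ := by ring
    have e2 : 64 * γ * β / S * (8 * h) ≤ 512 * γ / 20000 := by
      have : h ≤ 1 / 20000 := hh2.trans (by gcongr)
      calc 64 * γ * β / S * (8 * h) = 512 * γ * (β / S) * h := by ring
        _ ≤ 512 * γ * 1 * (1 / 20000) := by gcongr
        _ = _ := by ring
    rw [hw, add_mul]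
    linarith
  have c2 : w * (8 * h) * β ^ 2 ≤ γ * β / S / 32 := by
    have e1 : 3 * A₁ / β * (8 * h) * β ^ 2 ≤ 48 * (γ * β / S) / 20000 := by
      calc 3 * A₁ / β * (8 * h) * β ^ 2 = 24 * (β * A₁) * h := by field_simp; ring
        _ ≤ 24 * (2 * γ) * (β / S / 20000) := by gcongr
        _ = _ := by ring
    have e2 : 64 * γ * β / S * (8 * h) * β ^ 2 ≤ 512 * (γ * β / S) / 20000 := by
      have h1 : h ≤ 1 / 20000 := hh2.trans (by gcongr)
      have h2 : β ^ 2 ≤ 1 := pow_le_one₀ hβ0.le hβ1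
      calc 64 * γ * β / S * (8 * h) * β ^ 2 = 512 * (γ * β / S) * h * β ^ 2 := by ring
        _ ≤ 512 * (γ * β / S) * (1 / 20000) * 1 := by gcongr
        _ = _ := by ring
    have h3 : 0 ≤ γ * β / S := by positivity
    rw [hw, add_mul, add_mul]
    linarith
  have hn : 0 ≤ σ ^ 2 / K := by positivity
  have hu : w * (8 * h * (9 * X + 8 * (β ^ 2 * V) + 4 * E + 8 * G + β ^ 2 * σ ^ 2 / K))
      ≤ γ / 32 * (9 * X + 4 * E + 8 * G) + γ * β / S / 32 * (8 * V + σ ^ 2 / K) := by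
    calc _ = w * (8 * h) * (9 * X + 4 * E + 8 * G) + w * (8 * h) * β ^ 2 * (8 * V + σ ^ 2 / K) := by
          ring
      _ ≤ _ := by gcongr
  have hEt : A₁ * ((1 - β) * E) + γ / 8 * E ≤ A * E := by
    rw [← mul_assoc, ← add_mul]
    gcongr
    rw [hA, hA₁]
    nlinarith
  have hVt : A₁ * (4 * β ^ 2 / S * V) ≤ 8 * (γ * β / S) * V := by
    calc A₁ * (4 * β ^ 2 / S * V) = 4 * (β * A₁) * (β / S) * V := by ring
      _ ≤ 4 * (2 * γ) * (β / S) * V := by gcongr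
      _ = _ := by ring
  have hσt : A₁ * (4 * β ^ 2 * σ ^ 2 / (S * K)) ≤ 8 * (γ * β * σ ^ 2 / (S * K)) := by
    calc A₁ * (4 * β ^ 2 * σ ^ 2 / (S * K)) = 4 * (β * A₁) * (β * σ ^ 2 / (S * K)) := by ring
      _ ≤ 4 * (2 * γ) * (β * σ ^ 2 / (S * K)) := by gcongr
      _ = _ := by ring
  have hXt : A₁ * (20 / S * X) ≤ 40 * γ / (β * S) * X := by
    calc A₁ * (20 / S * X) = 20 * (β * A₁) / (β * S) * X := by field_simp
      _ ≤ 20 * (2 * γ) / (β * S) * X := by gcongr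
      _ = _ := by ring
  have eσ : γ * β / S / 32 * (σ ^ 2 / K) = γ * β * σ ^ 2 / (S * K) / 32 := by
    field_simp
  have hσ0 : 0 ≤ γ * β * σ ^ 2 / (S * K) := by positivity
  have hV0 : 0 ≤ γ * β / S * V := by positivity
  have eB : 32 * γ * β / (S * q) * ((1 - q / 2) * V + 3 / q * X + 2 * q * (σ ^ 2 / K
        + 8 * h * (9 * X + 8 * (β ^ 2 * V) + 4 * E + 8 * G + β ^ 2 * σ ^ 2 / K)))
      = 32 * γ * β / (S * q) * V - 16 * (γ * β / S) * V + 96 * γ * β / (S * q ^ 2) * X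
        + 64 * (γ * β * σ ^ 2 / (S * K)) + 64 * γ * β / S *
          (8 * h * (9 * X + 8 * (β ^ 2 * V) + 4 * E + 8 * G + β ^ 2 * σ ^ 2 / K)) := by
    generalize 8 * h * (9 * X + 8 * (β ^ 2 * V) + 4 * E + 8 * G + β ^ 2 * σ ^ 2 / K) = u
    field_simp
    ring
  rw [eB]
  set u := 8 * h * (9 * X + 8 * (β ^ 2 * V) + 4 * E + 8 * G + β ^ 2 * σ ^ 2 / K) with hudef
  have hw' : w * u = A₁ * (3 / β * u) + 64 * γ * β / S * u := by
    rw [hw]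
    ring
  rw [mul_add (γ * β / S / 32), eσ] at hu
  have hγX : 0 ≤ γ * X := by positivity
  clear_value u w A₁
  have hfin : A₁ * ((1 - β) * E + 20 / S * X + 4 * β ^ 2 / S * V + 4 * β ^ 2 * σ ^ 2 / (S * K)
        + 3 / β * u) = A₁ * ((1 - β) * E) + A₁ * (20 / S * X) + A₁ * (4 * β ^ 2 / S * V)
        + A₁ * (4 * β ^ 2 * σ ^ 2 / (S * K)) + A₁ * (3 / β * u) := by ring
  rw [hfin]
  linarith

/-- One round decreases the expected Lyapunov function by a multiple of `‖∇f‖²`, up to noise. -/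
lemma roundLE_lyapunov [∀ i, IsProbabilityMeasure (D i)] (hL : 0 < L) (hw : WellPosed F D)
    (hs : SampleSmooth F L) (hg : StochasticGradient F D σ) (hS : S ≤ N) (hS1 : 1 ≤ S)
    (hK : 1 ≤ K) (hβ0 : 0 < β) (hβ1 : β ≤ 1) (hη0 : 0 < η)
    (hη1 : (η * K * L) ^ 2 ≤ β ^ 2 / 20000) (hη2 : (η * K * L) ^ 2 ≤ β / S / 20000)
    (hγ : 0 < γ) (hγL : γ * L ≤ 1 / 4)
    (hγ2 : (γ * L) ^ 2 * (40 / (β * S) + 96 * β / (S * ((S : ℝ) / N) ^ 2) + 1) ≤ 1 / 4)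
    {A A' : ℝ} (hA' : 0 ≤ A') (hβA : β * A' ≤ γ) (hA : A = (1 - β) * A' + γ)
    {s : State d N} (hc : s.c = (1 / (N : ℝ)) • ∑ i, s.ci i) :
    RoundLE D S (fun P ξ => lyapunov F D γ A' (32 * γ * β / (S * ((S : ℝ) / N)))
        (round F η γ β S K s P ξ))
      (lyapunov F D γ A (32 * γ * β / (S * ((S : ℝ) / N))) s
        - γ / 4 * ‖gradient (globalLoss F D) s.x‖ ^ 2 + 73 * (γ * β * σ ^ 2 / (S * K))) := by
  have hK' : (0 : ℝ) < K := by exact_mod_cast hK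
  have hS' : (1 : ℝ) ≤ S := by exact_mod_cast hS1
  have hS0 : (0 : ℝ) < S := by linarith
  have hN : 0 < N := hS1.trans hS
  have hN' : (0 : ℝ) < N := by exact_mod_cast hN
  have hη : (η * K * L) ^ 2 ≤ 1 / 8 := by
    have : β ^ 2 ≤ 1 := pow_le_one₀ hβ0.le hβ1
    linarith
  have hB : 0 ≤ 32 * γ * β / (S * ((S : ℝ) / N)) := by positivity
  have h1 := roundLE_dirErr (γ := γ) hL hw hs hg hS hS1 hK hβ0 hβ1 hη0 hη hc
  have h2 := roundLE_ctrlErr (γ := γ) hL hw hs hg hS hS1 hK hβ0.le hβ1 hη hc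
  refine (((RoundLE.const hS (globalLoss F D s.x - (⨅ x, globalLoss F D x)
    - γ / 2 * ‖gradient (globalLoss F D) s.x‖ ^ 2)).add
    (h1.const_mul (by positivity : 0 ≤ A' + γ / 2))).add (h2.const_mul hB)).mono
    (fun P _ ξ => lyapunov_round_le hL hw hs hg hN hγ hγL _ _ s P ξ) ?_
  have hXY : (40 * γ / (β * S) + 96 * γ * β / (S * ((S : ℝ) / N) ^ 2) + γ)
      * (L ^ 2 * ‖s.x - s.xPrev‖ ^ 2) ≤ 1 / (4 * γ) * ‖s.x - s.xPrev‖ ^ 2 := by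
    have e1 : 1 / (4 * γ) = 1 / γ * (1 / 4) := by field_simp
    rw [← mul_assoc, e1]
    refine mul_le_mul_of_nonneg_right ?_ (sq_nonneg _)
    calc _ = 1 / γ * ((γ * L) ^ 2 * (40 / (β * S) + 96 * β / (S * ((S : ℝ) / N) ^ 2) + 1)) := by
          field_simp
      _ ≤ _ := by gcongr
  have h3 := lyapunov_arith (σ := σ) hγ hβ0 hβ1 hS' hK' (by positivity : 0 < (S : ℝ) / N) hA' hβA hA
    (sq_nonneg (η * K * L)) hη1 hη2 (sq_nonneg ‖dirErr F D s‖) (ctrlErr_nonneg (F := F) (D := D) s)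
    (by positivity : 0 ≤ L ^ 2 * ‖s.x - s.xPrev‖ ^ 2)
    (sq_nonneg ‖gradient (globalLoss F D) s.x‖) hXY
  unfold driftBound lyapunov
  linarith

end Lyapunov

/-! ### Telescoping over the rounds -/

section Telescope

open scoped ENNReal

variable {d N : ℕ} {Ξ : Type*} [MeasurableSpace Ξ] {F : Vec d → Ξ → ℝ} {D : Fin N → Measure Ξ}
  {η γ β L σ : ℝ} {S K B : ℕ} {x₀ : Vec d}

lemma ctrlErr_initState (hB : 1 ≤ B) (ξ : Fin N × ℕ → Ξ) :
    ctrlErr F D (initState F B x₀ ξ) = 1 / N * ∑ i, 1 / (B : ℝ) ^ 2 *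
      ‖∑ b ∈ Finset.range B, gradNoise F D x₀ i (ξ (i, b))‖ ^ 2 := by
  have hB' : (B : ℝ) ≠ 0 := by positivity
  unfold ctrlErr
  congr 1
  refine Finset.sum_congr rfl fun i _ => ?_
  have e : (initState F B x₀ ξ).ci i - gradient (localLoss F D i) (initState F B x₀ ξ).xPrev
      = (1 / (B : ℝ)) • ∑ b ∈ Finset.range B, gradNoise F D x₀ i (ξ (i, b)) := by
    simp only [initState, gradNoise]
    rw [Finset.sum_sub_distrib, smul_sub, Finset.sum_const, Finset.card_range,
      ← Nat.cast_smul_eq_nsmul ℝ, smul_smul, one_div_mul_cancel hB', one_smul]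
  rw [e, norm_smul, mul_pow, Real.norm_of_nonneg (by positivity), div_pow, one_pow]

variable [∀ i, IsProbabilityMeasure (D i)]

lemma dirErr_initState (hL : 0 < L) (hw : WellPosed F D)
    (hs : SampleSmooth F L) (hg : StochasticGradient F D σ) (hN : 0 < N) (hB : 1 ≤ B)
    (ξ : Fin N × ℕ → Ξ) :
    ‖dirErr F D (initState F B x₀ ξ)‖ ^ 2 = 1 / ((N : ℝ) * B) ^ 2 *
      ‖0 + ∑ j ∈ Finset.univ ×ˢ Finset.range B, gradNoise F D x₀ j.1 (ξ j)‖ ^ 2 := by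
  have hB' : (B : ℝ) ≠ 0 := by positivity
  have e : dirErr F D (initState F B x₀ ξ) = (1 / ((N : ℝ) * B)) •
      ∑ j ∈ Finset.univ ×ˢ Finset.range B, gradNoise F D x₀ j.1 (ξ j) := by
    simp only [dirErr, initState]
    rw [gradient_globalLoss hL hw hs hg, ← smul_sub, ← Finset.sum_sub_distrib, Finset.sum_product]
    have e1 : (1 / ((N : ℝ) * B)) = (1 / (N : ℝ)) * (1 / B) := by field_simp
    rw [e1, ← smul_smul, Finset.smul_sum (s := Finset.univ) (r := 1 / (B : ℝ))]
    congr 1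
    refine Finset.sum_congr rfl fun i _ => ?_
    simp only [gradNoise]
    rw [Finset.sum_sub_distrib, smul_sub, Finset.sum_const, Finset.card_range,
      ← Nat.cast_smul_eq_nsmul ℝ, smul_smul, one_div_mul_cancel hB', one_smul]
  rw [e, zero_add, norm_smul, mul_pow, Real.norm_of_nonneg (by positivity), div_pow, one_pow]

/-- The initial value of the Lyapunov function is governed by the gap `Δ` and by the variances of the
averages of the `B` initial samples per client. -/
lemma lintegral_lyapunov_zero_le (hL : 0 < L) (hw : WellPosed F D)
    (hs : SampleSmooth F L) (hg : StochasticGradient F D σ) (hS : S ≤ N) (hN : 0 < N) (hB : 1 ≤ B)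
    {A V : ℝ} (hA : 0 ≤ A) (hV : 0 ≤ V) :
    ∫⁻ ω, ENNReal.ofReal (lyapunov F D γ A V (state F η γ β S K B x₀ ω 0)) ∂(drawsLaw D S hS)
      ≤ ENNReal.ofReal (initialGap F D x₀ + A * (σ ^ 2 / (N * B)) + V * (σ ^ 2 / B)) := by
  have hN' : (0 : ℝ) < N := by exact_mod_cast hN
  have hB' : (0 : ℝ) < B := by exact_mod_cast hB
  set Q := Measure.infinitePi fun j : Fin N × ℕ => D j.1 with hQ
  have hfst : MeasurePreserving (Prod.fst : Draws N Ξ → _) (drawsLaw D S hS) Q :=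
    measurePreserving_fst
  have hd := integral_norm_add_sum_sq (μ := fun j : Fin N × ℕ => D j.1)
    (Z := fun j => gradNoise F D x₀ j.1) (fun j => measurable_gradNoise hw hs x₀ j.1)
    (fun j => hg.integrable_sq j.1 x₀) (fun j => integral_gradNoise hg x₀ j.1) 0
    (Finset.univ ×ˢ Finset.range B)
  have hn := fun i => integral_norm_sum_gradNoise_le hw hs hg x₀ i B
  set φ : (Fin N × ℕ → Ξ) → ℝ := fun ξ => initialGap F D x₀
    + A * (1 / ((N : ℝ) * B) ^ 2 *
      ‖0 + ∑ j ∈ Finset.univ ×ˢ Finset.range B, gradNoise F D x₀ j.1 (ξ j)‖ ^ 2)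
    + V * (1 / N * ∑ i, 1 / (B : ℝ) ^ 2 *
      ‖∑ b ∈ Finset.range B, gradNoise F D x₀ i (ξ (i, b))‖ ^ 2) with hφ
  have hlyap : ∀ ω : Draws N Ξ,
      lyapunov F D γ A V (state F η γ β S K B x₀ ω 0) = φ ω.1 := by
    intro ω
    have e1 : state F η γ β S K B x₀ ω 0 = initState F B x₀ ω.1 := rfl
    have e2 : (initState F B x₀ ω.1 : State d N).x = x₀ := rfl
    have e3 : (initState F B x₀ ω.1 : State d N).xPrev = x₀ := rfl
    rw [e1, lyapunov, dirErr_initState hL hw hs hg hN hB, ctrlErr_initState hB, e2, e3, sub_self,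
      norm_zero]
    simp only [hφ, initialGap]
    ring
  have hφ0 : ∀ ξ, 0 ≤ φ ξ := by
    intro ξ
    have h1 : 0 ≤ initialGap F D x₀ := sub_nonneg.2 (ciInf_le hw.bddBelow x₀)
    have h2 : 0 ≤ ∑ i, 1 / (B : ℝ) ^ 2 *
        ‖∑ b ∈ Finset.range B, gradNoise F D x₀ i (ξ (i, b))‖ ^ 2 :=
      Finset.sum_nonneg fun _ _ => by positivity
    simp only [hφ]
    positivity
  have hi1 : Integrable (fun ξ : Fin N × ℕ → Ξ => A * (1 / ((N : ℝ) * B) ^ 2 *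
      ‖0 + ∑ j ∈ Finset.univ ×ˢ Finset.range B, gradNoise F D x₀ j.1 (ξ j)‖ ^ 2)) Q :=
    (hd.1.const_mul _).const_mul _
  have hi2 : Integrable (fun ξ : Fin N × ℕ → Ξ => V * (1 / N * ∑ i, 1 / (B : ℝ) ^ 2 *
      ‖∑ b ∈ Finset.range B, gradNoise F D x₀ i (ξ (i, b))‖ ^ 2)) Q :=
    ((integrable_finsetSum _ fun i _ => (hn i).1.const_mul _).const_mul _).const_mul _
  have hi0 : Integrable (fun ξ : Fin N × ℕ → Ξ => initialGap F D x₀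
    + A * (1 / ((N : ℝ) * B) ^ 2 *
      ‖0 + ∑ j ∈ Finset.univ ×ˢ Finset.range B, gradNoise F D x₀ j.1 (ξ j)‖ ^ 2)) Q :=
    (integrable_const _).add hi1
  have hint : Integrable φ Q := hi0.add hi2
  have hφmeas : AEMeasurable (fun ξ => ENNReal.ofReal (φ ξ)) Q := hint.1.aemeasurable.ennreal_ofReal
  simp_rw [hlyap]
  have e : ∫⁻ ω : Draws N Ξ, ENNReal.ofReal (φ ω.1) ∂(drawsLaw D S hS)
      = ∫⁻ ξ, ENNReal.ofReal (φ ξ) ∂Q := by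
    rw [← hfst.map_eq] at hφmeas ⊢
    exact (lintegral_map' hφmeas measurable_fst.aemeasurable).symm
  rw [e, ← ofReal_integral_eq_lintegral_ofReal hint (Filter.Eventually.of_forall hφ0)]
  refine ENNReal.ofReal_le_ofReal ?_
  rw [hφ, integral_add hi0 hi2, integral_add (integrable_const _) hi1, integral_const,
    probReal_univ, one_smul, integral_const_mul, integral_const_mul, integral_const_mul,
    integral_const_mul, integral_finsetSum _ fun i _ => (hn i).1.const_mul _]
  simp_rw [integral_const_mul]
  have b1 : ∫ ξ, ‖0 + ∑ j ∈ Finset.univ ×ˢ Finset.range B, gradNoise F D x₀ j.1 (ξ j)‖ ^ 2 ∂Q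
      ≤ N * B * σ ^ 2 := by
    rw [hd.2, norm_zero, zero_pow two_ne_zero, zero_add]
    calc _ ≤ ∑ _j ∈ (Finset.univ : Finset (Fin N)) ×ˢ Finset.range B, σ ^ 2 :=
          Finset.sum_le_sum fun j _ => hg.variance_le j.1 x₀
      _ = _ := by
          rw [Finset.sum_const, Finset.card_product, Finset.card_univ, Fintype.card_fin,
            Finset.card_range, nsmul_eq_mul]
          push_cast
          ring
  refine add_le_add (add_le_add le_rfl (mul_le_mul_of_nonneg_left ?_ hA))
    (mul_le_mul_of_nonneg_left ?_ hV)
  · calc _ ≤ 1 / ((N : ℝ) * B) ^ 2 * (N * B * σ ^ 2) := by gcongr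
      _ = _ := by field_simp
  · calc _ ≤ 1 / (N : ℝ) * ∑ _i : Fin N, 1 / (B : ℝ) ^ 2 * (B * σ ^ 2) := by
          gcongr with i
          exact (hn i).2
      _ = _ := by
          rw [Finset.sum_const, Finset.card_univ, Fintype.card_fin, nsmul_eq_mul]
          field_simp

lemma measurable_lyapunov_state (hL : 0 < L) (hw : WellPosed F D)
    (hs : SampleSmooth F L) (hg : StochasticGradient F D σ) (A V : ℝ) (r : ℕ) :
    Measurable fun ω : Draws N Ξ => lyapunov F D γ A V (state F η γ β S K B x₀ ω r) := by
  have h := measurableState_state (η := η) (γ := γ) (β := β) (S := S) (K := K) (B := B) (x₀ := x₀)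
    (N := N) (measurable_uncurry_sampleGrad hw hs hL.le) r
  have h1 := (continuous_globalLoss hL hw hs hg).measurable.comp h.x
  have h2 := (h.g.sub ((continuous_gradient_globalLoss hL hw hs hg).measurable.comp
    h.xPrev)).norm.pow_const 2
  have h3 : Measurable fun ω : Draws N Ξ => ctrlErr F D (state F η γ β S K B x₀ ω r) :=
    (Finset.measurable_fun_sum _ fun i _ => ((h.ci i).sub ((continuous_gradient_localLoss hL hs hg
      i).measurable.comp h.xPrev)).norm.pow_const 2).const_mul _
  have h4 := (h.x.sub h.xPrev).norm.pow_const 2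
  exact (((h1.sub_const _).add (h2.const_mul A)).add (h3.const_mul V)).add (h4.const_mul _)

lemma measurable_gradient_state (hL : 0 < L) (hw : WellPosed F D)
    (hs : SampleSmooth F L) (hg : StochasticGradient F D σ) (r : ℕ) :
    Measurable fun ω : Draws N Ξ =>
      ‖gradient (globalLoss F D) (state F η γ β S K B x₀ ω r).x‖ ^ 2 :=
  ((continuous_gradient_globalLoss hL hw hs hg).measurable.comp (measurableState_state
    (measurable_uncurry_sampleGrad hw hs hL.le) r).x).norm.pow_const 2

/-- The weight of the momentum error when `n` rounds remain. It satisfies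
`A_{n+1} = (1 - β) A_n + γ` and is at most `γ min {n, 1 / β}`; the bound by `γ n` matters when
`β` is much smaller than `1 / R`. -/
noncomputable def momentumWeight (γ β : ℝ) (n : ℕ) : ℝ := γ * ∑ j ∈ Finset.range n, (1 - β) ^ j

lemma momentumWeight_succ (n : ℕ) :
    momentumWeight γ β (n + 1) = (1 - β) * momentumWeight γ β n + γ := by
  unfold momentumWeight
  rw [geom_sum_succ]
  ring

lemma momentumWeight_nonneg (hγ : 0 < γ) (hβ1 : β ≤ 1) (n : ℕ) : 0 ≤ momentumWeight γ β n :=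
  mul_nonneg hγ.le (Finset.sum_nonneg fun _ _ => pow_nonneg (sub_nonneg.2 hβ1) _)

lemma mul_momentumWeight_le (hγ : 0 < γ) (hβ1 : β ≤ 1) (n : ℕ) :
    β * momentumWeight γ β n ≤ γ := by
  have h := mul_neg_geom_sum (1 - β) n
  rw [sub_sub_cancel] at h
  have h2 : 0 ≤ (1 - β) ^ n := pow_nonneg (sub_nonneg.2 hβ1) _
  unfold momentumWeight
  rw [mul_left_comm, h]
  nlinarith

lemma momentumWeight_le (hγ : 0 < γ) (hβ0 : 0 ≤ β) (hβ1 : β ≤ 1) (n : ℕ) :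
    momentumWeight γ β n ≤ γ * n := by
  unfold momentumWeight
  gcongr
  calc ∑ j ∈ Finset.range n, (1 - β) ^ j ≤ ∑ _j ∈ Finset.range n, (1 : ℝ) :=
        Finset.sum_le_sum fun j _ => pow_le_one₀ (sub_nonneg.2 hβ1) (by linarith)
    _ = n := by simp

/-- The descent inequality of one round, with all the draws averaged out. -/
lemma lintegral_lyapunov_succ_le (hL : 0 < L) (hw : WellPosed F D)
    (hs : SampleSmooth F L) (hg : StochasticGradient F D σ) (hS : S ≤ N) (hS1 : 1 ≤ S)
    (hK : 1 ≤ K) (hβ0 : 0 < β) (hβ1 : β ≤ 1) (hη0 : 0 < η)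
    (hη1 : (η * K * L) ^ 2 ≤ β ^ 2 / 20000) (hη2 : (η * K * L) ^ 2 ≤ β / S / 20000)
    (hγ : 0 < γ) (hγL : γ * L ≤ 1 / 4)
    (hγ2 : (γ * L) ^ 2 * (40 / (β * S) + 96 * β / (S * ((S : ℝ) / N) ^ 2) + 1) ≤ 1 / 4)
    (n r : ℕ) :
    ∫⁻ ω, ENNReal.ofReal (lyapunov F D γ (momentumWeight γ β n)
        (32 * γ * β / (S * ((S : ℝ) / N))) (state F η γ β S K B x₀ ω (r + 1))) ∂(drawsLaw D S hS)
      + ∫⁻ ω, ENNReal.ofReal (γ / 4 *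
        ‖gradient (globalLoss F D) (state F η γ β S K B x₀ ω r).x‖ ^ 2) ∂(drawsLaw D S hS)
    ≤ ∫⁻ ω, ENNReal.ofReal (lyapunov F D γ (momentumWeight γ β (n + 1))
        (32 * γ * β / (S * ((S : ℝ) / N))) (state F η γ β S K B x₀ ω r)) ∂(drawsLaw D S hS)
      + ENNReal.ofReal (73 * (γ * β * σ ^ 2 / (S * K))) := by
  set V := 32 * γ * β / (S * ((S : ℝ) / N)) with hV
  have hV0 : 0 ≤ V := by positivity
  have hlm := fun A r => measurable_lyapunov_state (η := η) (γ := γ) (β := β) (S := S) (K := K)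
    (B := B) (x₀ := x₀) hL hw hs hg A V r
  have hgm := measurable_gradient_state (η := η) (γ := γ) (β := β) (S := S) (K := K)
    (B := B) (x₀ := x₀) hL hw hs hg r
  have hm : Measurable fun ω : Draws N Ξ => ENNReal.ofReal (lyapunov F D γ (momentumWeight γ β n) V
      (state F η γ β S K B x₀ ω (r + 1))) + ENNReal.ofReal (γ / 4 *
        ‖gradient (globalLoss F D) (state F η γ β S K B x₀ ω r).x‖ ^ 2) :=
    (hlm _ _).ennreal_ofReal.add (hgm.const_mul _).ennreal_ofReal
  rw [← lintegral_add_left (hlm _ _).ennreal_ofReal,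
    lintegral_drawsLaw_eq D hS r hm]
  have hconst : ENNReal.ofReal (73 * (γ * β * σ ^ 2 / (S * K)))
      = ∫⁻ _ω, ENNReal.ofReal (73 * (γ * β * σ ^ 2 / (S * K))) ∂(drawsLaw D S hS) := by
    rw [lintegral_const]
    have : IsProbabilityMeasure (drawsLaw D S hS) := by unfold drawsLaw; infer_instance
    rw [measure_univ, mul_one]
  rw [hconst, ← lintegral_add_left (hlm _ _).ennreal_ofReal]
  refine lintegral_mono fun ω => ?_
  set s := state F η γ β S K B x₀ ω r with hsdef
  simp only [state_replaceRound_succ, state_replaceRound_of_le le_rfl, ← hsdef]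
  have hround := roundLE_lyapunov (A' := momentumWeight γ β n) hL hw hs hg hS hS1 hK hβ0 hβ1 hη0 hη1
    hη2 hγ hγL hγ2 (momentumWeight_nonneg hγ hβ1 n) (mul_momentumWeight_le hγ hβ1 n)
    (momentumWeight_succ n) (state_c_eq (F := F) (η := η) (γ := γ) (β := β) (S := S) (K := K)
      (B := B) (x₀ := x₀) ω r)
  rw [← hV, ← hsdef] at hround
  have hsum := (hround.add (RoundLE.const hS (γ / 4 *
    ‖gradient (globalLoss F D) s.x‖ ^ 2))).lintegral_le hS (fun P _ ξ => add_nonneg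
      (lyapunov_nonneg hw hγ (momentumWeight_nonneg hγ hβ1 n) hV0 _) (by positivity))
  have e1 : ∀ P ξ, ENNReal.ofReal (lyapunov F D γ (momentumWeight γ β n) V
        (round F η γ β S K s P ξ) + γ / 4 * ‖gradient (globalLoss F D) s.x‖ ^ 2)
      = ENNReal.ofReal (lyapunov F D γ (momentumWeight γ β n) V (round F η γ β S K s P ξ))
        + ENNReal.ofReal (γ / 4 * ‖gradient (globalLoss F D) s.x‖ ^ 2) := fun P ξ =>
    ENNReal.ofReal_add (lyapunov_nonneg hw hγ (momentumWeight_nonneg hγ hβ1 n) hV0 _)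
      (by positivity)
  simp_rw [e1] at hsum
  refine hsum.trans ?_
  rw [← ENNReal.ofReal_add (lyapunov_nonneg hw hγ (momentumWeight_nonneg hγ hβ1 _) hV0 _)
    (by positivity)]
  exact ENNReal.ofReal_le_ofReal (by linarith)

/-- The convergence rate before the parameters are chosen. -/
lemma avgGradSqLE_of_smallRates (hL : 0 < L) (hw : WellPosed F D)
    (hs : SampleSmooth F L) (hg : StochasticGradient F D σ) (hS : S ≤ N) (hS1 : 1 ≤ S)
    (hK : 1 ≤ K) {R : ℕ} (hR : 1 ≤ R) (hB : 1 ≤ B) (hβ0 : 0 < β) (hβ1 : β ≤ 1) (hη0 : 0 < η)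
    (hη1 : (η * K * L) ^ 2 ≤ β ^ 2 / 20000) (hη2 : (η * K * L) ^ 2 ≤ β / S / 20000)
    (hγ : 0 < γ) (hγL : γ * L ≤ 1 / 4)
    (hγ2 : (γ * L) ^ 2 * (40 / (β * S) + 96 * β / (S * ((S : ℝ) / N) ^ 2) + 1) ≤ 1 / 4) :
    AvgGradSqLE F D η γ β S hS K B R x₀ (4 * (initialGap F D x₀ / (γ * R))
      + 4 * (momentumWeight 1 β R / R * (σ ^ 2 / (N * B)))
      + 128 * (β * N * σ ^ 2 / ((S : ℝ) ^ 2 * R * B)) + 292 * (β * σ ^ 2 / (S * K))) := by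
  have hN : 0 < N := hS1.trans hS
  have hN' : (0 : ℝ) < N := by exact_mod_cast hN
  have hS' : (0 : ℝ) < S := by exact_mod_cast hS1
  have hR' : (0 : ℝ) < R := by exact_mod_cast hR
  have hB' : (0 : ℝ) < B := by exact_mod_cast hB
  have hK' : (0 : ℝ) < K := by exact_mod_cast hK
  set μ := drawsLaw D S hS with hμ
  set V := 32 * γ * β / (S * ((S : ℝ) / N)) with hV
  have hV0 : 0 ≤ V := by positivity
  set c := 73 * (γ * β * σ ^ 2 / (S * K)) with hc
  have hc0 : 0 ≤ c := by positivity
  set G : ℕ → Draws N Ξ → ℝ := fun r ω =>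
    ‖gradient (globalLoss F D) (state F η γ β S K B x₀ ω r).x‖ ^ 2 with hG
  set a : ℕ → ℝ≥0∞ := fun r => ∫⁻ ω, ENNReal.ofReal (lyapunov F D γ (momentumWeight γ β (R - r)) V
    (state F η γ β S K B x₀ ω r)) ∂μ with ha
  set g : ℕ → ℝ≥0∞ := fun r => ∫⁻ ω, ENNReal.ofReal (γ / 4 * G r ω) ∂μ with hgdef
  have hstep : ∀ r < R, a (r + 1) + g r ≤ a r + ENNReal.ofReal c := by
    intro r hr
    have h := lintegral_lyapunov_succ_le (B := B) (x₀ := x₀) hL hw hs hg hS hS1 hK hβ0 hβ1 hη0 hη1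
      hη2 hγ hγL hγ2 (R - (r + 1)) r
    rwa [show R - (r + 1) + 1 = R - r by omega] at h
  have htel : ∀ m ≤ R, a m + ∑ r ∈ Finset.range m, g r ≤ a 0 + m * ENNReal.ofReal c := by
    intro m
    induction m with
    | zero => simp
    | succ m ih =>
      intro hm
      rw [Finset.sum_range_succ]
      calc a (m + 1) + (∑ r ∈ Finset.range m, g r + g m)
          = (a (m + 1) + g m) + ∑ r ∈ Finset.range m, g r := by ring
        _ ≤ (a m + ENNReal.ofReal c) + ∑ r ∈ Finset.range m, g r :=
          add_le_add_left (hstep m (by omega)) _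
        _ = (a m + ∑ r ∈ Finset.range m, g r) + ENNReal.ofReal c := by ring
        _ ≤ (a 0 + m * ENNReal.ofReal c) + ENNReal.ofReal c := add_le_add_left (ih (by omega)) _
        _ = _ := by push_cast; ring
  have hΔ : 0 ≤ initialGap F D x₀ := sub_nonneg.2 (ciInf_le hw.bddBelow x₀)
  have hA0 := momentumWeight_nonneg hγ hβ1 R
  set t := initialGap F D x₀ + momentumWeight γ β R * (σ ^ 2 / (N * B)) + V * (σ ^ 2 / B) + R * c
    with ht
  have ht0 : 0 ≤ t := by positivity
  have hsum : ∑ r ∈ Finset.range R, g r ≤ ENNReal.ofReal t := by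
    have h0 : a 0 ≤ _ := lintegral_lyapunov_zero_le (η := η) (β := β) (K := K) (x₀ := x₀) hL hw hs hg
      hS hN hB hA0 hV0
    calc ∑ r ∈ Finset.range R, g r ≤ a R + ∑ r ∈ Finset.range R, g r := le_add_self
      _ ≤ a 0 + R * ENNReal.ofReal c := htel R le_rfl
      _ ≤ _ := by
        rw [ht, ENNReal.ofReal_add (by positivity) (by positivity),
          ENNReal.ofReal_mul (p := (R : ℝ)) (by positivity), ENNReal.ofReal_natCast]
        exact add_le_add_left h0 _
  have hGm : ∀ r, Measurable (G r) := fun r => measurable_gradient_state hL hw hs hg r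
  have hgfin : ∀ r < R, g r ≠ ⊤ := fun r hr => ne_top_of_le_ne_top ENNReal.ofReal_ne_top
    ((Finset.single_le_sum (fun _ _ => zero_le) (Finset.mem_range.2 hr)).trans hsum)
  have hint : ∀ r < R, Integrable (fun ω => γ / 4 * G r ω) μ := fun r hr =>
    ⟨((hGm r).const_mul _).aestronglyMeasurable, by
      rw [hasFiniteIntegral_iff_ofReal (Filter.Eventually.of_forall fun ω => by positivity)]
      exact (hgfin r hr).lt_top⟩
  have hGint : ∀ r < R, Integrable (G r) μ := fun r hr => by
    have h := (hint r hr).const_mul (4 / γ)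
    refine h.congr (Filter.Eventually.of_forall fun ω => ?_)
    simp only
    field_simp
  refine ⟨hGint, ?_⟩
  have hreal : γ / 4 * ∑ r ∈ Finset.range R, ∫ ω, G r ω ∂μ ≤ t := by
    have e : ENNReal.ofReal (γ / 4 * ∑ r ∈ Finset.range R, ∫ ω, G r ω ∂μ)
        = ∑ r ∈ Finset.range R, g r := by
      rw [Finset.mul_sum, ENNReal.ofReal_sum_of_nonneg fun r _ => mul_nonneg (by positivity)
        (integral_nonneg fun ω => sq_nonneg _)]
      refine Finset.sum_congr rfl fun r hr => ?_
      rw [← integral_const_mul, ofReal_integral_eq_lintegral_ofReal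
        (hint r (Finset.mem_range.1 hr)) (Filter.Eventually.of_forall fun ω => by positivity)]
    rw [← e] at hsum
    exact (ENNReal.ofReal_le_ofReal_iff ht0).1 hsum
  have hW : momentumWeight γ β R = γ * momentumWeight 1 β R := by
    unfold momentumWeight
    ring
  calc 1 / (R : ℝ) * ∑ r ∈ Finset.range R, ∫ ω, G r ω ∂μ
      = 4 / (γ * R) * (γ / 4 * ∑ r ∈ Finset.range R, ∫ ω, G r ω ∂μ) := by field_simp
    _ ≤ 4 / (γ * R) * t := by gcongr
    _ = _ := by
      rw [ht, hW, hV, hc]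
      field_simp
      ring

end Telescope

/-! ### Choice of the parameters -/

section Rates

variable {L Δ σ θ β a b κ γ η : ℝ} {N S K R B : ℕ}

lemma rpow_two_thirds_pow_three {p : ℝ} (hp : 0 ≤ p) : (p ^ (2 / 3 : ℝ)) ^ 3 = p ^ 2 := by
  rw [← Real.rpow_natCast, ← Real.rpow_mul hp, ← Real.rpow_natCast]
  norm_num

lemma rpow_one_third_pow_three {p : ℝ} (hp : 0 ≤ p) : (p ^ (1 / 3 : ℝ)) ^ 3 = p := by
  rw [← Real.rpow_natCast, ← Real.rpow_mul hp]
  norm_num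

lemma momentum_le (θ L Δ σ : ℝ) (S K R : ℕ) : momentum θ L Δ σ S K R ≤ θ := by
  unfold momentum
  split_ifs
  · exact le_rfl
  · exact min_le_left _ _

/-- The noise term `βσ²/(SK)` is at most the first term of the rate: this is the reason for the cap
on the momentum parameter. The identity at the cap is checked on third powers. -/
lemma momentum_mul_noise_le (hL : 0 < L) (hΔ : 0 ≤ Δ) (hσ : 0 ≤ σ) (hS : 1 ≤ S) (hK : 1 ≤ K)
    (hR : 1 ≤ R) :
    momentum θ L Δ σ S K R * σ ^ 2 / (S * K) ≤ (L * Δ * σ / (S * √K * R)) ^ (2 / 3 : ℝ) := by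
  have hS' : (0 : ℝ) < S := by exact_mod_cast hS
  have hK' : (0 : ℝ) < K := by exact_mod_cast hK
  have hR' : (0 : ℝ) < R := by exact_mod_cast hR
  unfold momentum
  split_ifs with h0
  · rw [h0]
    simp
  · have hσ0 : 0 < σ := lt_of_le_of_ne hσ (Ne.symm h0)
    set X := (K * L * Δ / (σ ^ 2 * R)) ^ (2 / 3 : ℝ) * (S : ℝ) ^ (1 / 3 : ℝ) with hX
    have hX3 : X ^ 3 = (K * L * Δ / (σ ^ 2 * R)) ^ 2 * S := by
      rw [hX, mul_pow, rpow_two_thirds_pow_three (by positivity),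
        rpow_one_third_pow_three (by positivity)]
    refine (?_ : _ ≤ X * σ ^ 2 / (S * K)).trans (le_of_eq ?_)
    · gcongr
      exact min_le_right _ _
    · refine (pow_left_inj₀ (by positivity) (by positivity) three_ne_zero).1 ?_
      rw [rpow_two_thirds_pow_three (by positivity), div_pow, mul_pow, hX3,
        div_pow (L * Δ * σ), mul_pow (S * √K : ℝ), mul_pow (S : ℝ) √K, Real.sq_sqrt hK'.le]
      field_simp

/-- The optimization term `LΔ/(R√(βS))` is at most its value at `β = θ` plus the first term of the
rate, which is its value at the cap. -/
lemma gap_div_sqrt_momentum_le (hL : 0 < L) (hΔ : 0 ≤ Δ) (hσ : 0 ≤ σ) (hS : 1 ≤ S) (hK : 1 ≤ K)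
    (hR : 1 ≤ R) (hβ : 0 < momentum θ L Δ σ S K R) :
    L * Δ / R * (1 / √(momentum θ L Δ σ S K R * S))
      ≤ L * Δ / R * (1 / √(θ * S)) + (L * Δ * σ / (S * √K * R)) ^ (2 / 3 : ℝ) := by
  have hS' : (0 : ℝ) < S := by exact_mod_cast hS
  have hK' : (0 : ℝ) < K := by exact_mod_cast hK
  have hR' : (0 : ℝ) < R := by exact_mod_cast hR
  have hT : 0 ≤ (L * Δ * σ / (S * √K * R)) ^ (2 / 3 : ℝ) := by positivity
  have hθ : 0 ≤ L * Δ / R * (1 / √(θ * S)) := by positivity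
  unfold momentum at hβ ⊢
  split_ifs at hβ ⊢ with h0
  · linarith
  · have hσ0 : 0 < σ := lt_of_le_of_ne hσ (Ne.symm h0)
    set X := (K * L * Δ / (σ ^ 2 * R)) ^ (2 / 3 : ℝ) * (S : ℝ) ^ (1 / 3 : ℝ) with hX
    rcases le_total θ X with h | h
    · rw [min_eq_left h]
      linarith
    · rw [min_eq_right h] at hβ ⊢
      have hX3 : X ^ 3 = (K * L * Δ / (σ ^ 2 * R)) ^ 2 * S := by
        rw [hX, mul_pow, rpow_two_thirds_pow_three (by positivity),
          rpow_one_third_pow_three (by positivity)]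
      have hΔ0 : Δ ≠ 0 := by
        rintro rfl
        have : X ^ 3 = 0 := by rw [hX3]; simp
        exact hβ.ne' (pow_eq_zero_iff three_ne_zero |>.1 this)
      refine (le_of_eq ?_).trans (le_add_of_nonneg_left hθ)
      refine (pow_left_inj₀ (by positivity) (by positivity) (n := 6) (by norm_num)).1 ?_
      have e1 : √(X * S) ^ 6 = X ^ 3 * S ^ 3 := by
        rw [show 6 = 2 * 3 from rfl, pow_mul, Real.sq_sqrt (by positivity), mul_pow]
      have e2 : √(K : ℝ) ^ 4 = K ^ 2 := by
        rw [show 4 = 2 * 2 from rfl, pow_mul, Real.sq_sqrt hK'.le]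
      rw [show 6 = 3 * 2 from rfl, pow_mul (_ ^ (2 / 3 : ℝ)), rpow_two_thirds_pow_three
        (by positivity), show 3 * 2 = 6 from rfl, ← pow_mul, show 2 * 2 = 4 from rfl, mul_pow,
        one_div, inv_pow, e1, hX3, div_pow (L * Δ * σ), mul_pow (S * √K : ℝ), mul_pow (S : ℝ), e2]
      field_simp

lemma SmallLocalRate.momentum_pos (hL : 0 < L) (hb : 0 < b) (hK : 1 ≤ K)
    (h : SmallLocalRate b L β η S K) : 0 < β := by
  have hK' : (0 : ℝ) < K := by exact_mod_cast hK
  have h1 : 0 < η * K * L := by have := h.1; positivity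
  have h2 := h.2.trans (mul_le_mul_of_nonneg_left (min_le_left _ _) hb.le)
  exact pos_of_mul_pos_right (h1.trans_le h2) hb.le

lemma SmallLocalRate.sq_le (hL : 0 < L) (hb : 0 < b) (hK : 1 ≤ K)
    (h : SmallLocalRate b L β η S K) : (η * K * L) ^ 2 ≤ b ^ 2 * β ^ 2 := by
  have hη := h.1
  rw [← mul_pow]
  exact pow_le_pow_left₀ (by positivity)
    (h.2.trans (mul_le_mul_of_nonneg_left (min_le_left _ _) hb.le)) 2

lemma SmallLocalRate.sq_le_div (hL : 0 < L) (hb : 0 < b) (hK : 1 ≤ K)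
    (h : SmallLocalRate b L β η S K) : (η * K * L) ^ 2 ≤ b ^ 2 * (β / S) := by
  have hη := h.1
  have hβ := h.momentum_pos hL hb hK
  have h1 : η * K * L ≤ b * √(β / S) := by
    rw [Real.sqrt_eq_rpow]
    exact h.2.trans (mul_le_mul_of_nonneg_left ((min_le_right _ _).trans (min_le_left _ _)) hb.le)
  have h2 := pow_le_pow_left₀ (by positivity) h1 2
  rwa [mul_pow b, Real.sq_sqrt (by positivity)] at h2

lemma globalRate_mul (hL : 0 < L) : globalRate a L β S * L = a * min 1 √(β * S) := by
  rw [globalRate, mul_assoc, min_mul_of_nonneg _ _ hL.le]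
  congr 2 <;> field_simp

/-- The step size condition of the Lyapunov analysis holds when `a ≤ 1 / (24κ)` and
`β ≤ κ S / N`. -/
lemma globalRate_cond (hL : 0 < L) (ha : 0 < a) (hκ : 1 ≤ κ) (haκ : a ≤ 1 / (24 * κ))
    (hN : 1 ≤ N) (hS : 1 ≤ S) (hβ0 : 0 < β) (hβκ : β ≤ κ * (S / N)) :
    (globalRate a L β S * L) ^ 2 * (40 / (β * S) + 96 * β / (S * ((S : ℝ) / N) ^ 2) + 1)
      ≤ 1 / 4 := by
  have hS' : (0 : ℝ) < S := by exact_mod_cast hS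
  have hN' : (0 : ℝ) < N := by exact_mod_cast hN
  set q := (S : ℝ) / N with hq
  have hq0 : 0 < q := by positivity
  rw [globalRate_mul hL]
  have hm0 : 0 ≤ min 1 √(β * S) := le_min zero_le_one (Real.sqrt_nonneg _)
  have h1 : min 1 √(β * S) ^ 2 ≤ 1 := pow_le_one₀ hm0 (min_le_left _ _)
  have h2 : min 1 √(β * S) ^ 2 ≤ β * S := by
    refine (pow_le_pow_left₀ hm0 (min_le_right _ _) 2).trans (le_of_eq ?_)
    exact Real.sq_sqrt (by positivity)
  set m := min 1 √(β * S) ^ 2 with hm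
  have h3 : m * (40 / (β * S)) ≤ 40 := by
    calc m * (40 / (β * S)) ≤ β * S * (40 / (β * S)) := by gcongr
      _ = 40 := by field_simp
  have h4 : m * (96 * β / (S * q ^ 2)) ≤ 96 * κ ^ 2 := by
    calc m * (96 * β / (S * q ^ 2)) ≤ β * S * (96 * β / (S * q ^ 2)) := by gcongr
      _ = 96 * β ^ 2 / q ^ 2 := by field_simp
      _ ≤ 96 * (κ * q) ^ 2 / q ^ 2 := by gcongr
      _ = 96 * κ ^ 2 := by field_simp
  have h5 : a ^ 2 * κ ^ 2 ≤ 1 / 576 := by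
    have h : a * κ ≤ 1 / 24 := by
      calc a * κ ≤ 1 / (24 * κ) * κ := by gcongr
        _ = 1 / 24 := by field_simp
    have h' := pow_le_pow_left₀ (by positivity) h 2
    rw [mul_pow] at h'
    linarith
  have h6 : a ^ 2 * 1 ≤ a ^ 2 * κ ^ 2 := by
    gcongr
    exact one_le_pow₀ hκ
  calc (a * min 1 √(β * S)) ^ 2 * (40 / (β * S) + 96 * β / (S * q ^ 2) + 1)
      = a ^ 2 * (m * (40 / (β * S)) + m * (96 * β / (S * q ^ 2)) + m) := by
        rw [hm]
        ring
    _ ≤ a ^ 2 * (40 + 96 * κ ^ 2 + 1) := by gcongr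
    _ ≤ 1 / 4 := by linarith

lemma gap_div_globalRate_le (hL : 0 < L) (hΔ : 0 ≤ Δ) (ha : 0 < a) (hS : 1 ≤ S) (hR : 1 ≤ R)
    (hβ0 : 0 < β) :
    Δ / (globalRate a L β S * R) ≤ 1 / a * (L * Δ / R + L * Δ / R * (1 / √(β * S))) := by
  have hS' : (0 : ℝ) < S := by exact_mod_cast hS
  have hR' : (0 : ℝ) < R := by exact_mod_cast hR
  have hs : 0 < √(β * S) := Real.sqrt_pos.2 (by positivity)
  have hγ : globalRate a L β S = a * min 1 √(β * S) / L := by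
    rw [← globalRate_mul hL]
    field_simp
  have hm : 0 < min 1 √(β * S) := lt_min one_pos hs
  have h1 : 1 / min 1 √(β * S) ≤ 1 + 1 / √(β * S) := by
    rcases le_total 1 √(β * S) with h | h
    · rw [min_eq_left h, div_one]
      linarith [one_div_pos.2 hs]
    · rw [min_eq_right h]
      linarith
  calc Δ / (globalRate a L β S * R) = 1 / a * (L * Δ / R) * (1 / min 1 √(β * S)) := by
        rw [hγ]
        field_simp
    _ ≤ 1 / a * (L * Δ / R) * (1 + 1 / √(β * S)) := by gcongr
    _ = _ := by ring

end Rates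

section Theorem

variable {d N : ℕ} {Ξ : Type*} [MeasurableSpace Ξ] {F : Vec d → Ξ → ℝ} {D : Fin N → Measure Ξ}
  [∀ i, IsProbabilityMeasure (D i)] {η γ β L σ a κ θ : ℝ} {S K B R : ℕ} {x₀ : Vec d}

lemma AvgGradSqLE.mono {hS : S ≤ N} {u v : ℝ} (h : AvgGradSqLE F D η γ β S hS K B R x₀ u)
    (huv : u ≤ v) : AvgGradSqLE F D η γ β S hS K B R x₀ v :=
  ⟨h.1, h.2.trans huv⟩

/-- The rate for the prescribed step sizes, with the effect of the initialization still explicit. -/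
lemma avgGradSqLE_momentum (hL : 0 < L) (hσ : 0 ≤ σ) (hw : WellPosed F D)
    (hs : SampleSmooth F L) (hg : StochasticGradient F D σ) (hS : S ≤ N) (hS1 : 1 ≤ S)
    (hK : 1 ≤ K) (hR : 1 ≤ R) (hB : 1 ≤ B) (hκ : 1 ≤ κ) (ha : 0 < a) (haκ : a ≤ 1 / (24 * κ))
    (hθ1 : θ ≤ 1) (hθκ : θ ≤ κ * (S / N))
    (hβ : β = momentum θ L (initialGap F D x₀) σ S K R) (hγ : γ = globalRate a L β S)
    (hη : SmallLocalRate (1 / 150) L β η S K) :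
    AvgGradSqLE F D η γ β S hS K B R x₀
      (4 / a * (L * initialGap F D x₀ / R + L * initialGap F D x₀ / R * (1 / √(θ * S))
          + (L * initialGap F D x₀ * σ / (S * √K * R)) ^ (2 / 3 : ℝ))
        + 4 * (momentumWeight 1 β R / R * (σ ^ 2 / (N * B)))
        + 128 * (β * N * σ ^ 2 / ((S : ℝ) ^ 2 * R * B))
        + 292 * (L * initialGap F D x₀ * σ / (S * √K * R)) ^ (2 / 3 : ℝ)) := by
  have hS' : (0 : ℝ) < S := by exact_mod_cast hS1
  have hΔ : 0 ≤ initialGap F D x₀ := sub_nonneg.2 (ciInf_le hw.bddBelow x₀)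
  have hβ0 : 0 < β := hη.momentum_pos hL (by norm_num) hK
  have hβθ : β ≤ θ := hβ ▸ momentum_le _ _ _ _ _ _ _
  -- `150² = 22500` leaves room for the constant `20000` of the Lyapunov analysis
  have hη1 : (η * K * L) ^ 2 ≤ β ^ 2 / 20000 := by
    have h := hη.sq_le hL (by norm_num) hK
    linarith [sq_nonneg β]
  have hη2 : (η * K * L) ^ 2 ≤ β / S / 20000 := by
    have h := hη.sq_le_div hL (by norm_num) hK
    have : 0 ≤ β / S := by positivity
    linarith
  have hs0 : 0 < √(β * S) := Real.sqrt_pos.2 (by positivity)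
  have hγ0 : 0 < γ := by
    rw [hγ, globalRate]
    exact mul_pos ha (lt_min (by positivity) (by positivity))
  have hγL : γ * L ≤ 1 / 4 := by
    have h1 : a ≤ 1 / 24 := haκ.trans (by gcongr; linarith)
    rw [hγ, globalRate_mul hL]
    calc a * min 1 √(β * S) ≤ 1 / 24 * 1 := by
          gcongr
          exact min_le_left _ _
      _ ≤ 1 / 4 := by norm_num
  have hγ2 := globalRate_cond hL ha hκ haκ (hS1.trans hS) hS1 hβ0 (hβθ.trans hθκ)
  rw [← hγ] at hγ2
  refine (avgGradSqLE_of_smallRates hL hw hs hg hS hS1 hK hR hB hβ0 (hβθ.trans hθ1) hη.1 hη1 hη2 hγ0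
    hγL hγ2).mono ?_
  have h1 := gap_div_globalRate_le (a := a) hL hΔ ha hS1 hR hβ0
  have h2 : L * initialGap F D x₀ / R * (1 / √(β * S)) ≤ _ :=
    hβ ▸ gap_div_sqrt_momentum_le hL hΔ hσ hS1 hK hR (hβ ▸ hβ0)
  have h3 : β * σ ^ 2 / (S * K) ≤ _ :=
    hβ ▸ momentum_mul_noise_le (θ := θ) hL hΔ hσ hS1 hK hR
  rw [← hγ] at h1
  have h4 := mul_le_mul_of_nonneg_left (add_le_add_right h2 (L * initialGap F D x₀ / R))
    (one_div_pos.2 ha).le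
  have e : 4 / a * (L * initialGap F D x₀ / R + L * initialGap F D x₀ / R * (1 / √(θ * S))
          + (L * initialGap F D x₀ * σ / (S * √K * R)) ^ (2 / 3 : ℝ))
      = 4 * (1 / a * (L * initialGap F D x₀ / R + (L * initialGap F D x₀ / R * (1 / √(θ * S))
          + (L * initialGap F D x₀ * σ / (S * √K * R)) ^ (2 / 3 : ℝ)))) := by ring
  rw [e]
  linarith

lemma one_div_sqrt_ratio_mul (hS1 : 1 ≤ S) (N : ℕ) : 1 / √((S : ℝ) / N * S) = √N / S := by
  have hS' : (0 : ℝ) < S := by exact_mod_cast hS1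
  rw [show (S : ℝ) / N * S = S ^ 2 / N by ring, Real.sqrt_div (by positivity),
    Real.sqrt_sq hS'.le, one_div_div]

lemma momentumWeight_one_div_le (hβ0 : 0 < β) (hβ1 : β ≤ 1) (n : ℕ) :
    momentumWeight 1 β n ≤ 1 / β := by
  rw [le_div_iff₀ hβ0, mul_comm]
  exact mul_momentumWeight_le one_pos hβ1 n

/-- The initialization of the first part makes its effect of the order of `βσ²/(SK)`. -/
lemma init_terms_le_of_large_batch (hN : 1 ≤ N) (hS1 : 1 ≤ S) (hK : 1 ≤ K) (hR : 1 ≤ R)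
    (hβ0 : 0 < β) (hβ1 : β ≤ 1) (hB1 : (S : ℝ) * K / (N * R * β ^ 2) ≤ B)
    (hB2 : (N : ℝ) * K / (S * R) ≤ B) :
    4 * (momentumWeight 1 β R / R * (σ ^ 2 / (N * B)))
        + 128 * (β * N * σ ^ 2 / ((S : ℝ) ^ 2 * R * B)) ≤ 132 * (β * σ ^ 2 / (S * K)) := by
  have hS' : (0 : ℝ) < S := by exact_mod_cast hS1
  have hN' : (0 : ℝ) < N := by exact_mod_cast hN
  have hK' : (0 : ℝ) < K := by exact_mod_cast hK
  have hR' : (0 : ℝ) < R := by exact_mod_cast hR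
  have h1 : momentumWeight 1 β R / R * (σ ^ 2 / (N * B)) ≤ β * σ ^ 2 / (S * K) := by
    calc _ ≤ 1 / β / R * (σ ^ 2 / (N * ((S : ℝ) * K / (N * R * β ^ 2)))) := by
          gcongr
          exact momentumWeight_one_div_le hβ0 hβ1 R
      _ = _ := by field_simp
  have h2 : β * N * σ ^ 2 / ((S : ℝ) ^ 2 * R * B) ≤ β * σ ^ 2 / (S * K) := by
    calc _ ≤ β * N * σ ^ 2 / ((S : ℝ) ^ 2 * R * ((N : ℝ) * K / (S * R))) := by gcongr
      _ = _ := by field_simp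
  linarith

/-- With `B` of the order of `SKR/N` and `R` at least of the order of `N/S`, the initialization
costs at most a multiple of `σ²/(SKR)`. -/
lemma init_terms_le_of_linear_batch (hN : 1 ≤ N) (hS1 : 1 ≤ S) (hK : 1 ≤ K) (hR : 1 ≤ R)
    (hβ0 : 0 < β) (hβ1 : β ≤ 1) (hκ : 1 ≤ κ) (hβκ : β ≤ κ * (S / N)) (hRκ : (N : ℝ) / (S * R) ≤ κ)
    {b₁ : ℝ} (hb₁ : 0 < b₁) (hB : b₁ * ((S : ℝ) * K * R / N) ≤ B) :
    4 * (momentumWeight 1 β R / R * (σ ^ 2 / (N * B)))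
        + 128 * (β * N * σ ^ 2 / ((S : ℝ) ^ 2 * R * B))
      ≤ (4 / b₁ + 128 * κ ^ 2 / b₁) * (σ ^ 2 / (S * K * R)) := by
  have hS' : (0 : ℝ) < S := by exact_mod_cast hS1
  have hN' : (0 : ℝ) < N := by exact_mod_cast hN
  have hK' : (0 : ℝ) < K := by exact_mod_cast hK
  have hR' : (0 : ℝ) < R := by exact_mod_cast hR
  have hW : momentumWeight 1 β R / R ≤ 1 := by
    rw [div_le_one hR']
    simpa using momentumWeight_le one_pos hβ0.le hβ1 R
  have h1 : momentumWeight 1 β R / R * (σ ^ 2 / (N * B)) ≤ 1 / b₁ * (σ ^ 2 / (S * K * R)) := by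
    calc _ ≤ 1 * (σ ^ 2 / (N * (b₁ * ((S : ℝ) * K * R / N)))) := by gcongr
      _ = _ := by field_simp
  have h2 : β * N * σ ^ 2 / ((S : ℝ) ^ 2 * R * B) ≤ κ ^ 2 / b₁ * (σ ^ 2 / (S * K * R)) := by
    calc _ ≤ κ * (S / N) * N * σ ^ 2 / ((S : ℝ) ^ 2 * R * (b₁ * ((S : ℝ) * K * R / N))) := by
          gcongr
      _ = κ * (N / (S * R)) / b₁ * (σ ^ 2 / (S * K * R)) := by field_simp
      _ ≤ κ * κ / b₁ * (σ ^ 2 / (S * K * R)) := by gcongr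
      _ = _ := by ring
  calc _ ≤ 4 * (1 / b₁ * (σ ^ 2 / (S * K * R)))
        + 128 * (κ ^ 2 / b₁ * (σ ^ 2 / (S * K * R))) := by linarith
    _ = _ := by ring

end Theorem

end FedLearn

theorem theorem4 :
    -- first choice of the parameters
    (∃ a₀ : ℝ, 0 < a₀ ∧ ∀ a : ℝ, 0 < a → a ≤ a₀ → ∃ b C : ℝ, 0 < b ∧ 0 < C ∧
      ∀ (d N S K R : ℕ) (hS : S ≤ N), 1 ≤ S → 1 ≤ K → 1 ≤ R →
      ∀ (Ξ : Type*) [MeasurableSpace Ξ] (F : FedLearn.Vec d → Ξ → ℝ) (D : Fin N → Measure Ξ)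
        [∀ i, IsProbabilityMeasure (D i)] (x₀ : FedLearn.Vec d) (L σ Δ β γ η : ℝ) (B : ℕ),
      0 < L → 0 ≤ σ →
      FedLearn.WellPosed F D → FedLearn.SampleSmooth F L → FedLearn.StochasticGradient F D σ →
      Δ = FedLearn.initialGap F D x₀ →
      β = FedLearn.momentum ((S : ℝ) / N) L Δ σ S K R →
      γ = FedLearn.globalRate a L β S →
      FedLearn.SmallLocalRate b L β η S K →
      B = ⌈max ((S : ℝ) * K / (N * R * β ^ 2)) ((N : ℝ) * K / (S * R))⌉₊ →
      FedLearn.AvgGradSqLE F D η γ β S hS K B R x₀ (C * FedLearn.mainRate L Δ σ N S K R)) ∧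
    -- initialization with a number of samples of the order of `S K R / N`
    (∀ c b₁ b₂ : ℝ, 0 < c → 0 < b₁ → 0 < b₂ →
      ∃ a₀ : ℝ, 0 < a₀ ∧ ∀ a : ℝ, 0 < a → a ≤ a₀ → ∃ b C : ℝ, 0 < b ∧ 0 < C ∧
      ∀ (d N S K R : ℕ) (hS : S ≤ N), 1 ≤ S → 1 ≤ K → 1 ≤ R → c * ((N : ℝ) / S) ≤ R →
      ∀ (Ξ : Type*) [MeasurableSpace Ξ] (F : FedLearn.Vec d → Ξ → ℝ) (D : Fin N → Measure Ξ)
        [∀ i, IsProbabilityMeasure (D i)] (x₀ : FedLearn.Vec d) (L σ Δ β γ η : ℝ) (B : ℕ),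
      0 < L → 0 ≤ σ →
      FedLearn.WellPosed F D → FedLearn.SampleSmooth F L → FedLearn.StochasticGradient F D σ →
      Δ = FedLearn.initialGap F D x₀ →
      γ = FedLearn.globalRate a L β S →
      FedLearn.SmallLocalRate b L β η S K →
      b₁ * ((S : ℝ) * K * R / N) ≤ B → (B : ℝ) ≤ b₂ * ((S : ℝ) * K * R / N) →
      (β = FedLearn.momentum ((S : ℝ) / N) L Δ σ S K R →
        FedLearn.AvgGradSqLE F D η γ β S hS K B R x₀
          (C * (FedLearn.mainRate L Δ σ N S K R + σ ^ 2 / (S * K * R)))) ∧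
      (β = FedLearn.momentum (1 / (R : ℝ)) L Δ σ S K R →
        FedLearn.AvgGradSqLE F D η γ β S hS K B R x₀
          (C * (FedLearn.mainRate L Δ σ N S K R + σ ^ 2 / (S * K * R)
            + L * Δ / √((S : ℝ) * R))))) := by
  open FedLearn in
  constructor
  · refine ⟨1 / (24 * 1), by norm_num, fun a ha haa => ⟨1 / 150, 4 / a + 424, by norm_num,
      by positivity, ?_⟩⟩
    intro d N S K R hS hS1 hK hR Ξ _ F D _ x₀ L σ Δ β γ η B hL hσ hw hs hg hΔ hβ hγ hη hB
    subst hΔ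
    have hN : 1 ≤ N := hS1.trans hS
    have hS' : (0 : ℝ) < S := by exact_mod_cast hS1
    have hN' : (0 : ℝ) < N := by exact_mod_cast hN
    have hK' : (0 : ℝ) < K := by exact_mod_cast hK
    have hR' : (0 : ℝ) < R := by exact_mod_cast hR
    have hΔ : 0 ≤ initialGap F D x₀ := sub_nonneg.2 (ciInf_le hw.bddBelow x₀)
    have hθ1 : (S : ℝ) / N ≤ 1 := (div_le_one hN').2 (by exact_mod_cast hS)
    have hβ0 : 0 < β := hη.momentum_pos hL (by norm_num) hK
    have hβ1 : β ≤ 1 := (hβ ▸ momentum_le _ _ _ _ _ _ _ : β ≤ _).trans hθ1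
    have hBr : max ((S : ℝ) * K / (N * R * β ^ 2)) ((N : ℝ) * K / (S * R)) ≤ B :=
      hB ▸ Nat.le_ceil _
    have hB1 : 1 ≤ B := by
      rw [hB, Nat.one_le_ceil_iff]
      exact lt_max_of_lt_right (by positivity)
    refine (avgGradSqLE_momentum hL hσ hw hs hg hS hS1 hK hR hB1 le_rfl ha haa hθ1
      (one_mul _).ge hβ hγ hη).mono ?_
    have h1 := init_terms_le_of_large_batch (σ := σ) hN hS1 hK hR hβ0 hβ1
      ((le_max_left _ _).trans hBr) ((le_max_right _ _).trans hBr)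
    have h2 : β * σ ^ 2 / (S * K) ≤ _ :=
      hβ ▸ momentum_mul_noise_le (θ := (S : ℝ) / N) hL hΔ hσ hS1 hK hR
    rw [one_div_sqrt_ratio_mul hS1, mainRate]
    set T := (L * initialGap F D x₀ * σ / (S * √K * R)) ^ (2 / 3 : ℝ)
    have h3 : 0 ≤ L * initialGap F D x₀ / R * (1 + √N / S) := by positivity
    calc _ ≤ 4 / a * (L * initialGap F D x₀ / R + L * initialGap F D x₀ / R * (√N / S) + T)
          + 424 * T := by linarith
      _ ≤ 4 / a * (L * initialGap F D x₀ / R + L * initialGap F D x₀ / R * (√N / S) + T)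
          + 424 * (T + L * initialGap F D x₀ / R * (1 + √N / S)) := by linarith
      _ = _ := by ring
  · intro c b₁ b₂ hc hb₁ _
    -- `κ` bounds `N / (S R)`, which is also the ratio of `1 / R` to `S / N`
    set κ := max 1 (1 / c) with hκdef
    have hκ : 1 ≤ κ := le_max_left _ _
    refine ⟨1 / (24 * κ), by positivity, fun a ha haa => ⟨1 / 150,
      4 / a + 292 + (4 / b₁ + 128 * κ ^ 2 / b₁), by norm_num, by positivity, ?_⟩⟩
    intro d N S K R hS hS1 hK hR hcR Ξ _ F D _ x₀ L σ Δ β γ η B hL hσ hw hs hg hΔ hγ hη hB _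
    subst hΔ
    have hN : 1 ≤ N := hS1.trans hS
    have hS' : (0 : ℝ) < S := by exact_mod_cast hS1
    have hN' : (0 : ℝ) < N := by exact_mod_cast hN
    have hK' : (0 : ℝ) < K := by exact_mod_cast hK
    have hR1 : (1 : ℝ) ≤ R := by exact_mod_cast hR
    have hR' : (0 : ℝ) < R := by linarith
    have hΔ : 0 ≤ initialGap F D x₀ := sub_nonneg.2 (ciInf_le hw.bddBelow x₀)
    have hβ0 : 0 < β := hη.momentum_pos hL (by norm_num) hK
    have hRκ : (N : ℝ) / (S * R) ≤ κ := by
      refine le_trans ?_ (le_max_right _ _)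
      rw [div_le_div_iff₀ (by positivity) hc]
      calc (N : ℝ) * c = c * (N / S) * S := by field_simp
        _ ≤ R * S := by gcongr
        _ = _ := by ring
    have hB1 : 1 ≤ B := by
      have : (0 : ℝ) < B := lt_of_lt_of_le (by positivity) hB
      exact_mod_cast this
    set T := (L * initialGap F D x₀ * σ / (S * √K * R)) ^ (2 / 3 : ℝ) with hT
    have hT0 : 0 ≤ T := by positivity
    set C₁ := 4 / b₁ + 128 * κ ^ 2 / b₁ with hC₁
    have hC₁0 : 0 ≤ C₁ := by positivity
    set s := σ ^ 2 / ((S : ℝ) * K * R) with hsdef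
    have hs0 : 0 ≤ s := by positivity
    have h4a : 0 ≤ 4 / a := by positivity
    constructor
    · intro hβ
      have hθ1 : (S : ℝ) / N ≤ 1 := (div_le_one hN').2 (by exact_mod_cast hS)
      have hθκ : (S : ℝ) / N ≤ κ * (S / N) := le_mul_of_one_le_left (by positivity) hκ
      have hβθ : β ≤ (S : ℝ) / N := hβ ▸ momentum_le _ _ _ _ _ _ _
      refine (avgGradSqLE_momentum hL hσ hw hs hg hS hS1 hK hR hB1 hκ ha haa hθ1 hθκ hβ hγ
        hη).mono ?_
      have h1 := init_terms_le_of_linear_batch (σ := σ) hN hS1 hK hR hβ0 (hβθ.trans hθ1) hκ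
        (hβθ.trans hθκ) hRκ hb₁ hB
      rw [one_div_sqrt_ratio_mul hS1, mainRate, ← hT]
      set o := L * initialGap F D x₀ / R * (1 + √N / S) with ho
      have ho0 : 0 ≤ o := by positivity
      have e : L * initialGap F D x₀ / R + L * initialGap F D x₀ / R * (√N / S) = o := by
        rw [ho]
        ring
      rw [e]
      calc _ ≤ 4 / a * (o + T) + 292 * T + C₁ * s := by linarith
        _ ≤ 4 / a * (T + o + s) + 292 * (T + o + s) + C₁ * (T + o + s) := by
          have e1 : 4 / a * (o + T) ≤ 4 / a * (T + o + s) :=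
            mul_le_mul_of_nonneg_left (by linarith) h4a
          have e2 : C₁ * s ≤ C₁ * (T + o + s) := mul_le_mul_of_nonneg_left (by linarith) hC₁0
          linarith
        _ = _ := by ring
    · intro hβ
      have hθ1 : 1 / (R : ℝ) ≤ 1 := (div_le_one hR').2 hR1
      have hθκ : 1 / (R : ℝ) ≤ κ * (S / N) := by
        calc 1 / (R : ℝ) = N / (S * R) * (S / N) := by field_simp
          _ ≤ κ * (S / N) := by gcongr
      have hβθ : β ≤ 1 / (R : ℝ) := hβ ▸ momentum_le _ _ _ _ _ _ _
      refine (avgGradSqLE_momentum hL hσ hw hs hg hS hS1 hK hR hB1 hκ ha haa hθ1 hθκ hβ hγ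
        hη).mono ?_
      have h1 := init_terms_le_of_linear_batch (σ := σ) hN hS1 hK hR hβ0 (hβθ.trans hθ1) hκ
        (hβθ.trans hθκ) hRκ hb₁ hB
      have h2 : L * initialGap F D x₀ / R * (1 / √(1 / (R : ℝ) * S))
          = L * initialGap F D x₀ / √((S : ℝ) * R) := by
        rw [show 1 / (R : ℝ) * S = S * R / R ^ 2 by field_simp, Real.sqrt_div (by positivity),
          Real.sqrt_sq hR'.le]
        field_simp
      rw [h2, mainRate, ← hT]
      set o := L * initialGap F D x₀ / R * (1 + √N / S) with ho
      set p := L * initialGap F D x₀ / √((S : ℝ) * R)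
      have hp0 : 0 ≤ p := by positivity
      have e : L * initialGap F D x₀ / R ≤ o :=
        le_mul_of_one_le_right (by positivity) (le_add_of_nonneg_right (by positivity))
      have ho0 : 0 ≤ o := by positivity
      calc _ ≤ 4 / a * (L * initialGap F D x₀ / R + p + T) + 292 * T + C₁ * s := by linarith
        _ ≤ 4 / a * (T + o + s + p) + 292 * (T + o + s + p) + C₁ * (T + o + s + p) := by
          have e1 : 4 / a * (L * initialGap F D x₀ / R + p + T) ≤ 4 / a * (T + o + s + p) :=
            mul_le_mul_of_nonneg_left (by linarith) h4a
          have e2 : C₁ * s ≤ C₁ * (T + o + s + p) := mul_le_mul_of_nonneg_left (by linarith) hC₁0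
          linarith
        _ = _ := by ring
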